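/- A polygon is a self-avoiding polygon on the square lattice $\mathbb Z^2$, up to translation; it is rooted in the bottom-left corner if it passes through the bottom-left corner of its minimum bounding rectangle. A rooted polygon is $2$-unimodal if its perimeter exceeds the perimeter of its minimum bounding rectangle by $4$, and $2$-staircase if moreover it passes through the top-right corner of the rectangle. Its left arc is the clockwise boundary walk from the bottom-left corner to the last vertex on the top side of the rectangle. It has two distinct vertical indents on the left arc if the left arc contains exactly two down steps and at least one up step between them; the height of an indent is the height of the lower end of its down step. The generating function of a class of polygons is $\sum_{m,n} p_{2m,2n}x^my^n$, where $p_{2m,2n}$ is the number of polygons in the class with $2m$ horizontal and $2n$ vertical steps. Put $\Delta = 1-2x-2y-2xy+x^2+y^2$, $Z = 1/\sqrt\Delta$, $SP = (1-x-y-\sqrt\Delta)/2$ (where $\sqrt\Delta$ has constant term $1$), $u = x+SP$ and $\mathcal I = u^2/(1-u)^2$. **Proposition.** Let $Q = SP/y$ (resp. $Q = xZ$). The generating function of the $2$-staircase (resp. $2$-unimodal) polygons rooted in the bottom-left corner with two distinct vertical indents on the left arc, at different heights, is $$\tfrac12\, y^5\,\partial_y\bigl(\mathcal I^2\,\partial_y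 Q\bigr).$$ If the two indents are also allowed to be at the same height, the generating function is $$\tfrac12\, y^3\,\partial_y\bigl((y\,\mathcal I)^2\,\partial_y Q\bigr).$$ -/

import Mathlib

noncomputable section

namespace AlmostConvex

/-! ### Self-avoiding polygons rooted at the bottom-left corner of their bounding rectangle -/

/-- Unit steps on the square lattice: up, right, down, left. -/
inductive Step
  | U | R | D | L
  deriving DecidableEq

/-- The displacement of a step. -/
def Step.vec : Step → ℤ × ℤ
  | .U => (0, 1)
  | .R => (1, 0)
  | .D => (0, -1)
  | .L => (-1, 0)

/-- The vertex reached after the first `i` steps of the walk `w` that starts at the origin. -/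
def pos (w : List Step) (i : ℕ) : ℤ × ℤ := ((w.take i).map Step.vec).sum

/-- Self-avoiding polygons whose minimum bounding rectangle has its bottom-left corner at the origin
and which pass through that corner. A polygon is encoded by its clockwise boundary walk from the
origin: the origin has exactly the two neighbours `(0, 1)` and `(1, 0)` on the polygon, and the
clockwise walk is the one whose first step is up. So polygons and words correspond bijectively. -/
structure IsRootedPolygon (w : List Step) : Prop where
  four_le : 4 ≤ w.length
  closed : pos w w.length = 0
  simple : ∀ i j, i < j → j < w.length → pos w i ≠ pos w j
  nonneg : ∀ i ≤ w.length, 0 ≤ (pos w i).1 ∧ 0 ≤ (pos w i).2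
  start : w.head? = some Step.U

/-- Width of the minimum bounding rectangle (for a rooted polygon). -/
def width (w : List Step) : ℕ := (Finset.range (w.length + 1)).sup fun i => (pos w i).1.toNat

/-- Height of the minimum bounding rectangle (for a rooted polygon). -/
def height (w : List Step) : ℕ := (Finset.range (w.length + 1)).sup fun i => (pos w i).2.toNat

/-- Number of horizontal steps. -/
def hsteps (w : List Step) : ℕ := w.count Step.R + w.count Step.L

/-- Number of vertical steps. -/
def vsteps (w : List Step) : ℕ := w.count Step.U + w.count Step.D

/-- `m`-unimodal polygons rooted in the bottom-left corner: they visit the bottom-left corner of the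
minimum bounding rectangle, and their perimeter exceeds that of the rectangle by `2 * m`. -/
def IsUnimodal (m : ℕ) (w : List Step) : Prop :=
  IsRootedPolygon w ∧ w.length = 2 * (width w + height w) + 2 * m

/-- `m`-staircase polygons rooted in the bottom-left corner: they also visit the top-right corner of
the minimum bounding rectangle. -/
def IsStaircase (m : ℕ) (w : List Step) : Prop :=
  IsUnimodal m w ∧ ∃ i ≤ w.length, pos w i = ((width w : ℤ), (height w : ℤ))

/-- The left arc of a rooted polygon: the clockwise walk from the bottom-left corner to the last
vertex on the top side of the minimum bounding rectangle. -/
def leftArc (w : List Step) : List Step :=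
  w.take (((Finset.range (w.length + 1)).filter fun i => (pos w i).2 = (height w : ℤ)).sup id)

/-- The left arc has exactly two vertical indents, both one deep, and their bases (the lower ends of
the two down steps) are at the heights `k₁` (first indent) and `k₂` (second indent). The vertical
steps of the left arc are `a` times up, down, `b` times up, down, `c` times up; the indents are two
distinct ones (rather than a single indent that is two deep) because `1 ≤ b`. -/
def TwoVerticalIndents (w : List Step) (k₁ k₂ : ℕ) : Prop :=
  ∃ a b c : ℕ, 1 ≤ b ∧
    (leftArc w).filter (fun s => s = Step.U ∨ s = Step.D) =
      List.replicate a Step.U ++ [Step.D] ++ List.replicate b Step.U ++ [Step.D] ++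
        List.replicate c Step.U ∧
    k₁ + 1 = a ∧ k₂ + 2 = a + b

/-! ### Generating functions -/

/-- The variable `x`. -/
def x : MvPowerSeries (Fin 2) ℚ := MvPowerSeries.X 0

/-- The variable `y`. -/
def y : MvPowerSeries (Fin 2) ℚ := MvPowerSeries.X 1

/-- The (anisotropic) half-perimeter generating function of a class of polygons: the coefficient of
`x ^ m * y ^ n` is the number of members with `2 * m` horizontal and `2 * n` vertical steps. -/
def genFun (S : Set (List Step)) : MvPowerSeries (Fin 2) ℚ :=
  fun n => ({w ∈ S | hsteps w = 2 * n 0 ∧ vsteps w = 2 * n 1}.ncard : ℚ)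

/-- The sets counted by `genFun` are finite. -/
theorem finite_steps (S : Set (List Step)) (m n : ℕ) :
    {w ∈ S | hsteps w = m ∧ vsteps w = n}.Finite := by
  have : Finite Step := Finite.of_surjective
    (fun i : Fin 4 => match i with | 0 => Step.U | 1 => Step.R | 2 => Step.D | 3 => Step.L) (by
      rintro (_ | _ | _ | _)
      exacts [⟨0, rfl⟩, ⟨1, rfl⟩, ⟨2, rfl⟩, ⟨3, rfl⟩])
  refine (List.finite_length_eq Step (m + n)).subset ?_
  rintro w ⟨-, h1, h2⟩
  have key : ∀ l : List Step, l.length = hsteps l + vsteps l := by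
    intro l
    induction l with
    | nil => rfl
    | cons s l ih =>
      simp only [hsteps, vsteps] at *
      cases s <;> simp <;> omega
  change w.length = m + n
  rw [key, h1, h2]

/-- The discriminant `1 - 2x - 2y - 2xy + x² + y²`. -/
def Δ : MvPowerSeries (Fin 2) ℚ := 1 - 2 * x - 2 * y - 2 * x * y + x ^ 2 + y ^ 2

/-- The square root of `Δ` with constant term `1`: the binomial series `(1 + t) ^ (1 / 2)` at
`t = Δ - 1`. -/
def sqrtΔ : MvPowerSeries (Fin 2) ℚ :=
  (PowerSeries.binomialSeries ℚ (1 / 2 : ℚ)).subst (Δ - 1)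

/-- The generating function `Z = 1 / √Δ` of staircase festoons. -/
def Z : MvPowerSeries (Fin 2) ℚ := sqrtΔ⁻¹

/-- The generating function `(1 - x - y - √Δ) / 2` of staircase polygons. -/
def SP : MvPowerSeries (Fin 2) ℚ := (1 / 2 : ℚ) • (1 - x - y - sqrtΔ)

/-- The series `u = x + SP`. -/
def u : MvPowerSeries (Fin 2) ℚ := x + SP

/-- The generating function `u² / (1 - u)²` of indent factors. -/
def I : MvPowerSeries (Fin 2) ℚ := u ^ 2 * ((1 - u)⁻¹) ^ 2

/-- The partial derivative in `y`. -/
def dy (f : MvPowerSeries (Fin 2) ℚ) : MvPowerSeries (Fin 2) ℚ := MvPowerSeries.pderiv ℚ 1 f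

/-- The quotient `f / y` of a series `f` that is divisible by `y`. -/
def divY (f : MvPowerSeries (Fin 2) ℚ) : MvPowerSeries (Fin 2) ℚ :=
  fun n => MvPowerSeries.coeff (n + Finsupp.single 1 1) f

theorem divY_y_mul (g : MvPowerSeries (Fin 2) ℚ) : divY (y * g) = g := by
  ext n
  change MvPowerSeries.coeff (n + Finsupp.single 1 1) (y * g) = _
  rw [y, mul_comm, MvPowerSeries.X, MvPowerSeries.coeff_add_mul_monomial, mul_one]

theorem hasSubst_Δ : PowerSeries.HasSubst (Δ - 1) := by
  apply PowerSeries.HasSubst.of_constantCoeff_zero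
  simp [Δ, x, y]

theorem sqrtΔ_sq : sqrtΔ ^ 2 = Δ := by
  have h : (PowerSeries.binomialSeries ℚ (1 / 2 : ℚ)) ^ 2 = 1 + PowerSeries.X := by
    rw [pow_two, ← PowerSeries.binomialSeries_add]
    have := PowerSeries.binomialSeries_nat (R := ℚ) (A := ℚ) 1
    norm_num at this ⊢
    exact this
  rw [sqrtΔ, ← PowerSeries.subst_pow hasSubst_Δ, h, PowerSeries.subst_add hasSubst_Δ,
    PowerSeries.subst_X hasSubst_Δ, ← PowerSeries.coe_substAlgHom hasSubst_Δ, map_one]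
  ring

theorem constantCoeff_sqrtΔ : MvPowerSeries.constantCoeff sqrtΔ = 1 := by
  have h0 := PowerSeries.constantCoeff_subst_eq_zero (a := Δ - 1) (by simp [Δ, x, y])
    (PowerSeries.binomialSeries ℚ (1 / 2 : ℚ) - 1) (by simp)
  rw [PowerSeries.subst_sub hasSubst_Δ, map_sub, ← PowerSeries.coe_substAlgHom hasSubst_Δ,
    map_one, map_one, PowerSeries.coe_substAlgHom hasSubst_Δ, sub_eq_zero] at h0
  exact h0

/-- `SP` is divisible by `y`. -/
theorem y_mul_divY_SP : y * divY SP = SP := by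
  have hu : MvPowerSeries.constantCoeff (1 - u) ≠ 0 := by
    simp [u, SP, x, y, constantCoeff_sqrtΔ]
  have h2 : (2 : MvPowerSeries (Fin 2) ℚ) * SP = 1 - x - y - sqrtΔ := by
    rw [two_mul, SP, ← add_smul]
    norm_num
  have hq : (2 : MvPowerSeries (Fin 2) ℚ) * 2 * (SP * (1 - u)) = 2 * 2 * (y * u) := by
    have hs : sqrtΔ = 1 - x - y - 2 * SP := by rw [h2]; ring
    have h := sqrtΔ_sq
    rw [hs, Δ] at h
    rw [u]
    linear_combination -h
  have h20 : (2 : MvPowerSeries (Fin 2) ℚ) ≠ 0 := by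
    intro h
    have := congrArg MvPowerSeries.constantCoeff h
    rw [map_ofNat, map_zero] at this
    norm_num at this
  have hq2 : SP * (1 - u) = y * u := mul_left_cancel₀ (mul_ne_zero h20 h20) hq
  have h3 : SP = y * (u * (1 - u)⁻¹) := by
    rw [← mul_assoc, ← hq2, mul_assoc, MvPowerSeries.mul_inv_cancel _ hu, mul_one]
  rw [h3, divY_y_mul]

end AlmostConvex

end

/-! The two down steps of the left arc use up the whole perimeter excess. Hence the left arc has no
left step, and the right arc never goes up. Read upwards, the right arc first moves right and then
moves left; in the staircase case it never moves left. Cutting such a polygon at a row leaves two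
walks from the bottom-left corner. The one number that decides how they may be continued is the gap
`d` between their ends. The weight is `x` for each left step of the right arc and `y` for each up
step of the left arc; when the gap closes, this is the half-perimeter weight.

Indexed by `d`, the series satisfy linear recurrences (`gf_inc_system`, `gf_dec_system`) whose
solutions are unique because the series of gap `d` is divisible by `x ^ d` (`IncSystem.unique`,
`DecSystem.unique`). Without indents the solution is `y u ^ d / (1 - u)`, where `u` is the root
without constant term of `u² - (1 + x - y) u + x = 0`. The stage in which the right arc has turned
back multiplies this by `decRatio`. An indent consists of two nonempty runs of right steps, hence
two geometric sums, and multiplies by `y * I`.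

The rows above an indent obey the same recurrences with a source term. These are solved by
commutators with multiplication by `y`. Since `∂(y f) = y ∂f + f`, differentiating the solution
without indents gives the solution with one indent. For `T f = ½ ∂(I² ∂f)` one has `T(y f) = y T f +
I ∂(I f)`, and `I ∂(I f)` is, up to a power of `y`, the source left by a second indent in a higher
row. So two indents in different rows give `y ^ 5 T`, and two in the same row give `y ^ 4 I² ∂`. A
pair of gap zero arises from gap one, where `u / (1 - u) = SP / y`; adding the other stage gives `x
Z`.

The bijection with polygons has two halves. `Grow.polygon` shows that closed pairs are polygons.
Conversely `Split.leftOf`, a discrete substitute for the Jordan curve theorem, and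
`arcs_of_unimodal` allow every polygon to be read off row by row (`exists_twice`, `exists_double`).
-/

noncomputable section

namespace AlmostConvex

/-! ### Systems of recurrences for series indexed by a gap -/

/-- Formal power series in `x` and `y`. -/
abbrev Ser := MvPowerSeries (Fin 2) ℚ

/-- Modulo `y ^ n` the sequence is constant, and each of its coefficients vanishes far out. -/
theorem y_pow_dvd_of_tail {n : ℕ} {V : ℕ → Ser} (h : ∀ d, y ^ n ∣ V (d + 1) - V (d + 2))
    (tail : ∀ d, x ^ d ∣ V d) (d : ℕ) : y ^ n ∣ V (d + 1) := by
  rw [y, MvPowerSeries.X_pow_dvd_iff]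
  intro m hm
  have key : ∀ k, MvPowerSeries.coeff m (V (d + 1)) = MvPowerSeries.coeff m (V (d + k + 1)) := by
    intro k
    induction k with
    | zero => rfl
    | succ k ih =>
      have h1 := h (d + k)
      rw [y, MvPowerSeries.X_pow_dvd_iff] at h1
      have h2 := h1 m hm
      rw [map_sub, sub_eq_zero] at h2
      rw [ih, h2]
      rfl
  -- A shift by the `x`-degree of `m` makes the index exceed that degree.
  rw [key (m 0)]
  have h3 := tail (d + m 0 + 1)
  rw [x, MvPowerSeries.X_pow_dvd_iff] at h3
  exact h3 m (by omega)

theorem eq_zero_of_y_pow_dvd {f : Ser} (h : ∀ n, y ^ n ∣ f) : f = 0 := by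
  ext m
  have h1 := h (m 1 + 1)
  rw [y, MvPowerSeries.X_pow_dvd_iff] at h1
  exact h1 m (by omega)

theorem eq_of_tail {p V V' : ℕ → Ser} (hV : ∀ d, V (d + 1) = p (d + 1) + V (d + 2))
    (hV' : ∀ d, V' (d + 1) = p (d + 1) + V' (d + 2)) (tail : ∀ d, x ^ d ∣ V d)
    (tail' : ∀ d, x ^ d ∣ V' d) (d : ℕ) : V (d + 1) = V' (d + 1) := by
  refine sub_eq_zero.1 (eq_zero_of_y_pow_dvd fun n => ?_)
  refine y_pow_dvd_of_tail (V := fun d => V d - V' d) (fun d => ?_)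
    (fun d => dvd_sub (tail d) (tail' d)) d
  have : V (d + 1) - V' (d + 1) - (V (d + 2) - V' (d + 2)) = 0 := by
    rw [hV, hV']; ring
  simp only [this, dvd_zero]

/-- The recurrences satisfied by the increasing part of a level. -/
structure IncSystem (b h Z A B : ℕ → Ser) : Prop where
  z : ∀ d, Z (d + 1) = b (d + 1) + y * B (d + 1)
  a : ∀ d, A (d + 1) = Z (d + 1) + A (d + 2)
  b_zero : B 0 = 0
  b_succ : ∀ d, B (d + 1) = A (d + 1) + h (d + 1) + x * B d
  tail : ∀ d, x ^ d ∣ A d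

/-- The recurrences satisfied by the decreasing part of a level. -/
structure DecSystem (g Z A B : ℕ → Ser) : Prop where
  z : ∀ d, Z (d + 1) = y * B (d + 1)
  a : ∀ d, A (d + 1) = Z (d + 1) + A (d + 2)
  b : ∀ d, B (d + 1) = A (d + 1) + g (d + 1) + B (d + 2)
  tail : ∀ d, x ^ d ∣ A d
  tail_b : ∀ d, x ^ d ∣ B d

/-- Induction on the `y`-adic precision: passing from `B` to `A` gains a factor `y`, the constant of
summation being killed by `tail`, and the recursion started at `B 0 = 0` hands the precision back to
`B`. -/
theorem IncSystem.unique {b h Z A B h' Z' A' B' : ℕ → Ser} (H : IncSystem b h Z A B)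
    (H' : IncSystem b h' Z' A' B') (hh : ∀ d, h (d + 1) = h' (d + 1)) (d : ℕ) :
    A (d + 1) = A' (d + 1) := by
  have key : ∀ n, (∀ d, y ^ n ∣ A (d + 1) - A' (d + 1)) ∧ ∀ d, y ^ n ∣ B d - B' d := by
    intro n
    have hB : ∀ n, (∀ d, y ^ n ∣ A (d + 1) - A' (d + 1)) → ∀ d, y ^ n ∣ B d - B' d := by
      intro n hA d
      induction d with
      | zero => rw [H.b_zero, H'.b_zero, sub_self]; exact dvd_zero _
      | succ d ih =>
        have : B (d + 1) - B' (d + 1) = (A (d + 1) - A' (d + 1)) + x * (B d - B' d) := by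
          rw [H.b_succ, H'.b_succ, hh]; ring
        rw [this]
        exact dvd_add (hA d) (ih.mul_left x)
    induction n with
    | zero => simp
    | succ n ih =>
      have hA : ∀ d, y ^ (n + 1) ∣ A (d + 1) - A' (d + 1) := by
        intro d
        refine y_pow_dvd_of_tail (V := fun d => A d - A' d) (fun d => ?_)
          (fun d => dvd_sub (H.tail d) (H'.tail d)) d
        have : A (d + 1) - A' (d + 1) - (A (d + 2) - A' (d + 2)) =
            y * (B (d + 1) - B' (d + 1)) := by
          rw [H.a, H'.a, H.z, H'.z]; ring
        simp only [this, pow_succ']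
        exact mul_dvd_mul_left y (ih.2 _)
      exact ⟨hA, hB _ hA⟩
  exact sub_eq_zero.1 (eq_zero_of_y_pow_dvd fun n => (key n).1 d)

/-- Here the recursion for `B` runs towards larger gaps and has no initial value, so `tail_b` takes
over that role. -/
theorem DecSystem.unique {g Z A B g' Z' A' B' : ℕ → Ser} (H : DecSystem g Z A B)
    (H' : DecSystem g' Z' A' B') (hg : ∀ d, g (d + 1) = g' (d + 1)) (d : ℕ) :
    A (d + 1) = A' (d + 1) := by
  have key : ∀ n, (∀ d, y ^ n ∣ A (d + 1) - A' (d + 1)) ∧ ∀ d, y ^ n ∣ B (d + 1) - B' (d + 1) := by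
    intro n
    have hB : ∀ n, (∀ d, y ^ n ∣ A (d + 1) - A' (d + 1)) → ∀ d, y ^ n ∣ B (d + 1) - B' (d + 1) := by
      intro n hA d
      refine y_pow_dvd_of_tail (V := fun d => B d - B' d) (fun d => ?_)
        (fun d => dvd_sub (H.tail_b d) (H'.tail_b d)) d
      have : B (d + 1) - B' (d + 1) - (B (d + 2) - B' (d + 2)) = A (d + 1) - A' (d + 1) := by
        rw [H.b, H'.b, hg]; ring
      simp only [this]
      exact hA d
    induction n with
    | zero => simp
    | succ n ih =>
      have hA : ∀ d, y ^ (n + 1) ∣ A (d + 1) - A' (d + 1) := by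
        intro d
        refine y_pow_dvd_of_tail (V := fun d => A d - A' d) (fun d => ?_)
          (fun d => dvd_sub (H.tail d) (H'.tail d)) d
        have : A (d + 1) - A' (d + 1) - (A (d + 2) - A' (d + 2)) =
            y * (B (d + 1) - B' (d + 1)) := by
          rw [H.a, H'.a, H.z, H'.z]; ring
        simp only [this, pow_succ']
        exact mul_dvd_mul_left y (ih.2 _)
      exact ⟨hA, hB _ hA⟩
  exact sub_eq_zero.1 (eq_zero_of_y_pow_dvd fun n => (key n).1 d)

/-! ### The explicit solutions -/

theorem dy_add (f g : Ser) : dy (f + g) = dy f + dy g := map_add _ _ _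

theorem dy_sub (f g : Ser) : dy (f - g) = dy f - dy g := map_sub _ _ _

theorem dy_mul (f g : Ser) : dy (f * g) = f * dy g + g * dy f := by
  simp [dy, Derivation.leibniz]

theorem dy_x : dy x = 0 := by
  simp [dy, x]

theorem dy_y : dy y = 1 := by
  simp [dy, y]

theorem dy_x_mul (f : Ser) : dy (x * f) = x * dy f := by
  rw [dy_mul, dy_x]; ring

theorem dy_y_mul (f : Ser) : dy (y * f) = f + y * dy f := by
  rw [dy_mul, dy_y]; ring

theorem x_pow_dvd_dy {f : Ser} {d : ℕ} (h : x ^ d ∣ f) : x ^ d ∣ dy f := by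
  obtain ⟨g, rfl⟩ := h
  have : dy (x ^ d) = 0 := by
    rw [dy, Derivation.leibniz_pow]
    change d • x ^ (d - 1) • dy x = 0
    simp [dy_x]
  rw [dy_mul, this, mul_zero, add_zero]
  exact dvd_mul_right _ _

theorem constantCoeff_u : MvPowerSeries.constantCoeff u = 0 := by
  simp [u, SP, x, y, constantCoeff_sqrtΔ]

theorem sqrtΔ_eq : sqrtΔ = 1 + x - y - 2 * u := by
  have h2 : (2 : Ser) * SP = 1 - x - y - sqrtΔ := by
    rw [two_mul, SP, ← add_smul]
    norm_num
  rw [u]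
  linear_combination h2

theorem u_quadratic : u ^ 2 - (1 + x - y) * u + x = 0 := by
  have h := sqrtΔ_sq
  rw [sqrtΔ_eq, Δ] at h
  have h4 : (4 : Ser) ≠ 0 := by
    intro h
    have := congrArg MvPowerSeries.constantCoeff h
    rw [map_ofNat, map_zero] at this
    norm_num at this
  refine (mul_eq_zero.1 (?_ : (4 : Ser) * _ = 0)).resolve_left h4
  linear_combination h

/-- The geometric series `1 / (1 - u)`. -/
def geomU : Ser := (1 - u)⁻¹

theorem geomU_mul : geomU * (1 - u) = 1 :=
  MvPowerSeries.inv_mul_cancel _ (by simp [constantCoeff_u])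

/-- The ratio of decreasing to increasing weights, `y u / ((1 - u)² - y)`. -/
def decRatio : Ser := y * u * ((1 - u) ^ 2 - y)⁻¹

theorem decRatio_mul : decRatio * ((1 - u) ^ 2 - y) = y * u := by
  rw [decRatio, mul_assoc, MvPowerSeries.inv_mul_cancel _ (by simp [constantCoeff_u, y]), mul_one]

/-- The quadratic equation in the form that makes `u ^ d` solve the recurrence of the increasing
stage. -/
theorem u_sub_x : u - x = y * u * geomU := by
  linear_combination (-geomU) * u_quadratic - (u - x) * geomU_mul

/-- This is the condition on the factor `κ` under which `κ u ^ d` solves the recurrence of the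
decreasing stage. -/
theorem decRatio_eq : decRatio * (1 - u) = y * decRatio * geomU + y * u * geomU := by
  linear_combination geomU * decRatio_mul - decRatio * (1 - u) * geomU_mul

theorem x_dvd_u : x ∣ u := by
  refine ⟨(1 + x - y - u)⁻¹, ?_⟩
  have h : (1 + x - y - u) * (1 + x - y - u)⁻¹ = 1 :=
    MvPowerSeries.mul_inv_cancel _ (by simp [constantCoeff_u, x, y])
  linear_combination (-u) * h - (1 + x - y - u)⁻¹ * u_quadratic

/-- The basic family `κ u ^ d / (1 - u) ^ k`. -/
def expo (κ : Ser) (k d : ℕ) : Ser := κ * u ^ d * geomU ^ k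

/-- Raising `k` by one is summation over all gaps from `d` on, which is the effect of a run of right
steps of the left walk. -/
theorem expo_succ (κ : Ser) (k d : ℕ) : expo κ (k + 1) d = expo κ k d + expo κ (k + 1) (d + 1) := by
  simp only [expo]
  linear_combination κ * u ^ d * geomU ^ k * geomU_mul

theorem x_pow_dvd_expo (κ : Ser) (k d : ℕ) : x ^ d ∣ expo κ k d :=
  ((pow_dvd_pow_of_dvd x_dvd_u d).mul_left κ).mul_right _

theorem x_pow_dvd_expo_add (κ : Ser) (k d e : ℕ) : x ^ d ∣ expo κ k (d + e) :=
  (pow_dvd_pow x (Nat.le_add_right d e)).trans (x_pow_dvd_expo κ k (d + e))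

theorem I_mul_expo (κ : Ser) (k d : ℕ) : I * expo κ k d = expo κ (k + 2) (d + 2) := by
  simp only [expo, I, geomU]; ring

theorem expo_one_inc (d : ℕ) :
    expo 1 0 (d + 1) - x * expo 1 0 d = y * expo 1 1 (d + 1) := by
  simp only [expo]
  linear_combination u ^ d * u_sub_x

theorem expo_one_dec (d : ℕ) : expo decRatio 0 d - expo decRatio 0 (d + 1) =
    y * (expo decRatio 1 d + expo 1 1 (d + 1)) := by
  simp only [expo]
  linear_combination u ^ d * decRatio_eq

/-- The family `u ^ d` has value `1` at gap zero. Subtracting `x ^ d`, which the operator `B (d + 1)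
- x * B d` annihilates, repairs this and accounts for the bottom row. -/
theorem inc_system_zero : IncSystem (fun d => y * x ^ d) (fun _ => 0) (fun d => y * expo 1 0 d)
    (fun d => y * expo 1 1 d) (fun d => expo 1 0 d - x ^ d) where
  z d := by ring
  a d := by linear_combination y * expo_succ 1 0 (d + 1)
  b_zero := by simp [expo]
  b_succ d := by linear_combination expo_one_inc d
  tail d := (x_pow_dvd_expo _ _ _).mul_left _

theorem dec_system_zero : DecSystem (fun d => y * expo 1 1 (d + 1))
    (fun d => y * expo decRatio 0 d)
    (fun d => y * expo decRatio 1 d) (fun d => expo decRatio 0 d) where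
  z d := by ring
  a d := by linear_combination y * expo_succ decRatio 0 (d + 1)
  b d := by linear_combination expo_one_dec (d + 1)
  tail d := (x_pow_dvd_expo _ _ _).mul_left _
  tail_b d := x_pow_dvd_expo _ _ _

/-! ### Differentiated recurrences and their source terms -/

theorem dy_expo_succ (κ : Ser) (k d : ℕ) :
    dy (expo κ (k + 1) d) = dy (expo κ k d) + dy (expo κ (k + 1) (d + 1)) := by
  rw [← dy_add, ← expo_succ]

/-- The Leibniz term of the factor `y` is the undifferentiated family: this is the source left by an
indent, up to a factor independent of the gap. -/
theorem dy_expo_inc (d : ℕ) : dy (expo 1 0 (d + 1)) - x * dy (expo 1 0 d) =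
    expo 1 1 (d + 1) + y * dy (expo 1 1 (d + 1)) := by
  rw [← dy_y_mul, ← expo_one_inc, dy_sub, dy_x_mul]

theorem dy_dy_expo_inc (d : ℕ) : dy (dy (expo 1 0 (d + 1))) - x * dy (dy (expo 1 0 d)) =
    2 * dy (expo 1 1 (d + 1)) + y * dy (dy (expo 1 1 (d + 1))) := by
  have h := congrArg dy (dy_expo_inc d)
  rw [dy_sub, dy_x_mul, dy_add, dy_y_mul] at h
  linear_combination h

theorem dy_expo_dec (d : ℕ) : dy (expo decRatio 0 d) - dy (expo decRatio 0 (d + 1)) =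
    (expo decRatio 1 d + expo 1 1 (d + 1)) +
      y * (dy (expo decRatio 1 d) + dy (expo 1 1 (d + 1))) := by
  rw [← dy_add, ← dy_y_mul, ← expo_one_dec, dy_sub]

theorem dy_dy_expo_dec (d : ℕ) : dy (dy (expo decRatio 0 d)) - dy (dy (expo decRatio 0 (d + 1))) =
    2 * (dy (expo decRatio 1 d) + dy (expo 1 1 (d + 1))) +
      y * (dy (dy (expo decRatio 1 d)) + dy (dy (expo 1 1 (d + 1)))) := by
  have h := congrArg dy (dy_expo_dec d)
  rw [dy_sub, dy_add, dy_add, dy_y_mul, dy_add] at h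
  linear_combination h

theorem dy_expo_zero_zero : dy (expo 1 0 0) = 0 := by
  simp [expo, dy]

/-- A solution for the inhomogeneity `y ^ n * F * expo κ 1 d`. -/
theorem inc_system_single (n : ℕ) (F : Ser) : IncSystem (fun _ => 0)
    (fun d => y ^ n * (F * expo 1 1 d))
    (fun d => y ^ (n + 1) * (F * dy (expo 1 0 d))) (fun d => y ^ (n + 1) * (F * dy (expo 1 1 d)))
    (fun d => y ^ n * (F * dy (expo 1 0 d))) where
  z d := by ring
  a d := by linear_combination y ^ (n + 1) * F * dy_expo_succ 1 0 (d + 1)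
  b_zero := by simp [dy_expo_zero_zero]
  b_succ d := by linear_combination y ^ n * F * dy_expo_inc d
  tail d := ((x_pow_dvd_dy (x_pow_dvd_expo _ _ _)).mul_left _).mul_left _

theorem dec_system_single (n : ℕ) (F : Ser) : DecSystem
    (fun d => y ^ n * (F * expo decRatio 1 d) + y ^ (n + 1) * (F * dy (expo 1 1 (d + 1))) +
      y ^ n * (F * expo 1 1 (d + 1)))
    (fun d => y ^ (n + 1) * (F * dy (expo decRatio 0 d)))
    (fun d => y ^ (n + 1) * (F * dy (expo decRatio 1 d)))
    (fun d => y ^ n * (F * dy (expo decRatio 0 d))) where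
  z d := by ring
  a d := by linear_combination y ^ (n + 1) * F * dy_expo_succ decRatio 0 (d + 1)
  b d := by linear_combination y ^ n * F * dy_expo_dec (d + 1)
  tail d := ((x_pow_dvd_dy (x_pow_dvd_expo _ _ _)).mul_left _).mul_left _
  tail_b d := ((x_pow_dvd_dy (x_pow_dvd_expo _ _ _)).mul_left _).mul_left _

/-- The family `∂ (I² ∂ f) / 2`. -/
def twice (f : Ser) : Ser := (1 / 2 : ℚ) • dy (I ^ 2 * dy f)

/-- The constant series `1 / 2`. -/
def half : Ser := algebraMap ℚ Ser (1 / 2)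

theorem two_mul_half : 2 * half = 1 := by
  rw [half, ← map_ofNat (algebraMap ℚ Ser), ← map_mul, ← map_one (algebraMap ℚ Ser)]
  norm_num

theorem half_smul (f : Ser) : (1 / 2 : ℚ) • f = half * f := Algebra.smul_def _ _

theorem twice_eq (f : Ser) : twice f = I * dy I * dy f + half * (I ^ 2 * dy (dy f)) := by
  have h2 : dy (I ^ 2) = 2 * (I * dy I) := by rw [pow_two, dy_mul]; ring
  rw [twice, dy_mul, h2, half_smul]
  linear_combination I * dy I * dy f * two_mul_half

theorem twice_add (f g : Ser) : twice (f + g) = twice f + twice g := by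
  simp only [twice, dy_add, mul_add, smul_add]

theorem x_pow_dvd_twice {f : Ser} {d : ℕ} (h : x ^ d ∣ f) : x ^ d ∣ twice f := by
  obtain ⟨g, hg⟩ := x_pow_dvd_dy ((x_pow_dvd_dy h).mul_left (I ^ 2))
  exact ⟨(1 / 2 : ℚ) • g, by rw [twice, hg, mul_smul_comm]⟩

theorem dy_I_mul_expo (κ : Ser) (d : ℕ) :
    dy (I * expo κ 1 d) = I * dy (expo κ 1 d) + expo κ 1 d * dy I := dy_mul _ _

/-- Multiplication by `x` commutes with `twice`, while `twice (y * f) = y * twice f + I * dy (I *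
f)`; the extra term is the shape of a second indent. -/
theorem twice_inc (d : ℕ) : twice (expo 1 0 (d + 1)) - x * twice (expo 1 0 d) =
    y * twice (expo 1 1 (d + 1)) + I * dy (I * expo 1 1 (d + 1)) := by
  rw [twice_eq, twice_eq, twice_eq, dy_I_mul_expo]
  linear_combination half * I ^ 2 * dy_dy_expo_inc d + I * dy I * dy_expo_inc d +
    I ^ 2 * dy (expo 1 1 (d + 1)) * two_mul_half

/-- The same commutator, applied to the sum of the decreasing family and the increasing one that
feeds it. -/
theorem twice_dec (d : ℕ) : twice (expo decRatio 0 d) - twice (expo decRatio 0 (d + 1)) =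
    y * (twice (expo decRatio 1 d) + twice (expo 1 1 (d + 1))) +
      (I * dy (I * expo decRatio 1 d) + I * dy (I * expo 1 1 (d + 1))) := by
  rw [twice_eq, twice_eq, twice_eq, twice_eq, dy_I_mul_expo, dy_I_mul_expo]
  linear_combination half * I ^ 2 * dy_dy_expo_dec d + I * dy I * dy_expo_dec d +
    I ^ 2 * (dy (expo decRatio 1 d) + dy (expo 1 1 (d + 1))) * two_mul_half

theorem twice_expo_succ (κ : Ser) (k d : ℕ) :
    twice (expo κ (k + 1) d) = twice (expo κ k d) + twice (expo κ (k + 1) (d + 1)) := by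
  rw [← twice_add, ← expo_succ]

theorem twice_expo_zero_zero : twice (expo 1 0 0) = 0 := by
  rw [twice, dy_expo_zero_zero, mul_zero, dy, map_zero, smul_zero]

theorem inc_system_twice (n : ℕ) : IncSystem (fun _ => 0)
    (fun d => y ^ n * (I * dy (I * expo 1 1 d)))
    (fun d => y ^ (n + 1) * twice (expo 1 0 d)) (fun d => y ^ (n + 1) * twice (expo 1 1 d))
    (fun d => y ^ n * twice (expo 1 0 d)) where
  z d := by ring
  a d := by linear_combination y ^ (n + 1) * twice_expo_succ 1 0 (d + 1)
  b_zero := by simp [twice_expo_zero_zero]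
  b_succ d := by linear_combination y ^ n * twice_inc d
  tail d := (x_pow_dvd_twice (x_pow_dvd_expo _ _ _)).mul_left _

theorem dec_system_twice (n : ℕ) : DecSystem
    (fun d => y ^ n * (I * dy (I * expo decRatio 1 d)) + y ^ (n + 1) * twice (expo 1 1 (d + 1)) +
      y ^ n * (I * dy (I * expo 1 1 (d + 1))))
    (fun d => y ^ (n + 1) * twice (expo decRatio 0 d))
    (fun d => y ^ (n + 1) * twice (expo decRatio 1 d))
    (fun d => y ^ n * twice (expo decRatio 0 d)) where
  z d := by ring
  a d := by linear_combination y ^ (n + 1) * twice_expo_succ decRatio 0 (d + 1)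
  b d := by linear_combination y ^ n * twice_dec (d + 1)
  tail d := (x_pow_dvd_twice (x_pow_dvd_expo _ _ _)).mul_left _
  tail_b d := (x_pow_dvd_twice (x_pow_dvd_expo _ _ _)).mul_left _

/-! ### Values at gap one -/

theorem expo_one_one_one : expo 1 1 1 = divY SP := by
  have h : SP = y * expo 1 1 1 := by
    have := u_sub_x
    simp only [expo]
    rw [u] at this ⊢
    linear_combination this
  rw [h, divY_y_mul]

theorem expo_add_expo_dec : expo 1 1 1 + expo decRatio 1 1 = x * Z := by
  have hs : MvPowerSeries.constantCoeff sqrtΔ ≠ 0 := by simp [constantCoeff_sqrtΔ]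
  have hne : ((1 - u) ^ 2 - y) ≠ 0 := by
    intro h
    have := congrArg MvPowerSeries.constantCoeff h
    simp [constantCoeff_u, y] at this
  -- Up to the factor `1 - u`, the denominator of `decRatio` is `√Δ`.
  have h1 : (1 - u) * sqrtΔ = (1 - u) ^ 2 - y := by
    rw [sqrtΔ_eq]
    linear_combination u_quadratic
  rw [Z, MvPowerSeries.eq_mul_inv_iff_mul_eq hs]
  have hne' : (1 - u) ≠ 0 := by
    intro h
    rw [h] at h1
    exact hne (by rw [h, ← h1]; ring)
  refine mul_left_cancel₀ hne' ?_
  have h2 : (1 - u) * ((expo 1 1 1 + expo decRatio 1 1) * sqrtΔ) =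
      (expo 1 1 1 + expo decRatio 1 1) * ((1 - u) ^ 2 - y) := by
    rw [← h1]; ring
  rw [h2]
  simp only [expo]
  linear_combination u * geomU * decRatio_mul + (u * (1 - u - y)) * geomU_mul - u_quadratic

section

/-! ### Pairs of partial boundary walks and their generating functions -/

/-- A pair of partial boundary walks of a polygon: a prefix of the boundary word, reversed, and a
suffix of it. -/
abbrev Cfg := List Step × List Step

/-- The weight of a pair: left steps on the right, up steps on the left. -/
def wt (c : Cfg) : Fin 2 →₀ ℕ :=
  Finsupp.single 0 (c.2.count Step.L) + Finsupp.single 1 (c.1.count Step.U)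

theorem wt_apply_zero (c : Cfg) : wt c 0 = c.2.count Step.L := by simp [wt]

theorem wt_apply_one (c : Cfg) : wt c 1 = c.1.count Step.U := by simp [wt]

theorem wt_eq_iff (c : Cfg) (n : Fin 2 →₀ ℕ) :
    wt c = n ↔ c.2.count Step.L = n 0 ∧ c.1.count Step.U = n 1 := by
  rw [← wt_apply_zero, ← wt_apply_one]
  constructor
  · rintro rfl
    exact ⟨rfl, rfl⟩
  · rintro ⟨h0, h1⟩
    ext i
    fin_cases i
    · exact h0
    · exact h1

/-- The generating function of a set of pairs. -/
def gfs (s : Set Cfg) : Ser := fun n => ({c ∈ s | wt c = n}.ncard : ℚ)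

theorem coeff_gfs (s : Set Cfg) (n : Fin 2 →₀ ℕ) :
    MvPowerSeries.coeff n (gfs s) = ({c ∈ s | wt c = n}.ncard : ℚ) := rfl

theorem gfs_empty : gfs ∅ = 0 := by
  ext n
  simp [coeff_gfs]

/-- Finiteness matters because `ncard` sends infinite sets to zero. -/
theorem gfs_union {s t : Set Cfg} (hs : ∀ n, {c ∈ s | wt c = n}.Finite)
    (ht : ∀ n, {c ∈ t | wt c = n}.Finite) (hst : Disjoint s t) :
    gfs (s ∪ t) = gfs s + gfs t := by
  ext n
  rw [map_add, coeff_gfs, coeff_gfs, coeff_gfs, ← Nat.cast_add,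
    ← Set.ncard_union_eq (hst.mono (fun c hc => hc.1) (fun c hc => hc.1)) (hs n) (ht n)]
  congr 2
  ext c
  simp only [Set.mem_ofPred_eq, Set.mem_union, or_and_right]

theorem gfs_image {s : Set Cfg} {f : Cfg → Cfg} (hf : f.Injective) (e : Fin 2 →₀ ℕ)
    (hw : ∀ c, wt (f c) = e + wt c) : gfs (f '' s) = MvPowerSeries.monomial e 1 * gfs s := by
  ext n
  rw [MvPowerSeries.coeff_monomial_mul, coeff_gfs, coeff_gfs, one_mul]
  split_ifs with he
  · rw [← Set.ncard_image_of_injective {c ∈ s | wt c = n - e} hf]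
    congr 2
    ext c
    simp only [Set.mem_ofPred_eq, Set.mem_image]
    constructor
    · rintro ⟨⟨c, hc, rfl⟩, rfl⟩
      exact ⟨c, ⟨hc, by rw [hw, add_tsub_cancel_left]⟩, rfl⟩
    · rintro ⟨c, ⟨hc, h2⟩, rfl⟩
      exact ⟨⟨c, hc, rfl⟩, by rw [hw, h2, add_tsub_cancel_of_le he]⟩
  · rw [Nat.cast_eq_zero]
    convert Set.ncard_empty Cfg
    ext c
    simp only [Set.mem_ofPred_eq, Set.mem_image, Set.mem_empty_iff_false, iff_false]
    rintro ⟨⟨c, hc, rfl⟩, rfl⟩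
    exact he (by rw [hw]; exact le_self_add)

/-- Put a step on each of the two walks. -/
def push (p q : List Step) (c : Cfg) : Cfg := (p ++ c.1, q ++ c.2)

theorem push_injective (p q : List Step) : (push p q).Injective := by
  rintro ⟨a, b⟩ ⟨a', b'⟩ h
  simp only [push, Prod.mk.injEq, List.append_cancel_left_eq] at h
  rw [h.1, h.2]

theorem gfs_push (p q : List Step) (s : Set Cfg) : gfs (push p q '' s) =
    x ^ q.count Step.L * y ^ p.count Step.U * gfs s := by
  rw [gfs_image (push_injective p q)
    (Finsupp.single 0 (q.count Step.L) + Finsupp.single 1 (p.count Step.U))]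
  · rw [x, y, MvPowerSeries.X_pow_eq, MvPowerSeries.X_pow_eq, MvPowerSeries.monomial_mul_monomial,
      one_mul]
  · intro c
    simp only [wt, push, List.count_append, Finsupp.single_add]
    abel

/-- The numerical constraints on a pair of partial walks with gap `d`. -/
structure Bal (d : ℕ) (c : Cfg) : Prop where
  gap : c.2.count Step.L = d + c.1.count Step.R + c.2.count Step.R
  left : c.1.count Step.L = 0
  right : c.2.count Step.U = 0
  vert : c.1.count Step.D + c.2.count Step.D ≤ c.1.count Step.U

theorem length_eq_counts (l : List Step) :
    l.length = l.count Step.U + l.count Step.R + l.count Step.D + l.count Step.L := by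
  induction l with
  | nil => rfl
  | cons s l ih => cases s <;> simp <;> omega

instance : Finite Step := Finite.of_surjective
  (fun i : Fin 4 => match i with | 0 => Step.U | 1 => Step.R | 2 => Step.D | 3 => Step.L) (by
    rintro (_ | _ | _ | _)
    exacts [⟨0, rfl⟩, ⟨1, rfl⟩, ⟨2, rfl⟩, ⟨3, rfl⟩])

/-- The weight bounds every step count: `gap` bounds the right steps by the left steps of the right
walk, and `vert` bounds the down steps by the up steps of the left walk. -/
theorem finite_of_bal {s : Set Cfg} (h : ∀ c ∈ s, ∃ d, Bal d c) (n : Fin 2 →₀ ℕ) :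
    {c ∈ s | wt c = n}.Finite := by
  refine Set.Finite.subset ((List.finite_length_le Step (n 0 + n 1 + n 1)).prod
    (List.finite_length_le Step (n 0 + n 1 + n 0))) ?_
  rintro c ⟨hc, hw⟩
  obtain ⟨d, hd⟩ := h c hc
  rw [wt_eq_iff] at hw
  have h1 := hd.gap
  have h2 := hd.left
  have h3 := hd.right
  have h4 := hd.vert
  constructor
  · change c.1.length ≤ _
    rw [length_eq_counts]; omega
  · change c.2.length ≤ _
    rw [length_eq_counts]; omega

theorem gfs_union_of_bal {r s t : Set Cfg} {d : ℕ} (h : r = s ∪ t) (hr : ∀ c ∈ r, Bal d c)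
    (hst : Disjoint s t) : gfs r = gfs s + gfs t := by
  subst h
  exact gfs_union (finite_of_bal fun c hc => ⟨d, hr c (Or.inl hc)⟩)
    (finite_of_bal fun c hc => ⟨d, hr c (Or.inr hc)⟩) hst

/-- The generating functions of a family of sets of pairs. -/
def gf (X : ℕ → Cfg → Prop) (d : ℕ) : Ser := gfs {c | X d c}

theorem gf_tail {X : ℕ → Cfg → Prop} (h : ∀ d c, X d c → Bal d c) (d : ℕ) : x ^ d ∣ gf X d := by
  rw [x, MvPowerSeries.X_pow_dvd_iff]
  intro m hm
  rw [gf, coeff_gfs, Nat.cast_eq_zero]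
  convert Set.ncard_empty Cfg
  ext c
  simp only [Set.mem_ofPred_eq, Set.mem_empty_iff_false, iff_false]
  rintro ⟨hc, hw⟩
  have := (h d c hc).gap
  rw [wt_eq_iff] at hw
  omega

/-! ### Growing the walks -/

/-- A vertical step followed by at least one right step, put on the left walk. -/
inductive Turn (s : Step) (X : ℕ → Cfg → Prop) : ℕ → Cfg → Prop
  | start {d : ℕ} {Q S : List Step} : X (d + 2) (Q, S) → Turn s X (d + 1) (Step.R :: s :: Q, S)
  | step {d : ℕ} {Q S : List Step} : Turn s X (d + 2) (Q, S) → Turn s X (d + 1) (Step.R :: Q, S)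

/-- An indent put on the left walk. -/
def Indent (X : ℕ → Cfg → Prop) : ℕ → Cfg → Prop := Turn Step.D (Turn Step.U X)

/-- Whether the right walk, read upwards, has started to go left. -/
inductive Stage
  | inc | dec

/-- What the two walks have done in the current row. -/
inductive Phase
  | row | left | right

/-- The pairs of partial walks that are built row by row from the pairs in `base`; in each row the
left walk goes right, and may use an indent provided by `h`, then the right walk moves, then both go
up. -/
inductive Grow (base : ℕ → Cfg → Prop) (h : Stage → ℕ → Cfg → Prop) :
    Stage → Phase → ℕ → Cfg → Prop
  | base {d : ℕ} {c : Cfg} : base d c → Grow base h .inc .row d c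
  | row {σ : Stage} {d : ℕ} {Q S : List Step} :
      Grow base h σ .right d (Q, S) → Grow base h σ .row d (Step.U :: Q, Step.D :: S)
  | left {σ : Stage} {d : ℕ} {c : Cfg} : Grow base h σ .row d c → Grow base h σ .left d c
  | left_step {σ : Stage} {d : ℕ} {Q S : List Step} :
      Grow base h σ .left (d + 1) (Q, S) → Grow base h σ .left d (Step.R :: Q, S)
  | right {σ : Stage} {d : ℕ} {c : Cfg} :
      Grow base h σ .left (d + 1) c → Grow base h σ .right (d + 1) c
  | indent {σ : Stage} {d : ℕ} {c : Cfg} : h σ d c → Grow base h σ .right d c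
  | inc_step {d : ℕ} {Q S : List Step} :
      Grow base h .inc .right d (Q, S) → Grow base h .inc .right (d + 1) (Q, Step.L :: S)
  | dec_step {d : ℕ} {Q S : List Step} :
      Grow base h .dec .right (d + 2) (Q, S) → Grow base h .dec .right (d + 1) (Q, Step.R :: S)
  | switch {d : ℕ} {Q S : List Step} :
      Grow base h .inc .left (d + 2) (Q, S) → Grow base h .dec .right (d + 1) (Q, Step.R :: S)
  | switch_indent {d : ℕ} {Q S : List Step} :
      h .inc (d + 2) (Q, S) → Grow base h .dec .right (d + 1) (Q, Step.R :: S)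

/-- The vertical steps of a walk. -/
def verts (l : List Step) : List Step := l.filter fun s => s = Step.U ∨ s = Step.D

/-- The last vertical step of the left walk, the state of the right walk. -/
structure Shape (s : Step) (σ : Stage) (d : ℕ) (c : Cfg) : Prop where
  bal : Bal d c
  last : (verts c.1).head? = some s
  head : c.2.head? = some Step.D
  stage : Step.R ∈ c.2 ↔ σ = .dec

/-- A turn upwards leaves one up step unmatched, and the turn downwards that completes an indent
spends it; hence the strict slack in the hypothesis for `D` and in the conclusion for `U`. -/
theorem Turn.shape {s t : Step} {σ : Stage} {X : ℕ → Cfg → Prop}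
    (hX : ∀ d c, X d c → Shape t σ d c) (hs : s = Step.U ∨ s = Step.D ∧ ∀ d c, X d c →
      c.1.count Step.D + c.2.count Step.D + 1 ≤ c.1.count Step.U) {d : ℕ} {c : Cfg}
    (h : Turn s X d c) : Shape s σ d c ∧ 1 ≤ d ∧ c.1.head? = some Step.R ∧
      (s = Step.U → c.1.count Step.D + c.2.count Step.D + 1 ≤ c.1.count Step.U) := by
  induction h with
  | @start d Q S h =>
    have hc := hX _ _ h
    obtain ⟨⟨h1, h2, h3, h4⟩, -, h6, h7⟩ := hc
    refine ⟨⟨⟨?_, ?_, ?_, ?_⟩, ?_, h6, h7⟩, by omega, rfl, ?_⟩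
    all_goals rcases hs with rfl | ⟨rfl, hs⟩
    all_goals try have h8 := hs _ _ h
    all_goals simp_all [verts] <;> omega
  | @step d Q S h ih =>
    obtain ⟨⟨⟨h1, h2, h3, h4⟩, h5, h6, h7⟩, h8, h9, h10⟩ := ih
    refine ⟨⟨⟨?_, ?_, ?_, ?_⟩, ?_, h6, h7⟩, by omega, rfl, ?_⟩
    all_goals simp_all [verts] <;> omega

theorem Indent.shape {t : Step} {σ : Stage} {X : ℕ → Cfg → Prop}
    (hX : ∀ d c, X d c → Shape t σ d c) {d : ℕ} {c : Cfg} (h : Indent X d c) :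
    Shape Step.D σ d c ∧ 1 ≤ d := by
  have hU : ∀ d c, Turn Step.U X d c → _ := fun d c => Turn.shape hX (Or.inl rfl)
  obtain ⟨h1, h2, -⟩ := Turn.shape (fun d c hc => (hU d c hc).1)
    (Or.inr ⟨rfl, fun d c hc => (hU d c hc).2.2.2 rfl⟩) h
  exact ⟨h1, h2⟩

/-- Removing the last right step leaves either a shorter turn or the bare vertical step, and the
step then on top tells which. -/
theorem gf_turn {s t : Step} {σ : Stage} {X : ℕ → Cfg → Prop}
    (hX : ∀ d c, X d c → Shape t σ d c) (hs : s = Step.U ∨ s = Step.D ∧ ∀ d c, X d c →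
      c.1.count Step.D + c.2.count Step.D + 1 ≤ c.1.count Step.U) (d : ℕ) :
    gf (Turn s X) (d + 1) = y ^ [s].count Step.U * gf X (d + 2) + gf (Turn s X) (d + 2) := by
  have h : {c | Turn s X (d + 1) c} =
      push [Step.R, s] [] '' {c | X (d + 2) c} ∪ push [Step.R] [] '' {c | Turn s X (d + 2) c} := by
    ext c
    simp only [Set.mem_ofPred_eq, Set.mem_union, Set.mem_image]
    constructor
    · intro h
      cases h with
      | start h => exact Or.inl ⟨_, h, rfl⟩
      | step h => exact Or.inr ⟨_, h, rfl⟩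
    · rintro (⟨c, h, rfl⟩ | ⟨c, h, rfl⟩)
      · exact Turn.start h
      · exact Turn.step h
  rw [gf, gfs_union_of_bal h fun c hc => (Turn.shape hX hs hc).1.bal, gfs_push, gfs_push]
  · simp [gf]
  · rw [Set.disjoint_left]
    rintro _ ⟨c, hc, rfl⟩ ⟨c', hc', h'⟩
    have h1 := (Turn.shape hX hs hc').2.2.1
    simp only [push, Prod.mk.injEq, List.cons_append, List.nil_append, List.cons.injEq,
      true_and] at h'
    rw [h'.1] at h1
    simp only [List.head?_cons, Option.some.injEq] at h1
    rcases hs with rfl | ⟨rfl, -⟩ <;> cases h1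

/-- What is needed of the data of `Grow`. -/
structure GrowData (base : ℕ → Cfg → Prop) (h : Stage → ℕ → Cfg → Prop) : Prop where
  base : ∀ d c, base d c → Shape Step.U .inc d c ∧ 1 ≤ d ∧ c.1 = [Step.U]
  indent : ∀ σ d c, h σ d c → Shape Step.D σ d c ∧ 1 ≤ d

variable {base : ℕ → Cfg → Prop} {h : Stage → ℕ → Cfg → Prop}

theorem ne_nil_of_verts_head? {l : List Step} {s : Step} (h : (verts l).head? = some s) :
    l ≠ [] := by
  rintro rfl
  cases h

/-- These invariants make the rules unambiguous: the last rule used can be recovered from the pair,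
so the unions in the recurrences are disjoint. -/
theorem Grow.shape (H : GrowData base h) {σ : Stage} {φ : Phase} {d : ℕ} {c : Cfg}
    (hc : Grow base h σ φ d c) : Bal d c ∧ (Step.R ∈ c.2 ↔ σ = .dec) ∧
      match φ with
      | .row => 1 ≤ d ∧ c.1.head? = some Step.U ∧ c.2.head? = some Step.D
      | .left => (verts c.1).head? = some Step.U ∧ c.2.head? = some Step.D
      | .right => 1 ≤ d ∧ c.1 ≠ [] := by
  induction hc with
  | base hc =>
    obtain ⟨h1, h2, h3⟩ := H.base _ _ hc
    exact ⟨h1.bal, h1.stage, h2, by rw [h3]; rfl, h1.head⟩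
  | row _ ih =>
    obtain ⟨⟨h1, h2, h3, h4⟩, h5, h6, h7⟩ := ih
    refine ⟨⟨?_, ?_, ?_, ?_⟩, ?_, h6, rfl, rfl⟩ <;> simp_all <;> omega
  | @left _ _ c _ ih =>
    obtain ⟨h1, h2, h3, h4, h5⟩ := ih
    refine ⟨h1, h2, ?_, h5⟩
    obtain ⟨_ | ⟨s, Q⟩, S⟩ := c <;> simp_all [verts]
  | left_step _ ih =>
    obtain ⟨⟨h1, h2, h3, h4⟩, h5, h6, h7⟩ := ih
    refine ⟨⟨?_, ?_, ?_, ?_⟩, h5, ?_, h7⟩ <;> simp_all [verts] <;> omega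
  | right _ ih => exact ⟨ih.1, ih.2.1, by omega, ne_nil_of_verts_head? ih.2.2.1⟩
  | indent hc =>
    obtain ⟨h1, h2⟩ := H.indent _ _ _ hc
    exact ⟨h1.bal, h1.stage, h2, ne_nil_of_verts_head? h1.last⟩
  | inc_step _ ih =>
    obtain ⟨⟨h1, h2, h3, h4⟩, h5, h6, h7⟩ := ih
    refine ⟨⟨?_, ?_, ?_, ?_⟩, ?_, by omega, h7⟩ <;> simp_all <;> omega
  | dec_step _ ih =>
    obtain ⟨⟨h1, h2, h3, h4⟩, h5, h6, h7⟩ := ih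
    refine ⟨⟨?_, ?_, ?_, ?_⟩, ?_, by omega, h7⟩ <;> simp_all <;> omega
  | switch _ ih =>
    obtain ⟨⟨h1, h2, h3, h4⟩, h5, h6, h7⟩ := ih
    refine ⟨⟨?_, ?_, ?_, ?_⟩, ?_, by omega, ne_nil_of_verts_head? h6⟩ <;> simp_all <;> omega
  | switch_indent hc =>
    obtain ⟨⟨⟨h1, h2, h3, h4⟩, h5, h6, h7⟩, h8⟩ := H.indent _ _ _ hc
    refine ⟨⟨?_, ?_, ?_, ?_⟩, ?_, by omega, ne_nil_of_verts_head? h5⟩ <;> simp_all <;> omega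

theorem Grow.shape_left (H : GrowData base h) {σ : Stage} {d : ℕ} {c : Cfg}
    (hc : Grow base h σ .left d c) : Shape Step.U σ d c :=
  have h1 := Grow.shape H hc
  ⟨h1.1, h1.2.2.1, h1.2.2.2, h1.2.1⟩

theorem gf_inc_row (H : GrowData base h) (d : ℕ) : gf (Grow base h .inc .row) (d + 1) =
    gf base (d + 1) + y * gf (Grow base h .inc .right) (d + 1) := by
  have h1 : {c | Grow base h .inc .row (d + 1) c} = {c | base (d + 1) c} ∪
      push [Step.U] [Step.D] '' {c | Grow base h .inc .right (d + 1) c} := by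
    ext c
    simp only [Set.mem_ofPred_eq, Set.mem_union, Set.mem_image]
    constructor
    · intro hc
      cases hc with
      | base hc => exact Or.inl hc
      | row hc => exact Or.inr ⟨_, hc, rfl⟩
    · rintro (hc | ⟨c, hc, rfl⟩)
      · exact Grow.base hc
      · exact Grow.row hc
  rw [gf, gfs_union_of_bal h1 fun c hc => (Grow.shape H hc).1, gfs_push]
  · simp [gf]
  · rw [Set.disjoint_left]
    rintro _ hc ⟨c', hc', rfl⟩
    have h2 := (H.base _ _ hc).2.2
    have h3 := (Grow.shape H hc').2.2.2
    simp [push] at h2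
    exact h3 h2

theorem gf_dec_row (d : ℕ) : gf (Grow base h .dec .row) (d + 1) =
    y * gf (Grow base h .dec .right) (d + 1) := by
  have h1 : {c | Grow base h .dec .row (d + 1) c} =
      push [Step.U] [Step.D] '' {c | Grow base h .dec .right (d + 1) c} := by
    ext c
    simp only [Set.mem_ofPred_eq, Set.mem_image]
    constructor
    · intro hc
      cases hc with
      | row hc => exact ⟨_, hc, rfl⟩
    · rintro ⟨c, hc, rfl⟩
      exact Grow.row hc
  rw [gf, h1, gfs_push]
  simp [gf]

theorem gf_left (H : GrowData base h) (σ : Stage) (d : ℕ) : gf (Grow base h σ .left) d =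
    gf (Grow base h σ .row) d + gf (Grow base h σ .left) (d + 1) := by
  have h1 : {c | Grow base h σ .left d c} = {c | Grow base h σ .row d c} ∪
      push [Step.R] [] '' {c | Grow base h σ .left (d + 1) c} := by
    ext c
    simp only [Set.mem_ofPred_eq, Set.mem_union, Set.mem_image]
    constructor
    · intro hc
      cases hc with
      | left hc => exact Or.inl hc
      | left_step hc => exact Or.inr ⟨_, hc, rfl⟩
    · rintro (hc | ⟨c, hc, rfl⟩)
      · exact Grow.left hc
      · exact Grow.left_step hc
  rw [gf, gfs_union_of_bal h1 fun c hc => (Grow.shape H hc).1, gfs_push]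
  · simp [gf]
  · rw [Set.disjoint_left]
    rintro _ hc ⟨c', hc', rfl⟩
    have h2 := (Grow.shape H hc).2.2.2.1
    simp [push] at h2

/-- The last vertical step of the left walk is up without an indent in the current row and down
after one. -/
theorem disjoint_left_indent (H : GrowData base h) (σ : Stage) (d : ℕ) :
    Disjoint {c | Grow base h σ .left d c} {c | h σ d c} := by
  rw [Set.disjoint_left]
  intro c hc hc'
  have h1 := (Grow.shape H hc).2.2.1
  rw [(H.indent _ _ _ hc').1.last] at h1
  cases h1

theorem gf_inc_right_zero (H : GrowData base h) (σ : Stage) :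
    gf (Grow base h σ .right) 0 = 0 := by
  rw [gf, ← gfs_empty]
  congr 1
  ext c
  simp only [Set.mem_ofPred_eq, Set.mem_empty_iff_false, iff_false]
  intro hc
  have := (Grow.shape H hc).2.2.1
  omega

theorem gf_inc_right (H : GrowData base h) (d : ℕ) : gf (Grow base h .inc .right) (d + 1) =
    gf (Grow base h .inc .left) (d + 1) + gf (h .inc) (d + 1) +
      x * gf (Grow base h .inc .right) d := by
  have h1 : {c | Grow base h .inc .right (d + 1) c} =
      ({c | Grow base h .inc .left (d + 1) c} ∪ {c | h .inc (d + 1) c}) ∪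
      push [] [Step.L] '' {c | Grow base h .inc .right d c} := by
    ext c
    simp only [Set.mem_ofPred_eq, Set.mem_union, Set.mem_image]
    constructor
    · intro hc
      cases hc with
      | right hc => exact Or.inl (Or.inl hc)
      | indent hc => exact Or.inl (Or.inr hc)
      | inc_step hc => exact Or.inr ⟨_, hc, rfl⟩
    · rintro ((hc | hc) | ⟨c, hc, rfl⟩)
      · exact Grow.right hc
      · exact Grow.indent hc
      · exact Grow.inc_step hc
  have h2 : ∀ c ∈ {c | Grow base h .inc .right (d + 1) c}, Bal (d + 1) c :=
    fun c hc => (Grow.shape H hc).1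
  rw [gf, gfs_union_of_bal h1 h2, gfs_union_of_bal rfl fun c hc => h2 c (h1 ▸ Or.inl hc), gfs_push]
  · simp [gf]
  · exact disjoint_left_indent H _ _
  -- Before its first horizontal move in a row the right walk begins with `D`.
  · rw [Set.disjoint_left]
    rintro _ (hc | hc) ⟨c', hc', rfl⟩
    · have h3 := (Grow.shape H hc).2.2.2
      simp [push] at h3
    · have h3 := (H.indent _ _ _ hc).1.head
      simp [push] at h3

theorem gf_dec_right (H : GrowData base h) (d : ℕ) : gf (Grow base h .dec .right) (d + 1) =
    gf (Grow base h .dec .left) (d + 1) + (gf (h .dec) (d + 1) +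
      gf (Grow base h .inc .left) (d + 2) + gf (h .inc) (d + 2)) +
      gf (Grow base h .dec .right) (d + 2) := by
  have h1 : {c | Grow base h .dec .right (d + 1) c} =
      ({c | Grow base h .dec .left (d + 1) c} ∪ {c | h .dec (d + 1) c}) ∪
      push [] [Step.R] '' (({c | Grow base h .inc .left (d + 2) c} ∪ {c | h .inc (d + 2) c}) ∪
        {c | Grow base h .dec .right (d + 2) c}) := by
    ext c
    simp only [Set.mem_ofPred_eq, Set.mem_union, Set.mem_image]
    constructor
    · intro hc
      cases hc with
      | right hc => exact Or.inl (Or.inl hc)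
      | indent hc => exact Or.inl (Or.inr hc)
      | switch hc => exact Or.inr ⟨_, Or.inl (Or.inl hc), rfl⟩
      | switch_indent hc => exact Or.inr ⟨_, Or.inl (Or.inr hc), rfl⟩
      | dec_step hc => exact Or.inr ⟨_, Or.inr hc, rfl⟩
    · rintro ((hc | hc) | ⟨c, (hc | hc) | hc, rfl⟩)
      · exact Grow.right hc
      · exact Grow.indent hc
      · exact Grow.switch hc
      · exact Grow.switch_indent hc
      · exact Grow.dec_step hc
  have h2 : ∀ c ∈ {c | Grow base h .dec .right (d + 1) c}, Bal (d + 1) c :=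
    fun c hc => (Grow.shape H hc).1
  have h3 : ∀ c ∈ ({c | Grow base h .inc .left (d + 2) c} ∪ {c | h .inc (d + 2) c}) ∪
        {c | Grow base h .dec .right (d + 2) c}, Bal (d + 2) c := by
    rintro c ((hc | hc) | hc)
    · exact (Grow.shape H hc).1
    · exact (H.indent _ _ _ hc).1.bal
    · exact (Grow.shape H hc).1
  rw [gf, gfs_union_of_bal h1 h2, gfs_union_of_bal rfl fun c hc => h2 c (h1 ▸ Or.inl hc), gfs_push,
    gfs_union_of_bal rfl h3, gfs_union_of_bal rfl fun c hc => h3 c (Or.inl hc)]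
  · simp only [gf, List.count_nil, pow_zero, mul_one,
      show List.count Step.L [Step.R] = 0 from rfl, one_mul]
    ring
  · exact disjoint_left_indent H _ _
  -- Only the decreasing stage has a right step on the right walk.
  · rw [Set.disjoint_left]
    rintro c (hc | hc) hc'
    · exact absurd ((Grow.shape H hc).2.1.1 ((Grow.shape H hc').2.1.2 rfl)) (by simp)
    · exact absurd ((H.indent _ _ _ hc).1.stage.1 ((Grow.shape H hc').2.1.2 rfl)) (by simp)
  · exact disjoint_left_indent H _ _
  · rw [Set.disjoint_left]
    rintro _ (hc | hc) ⟨c', hc', rfl⟩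
    · have h3 := (Grow.shape H hc).2.2.2
      simp [push] at h3
    · have h3 := (H.indent _ _ _ hc).1.head
      simp [push] at h3

theorem gf_inc_system (H : GrowData base h) : IncSystem (gf base) (gf (h .inc))
    (gf (Grow base h .inc .row)) (gf (Grow base h .inc .left)) (gf (Grow base h .inc .right)) where
  z := gf_inc_row H
  a _ := gf_left H _ _
  b_zero := gf_inc_right_zero H _
  b_succ := gf_inc_right H
  tail := gf_tail fun _ _ hc => (Grow.shape H hc).1

theorem gf_dec_system (H : GrowData base h) : DecSystem
    (fun d => gf (h .dec) d + gf (Grow base h .inc .left) (d + 1) + gf (h .inc) (d + 1))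
    (gf (Grow base h .dec .row)) (gf (Grow base h .dec .left)) (gf (Grow base h .dec .right)) where
  z := gf_dec_row
  a _ := gf_left H _ _
  b := gf_dec_right H
  tail := gf_tail fun _ _ hc => (Grow.shape H hc).1
  tail_b := gf_tail fun _ _ hc => (Grow.shape H hc).1

/-- A complete row has positive gap, so gap zero is reached only by a last right step from gap one,
which has weight `1`. -/
theorem gf_left_zero (H : GrowData base h) (σ : Stage) :
    gf (Grow base h σ .left) 0 = gf (Grow base h σ .left) 1 := by
  rw [gf_left H]
  refine add_eq_right.2 ?_
  rw [gf, ← gfs_empty]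
  congr 1
  ext c
  simp only [Set.mem_ofPred_eq, Set.mem_empty_iff_false, iff_false]
  intro hc
  have := (Grow.shape H hc).2.2.1
  omega

/-! ### The levels -/

/-- The bottom row. -/
def bottom (d : ℕ) (c : Cfg) : Prop :=
  1 ≤ d ∧ c = ([Step.U], Step.D :: List.replicate d Step.L)

/-- No pairs. -/
def nothing (_ : ℕ) (_ : Cfg) : Prop := False

/-- Pairs without indents. -/
def Plain : Stage → Phase → ℕ → Cfg → Prop := Grow bottom fun _ => nothing

/-- Pairs with one indent. -/
def Once : Stage → Phase → ℕ → Cfg → Prop := Grow nothing fun σ => Indent (Plain σ .left)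

/-- Pairs with two indents in different rows. -/
def Twice : Stage → Phase → ℕ → Cfg → Prop := Grow nothing fun σ => Indent (Once σ .left)

/-- Pairs with two indents in the same row. -/
def Double : Stage → Phase → ℕ → Cfg → Prop :=
  Grow nothing fun σ => Indent (Indent (Plain σ .left))

theorem growData_plain : GrowData bottom fun _ => nothing where
  base := by
    rintro d c ⟨hd, rfl⟩
    refine ⟨⟨⟨?_, ?_, ?_, ?_⟩, rfl, rfl, ?_⟩, hd, rfl⟩ <;> simp [List.count_replicate]
  indent _ _ _ hc := hc.elim

theorem growData_once : GrowData nothing fun σ => Indent (Plain σ .left) where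
  base _ _ hc := hc.elim
  indent _ _ _ hc := Indent.shape (fun _ _ hc => Grow.shape_left growData_plain hc) hc

theorem growData_twice : GrowData nothing fun σ => Indent (Once σ .left) where
  base _ _ hc := hc.elim
  indent _ _ _ hc := Indent.shape (fun _ _ hc => Grow.shape_left growData_once hc) hc

theorem growData_double : GrowData nothing fun σ => Indent (Indent (Plain σ .left)) where
  base _ _ hc := hc.elim
  indent _ _ _ hc := Indent.shape (fun _ _ hc => (growData_once.indent _ _ _ hc).1) hc

theorem gf_nothing (d : ℕ) : gf nothing d = 0 := gfs_empty

theorem gf_bottom (d : ℕ) : gf bottom (d + 1) = y * x ^ (d + 1) := by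
  have h : {c | bottom (d + 1) c} =
      push [Step.U] (Step.D :: List.replicate (d + 1) Step.L) '' {([], [])} := by
    ext c
    simp [bottom, push]
  have h1 : gfs {([], [])} = 1 := by
    ext n
    rw [coeff_gfs, MvPowerSeries.coeff_one]
    split_ifs with hn
    · subst hn
      rw [Nat.cast_eq_one, Set.ncard_eq_one]
      refine ⟨([], []), ?_⟩
      ext c
      simp only [Set.mem_singleton_iff, Set.mem_ofPred_eq, and_iff_left_iff_imp]
      rintro rfl
      simp [wt]
    · rw [Nat.cast_eq_zero]
      convert Set.ncard_empty Cfg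
      ext c
      simp only [Set.mem_singleton_iff, Set.mem_ofPred_eq, Set.mem_empty_iff_false, iff_false]
      rintro ⟨rfl, rfl⟩
      simp [wt] at hn
  rw [gf, h, gfs_push, h1]
  simp
  ring

/-- The weight of the right walk relative to the increasing stage. -/
def ratio : Stage → Ser
  | .inc => 1
  | .dec => decRatio

theorem IncSystem.congr_base {b b' h Z A B : ℕ → Ser} (H : IncSystem b h Z A B)
    (hb : ∀ d, b (d + 1) = b' (d + 1)) : IncSystem b' h Z A B :=
  { H with z := fun d => by rw [H.z, hb] }

theorem gf_plain (σ : Stage) (d : ℕ) :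
    gf (Plain σ .left) (d + 1) = y * expo (ratio σ) 1 (d + 1) := by
  have h1 : ∀ d, gf (Plain .inc .left) (d + 1) = y * expo 1 1 (d + 1) :=
    ((gf_inc_system growData_plain).congr_base gf_bottom).unique inc_system_zero
      fun d => gf_nothing _
  cases σ with
  | inc => exact h1 d
  | dec =>
    refine (gf_dec_system growData_plain).unique dec_system_zero (fun d => ?_) d
    rw [gf_nothing, gf_nothing, zero_add, add_zero]
    exact h1 _

/-- `V` and `W` are the sums over the run after the up step and over the run after the down step.
They start one gap further on because neither run is empty. -/
theorem gf_indent {t : Step} {σ : Stage} {X : ℕ → Cfg → Prop}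
    (hX : ∀ d c, X d c → Shape t σ d c) {V : ℕ → Ser} {W : ℕ → Ser} {F : ℕ → Ser}
    (hF : ∀ d, gf X (d + 1) = F (d + 1)) (hV : ∀ d, V (d + 1) = y * F (d + 2) + V (d + 2))
    (hW : ∀ d, W (d + 1) = V (d + 2) + W (d + 2)) (tailV : ∀ d, x ^ d ∣ V d)
    (tailW : ∀ d, x ^ d ∣ W d) (d : ℕ) : gf (Indent X) (d + 1) = W (d + 1) := by
  have hU : ∀ d c, Turn Step.U X d c → _ := fun d c => Turn.shape hX (Or.inl rfl)
  have h1 : ∀ d, gf (Turn Step.U X) (d + 1) = V (d + 1) := by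
    refine eq_of_tail (p := fun d => y * F (d + 1)) (fun d => ?_) hV
      (gf_tail fun d c hc => (hU d c hc).1.bal) tailV
    rw [gf_turn hX (Or.inl rfl), hF]
    simp
  refine eq_of_tail (p := fun d => V (d + 1)) (fun d => ?_) hW
    (gf_tail fun d c hc => (Indent.shape hX hc).1.bal) tailW d
  rw [Indent, gf_turn (fun d c hc => (hU d c hc).1)
    (Or.inr ⟨rfl, fun d c hc => (hU d c hc).2.2.2 rfl⟩), h1]
  simp

theorem gf_indent_plain (σ : Stage) (d : ℕ) : gf (Indent (Plain σ .left)) (d + 1) =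
    y ^ 2 * (I * expo (ratio σ) 1 (d + 1)) := by
  rw [I_mul_expo]
  refine gf_indent (X := Plain σ .left) (F := fun d => y * expo (ratio σ) 1 d)
    (W := fun d => y ^ 2 * expo (ratio σ) 3 (d + 2))
    (V := fun d => y ^ 2 * expo (ratio σ) 2 (d + 1))
    (fun _ _ hc => Grow.shape_left growData_plain hc) (gf_plain σ) (fun d => ?_) (fun d => ?_)
    (fun d => (x_pow_dvd_expo_add _ _ _ _).mul_left _)
    (fun d => (x_pow_dvd_expo_add _ _ _ _).mul_left _) d
  · linear_combination y ^ 2 * expo_succ (ratio σ) 1 (d + 2)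
  · linear_combination y ^ 2 * expo_succ (ratio σ) 2 (d + 3)

theorem gf_once (σ : Stage) (d : ℕ) :
    gf (Once σ .left) (d + 1) = y ^ 3 * (I * dy (expo (ratio σ) 1 (d + 1))) := by
  have h1 : ∀ d, gf (Once .inc .left) (d + 1) = y ^ 3 * (I * dy (expo 1 1 (d + 1))) :=
    ((gf_inc_system growData_once).congr_base fun d => gf_nothing _).unique
      (inc_system_single 2 I) (gf_indent_plain .inc)
  cases σ with
  | inc => exact h1 d
  | dec =>
    refine (gf_dec_system growData_once).unique (dec_system_single 2 I) (fun d => ?_) d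
    rw [gf_indent_plain, gf_indent_plain]
    exact congrArg₂ _ (congrArg₂ _ rfl (h1 _)) rfl

/-- Summation over the runs commutes with `dy`, so the new factor `I` appears inside the derivative
and the old one stays outside. -/
theorem gf_indent_once (σ : Stage) (d : ℕ) : gf (Indent (Once σ .left)) (d + 1) =
    y ^ 4 * (I * dy (I * expo (ratio σ) 1 (d + 1))) := by
  rw [I_mul_expo]
  refine gf_indent (X := Once σ .left) (F := fun d => y ^ 3 * (I * dy (expo (ratio σ) 1 d)))
    (W := fun d => y ^ 4 * (I * dy (expo (ratio σ) 3 (d + 2))))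
    (V := fun d => y ^ 4 * (I * dy (expo (ratio σ) 2 (d + 1))))
    (fun _ _ hc => Grow.shape_left growData_once hc) (gf_once σ) (fun d => ?_) (fun d => ?_)
    (fun d => ((x_pow_dvd_dy (x_pow_dvd_expo_add _ _ _ _)).mul_left _).mul_left _)
    (fun d => ((x_pow_dvd_dy (x_pow_dvd_expo_add _ _ _ _)).mul_left _).mul_left _) d
  · linear_combination y ^ 4 * I * dy_expo_succ (ratio σ) 1 (d + 2)
  · linear_combination y ^ 4 * I * dy_expo_succ (ratio σ) 2 (d + 3)

theorem gf_twice (σ : Stage) (d : ℕ) :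
    gf (Twice σ .left) (d + 1) = y ^ 5 * twice (expo (ratio σ) 1 (d + 1)) := by
  have h1 : ∀ d, gf (Twice .inc .left) (d + 1) = y ^ 5 * twice (expo 1 1 (d + 1)) :=
    ((gf_inc_system growData_twice).congr_base fun d => gf_nothing _).unique
      (inc_system_twice 4) (gf_indent_once .inc)
  cases σ with
  | inc => exact h1 d
  | dec =>
    refine (gf_dec_system growData_twice).unique (dec_system_twice 4) (fun d => ?_) d
    rw [gf_indent_once, gf_indent_once]
    exact congrArg₂ _ (congrArg₂ _ rfl (h1 _)) rfl

theorem gf_indent_indent (σ : Stage) (d : ℕ) : gf (Indent (Indent (Plain σ .left))) (d + 1) =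
    y ^ 3 * (I ^ 2 * expo (ratio σ) 1 (d + 1)) := by
  rw [pow_two I, mul_assoc, I_mul_expo, I_mul_expo]
  refine gf_indent (W := fun d => y ^ 3 * expo (ratio σ) 5 (d + 4))
    (V := fun d => y ^ 3 * expo (ratio σ) 4 (d + 3))
    (F := fun d => y ^ 2 * (I * expo (ratio σ) 1 d))
    (fun _ _ hc => (growData_once.indent _ _ _ hc).1) (gf_indent_plain σ) (fun d => ?_)
    (fun d => ?_) (fun d => (x_pow_dvd_expo_add _ _ _ _).mul_left _)
    (fun d => (x_pow_dvd_expo_add _ _ _ _).mul_left _) d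
  · rw [I_mul_expo]
    linear_combination y ^ 3 * expo_succ (ratio σ) 3 (d + 4)
  · linear_combination y ^ 3 * expo_succ (ratio σ) 4 (d + 5)

theorem gf_double (σ : Stage) (d : ℕ) :
    gf (Double σ .left) (d + 1) = y ^ 4 * (I ^ 2 * dy (expo (ratio σ) 1 (d + 1))) := by
  have h1 : ∀ d, gf (Double .inc .left) (d + 1) = y ^ 4 * (I ^ 2 * dy (expo 1 1 (d + 1))) :=
    ((gf_inc_system growData_double).congr_base fun d => gf_nothing _).unique
      (inc_system_single 3 (I ^ 2)) (gf_indent_indent .inc)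
  cases σ with
  | inc => exact h1 d
  | dec =>
    refine (gf_dec_system growData_double).unique (dec_system_single 3 (I ^ 2)) (fun d => ?_) d
    rw [gf_indent_indent, gf_indent_indent]
    exact congrArg₂ _ (congrArg₂ _ rfl (h1 _)) rfl

end

section

/-! ### Vertices of walks -/

/-- The displacement of a walk. -/
def endp (l : List Step) : ℤ × ℤ := (l.map Step.vec).sum

theorem endp_cons (s : Step) (l : List Step) : endp (s :: l) = s.vec + endp l := by
  simp [endp]

theorem endp_append (l l' : List Step) : endp (l ++ l') = endp l + endp l' := by
  simp [endp]

theorem endp_reverse (l : List Step) : endp l.reverse = endp l := by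
  rw [endp, List.map_reverse, List.sum_reverse, endp]

theorem endp_eq (l : List Step) : endp l =
    ((l.count Step.R : ℤ) - l.count Step.L, (l.count Step.U : ℤ) - l.count Step.D) := by
  induction l with
  | nil => rfl
  | cons s l ih =>
    rw [endp_cons, ih]
    cases s <;> simp [Step.vec] <;> ring

theorem pos_eq_endp (w : List Step) (i : ℕ) : pos w i = endp (w.take i) := rfl

/-- The vertices of a walk from `p`, without the last one. -/
def walk : ℤ × ℤ → List Step → List (ℤ × ℤ)
  | _, [] => []
  | p, s :: w => p :: walk (p + s.vec) w

theorem walk_append (p : ℤ × ℤ) (v w : List Step) :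
    walk p (v ++ w) = walk p v ++ walk (p + endp v) w := by
  induction v generalizing p with
  | nil => simp [walk, endp]
  | cons s v ih => simp [walk, ih, endp_cons, add_assoc]

theorem map_pos_range (p : ℤ × ℤ) (w : List Step) :
    (List.range w.length).map (fun i => p + pos w i) = walk p w := by
  induction w generalizing p with
  | nil => rfl
  | cons s w ih =>
    rw [walk, ← ih, List.length_cons, List.range_succ_eq_map, List.map_cons, List.map_map]
    congr 1
    · simp [pos]
    · refine List.map_congr_left fun i _ => ?_
      simp [pos, add_assoc]

theorem pos_mem_walk (p : ℤ × ℤ) {w : List Step} {i : ℕ} (h : i < w.length) :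
    p + pos w i ∈ walk p w := by
  rw [← map_pos_range]
  exact List.mem_map.2 ⟨i, List.mem_range.2 h, rfl⟩

theorem nodup_walk_iff (w : List Step) :
    (walk 0 w).Nodup ↔ ∀ i j, i < j → j < w.length → pos w i ≠ pos w j := by
  rw [← map_pos_range]
  simp only [zero_add]
  constructor
  · intro h i j hij hj heq
    have := List.inj_on_of_nodup_map h (List.mem_range.2 (hij.trans hj)) (List.mem_range.2 hj) heq
    omega
  · intro h
    refine List.Nodup.map_on ?_ List.nodup_range
    intro i hi j hj heq
    rw [List.mem_range] at hi hj
    rcases lt_trichotomy i j with hij | hij | hij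
    · exact (h i j hij hj heq).elim
    · exact hij
    · exact (h j i hij hi heq.symm).elim

/-- The vertices of a reversed walk from the origin. -/
def leftVerts : List Step → List (ℤ × ℤ)
  | [] => [0]
  | s :: Q => endp (s :: Q) :: leftVerts Q

/-- The vertices of a walk to the origin, without the origin. -/
def rightVerts : List Step → List (ℤ × ℤ)
  | [] => []
  | s :: S => -endp (s :: S) :: rightVerts S

theorem endp_mem_leftVerts (Q : List Step) : endp Q ∈ leftVerts Q := by
  cases Q with
  | nil => simp [leftVerts, endp]
  | cons s Q => exact List.mem_cons_self

theorem walk_cons_reverse (s : Step) (Q : List Step) :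
    walk 0 (s :: Q).reverse = (leftVerts Q).reverse := by
  induction Q generalizing s with
  | nil => simp [walk, leftVerts]
  | cons t Q ih =>
    rw [List.reverse_cons, walk_append, ih, leftVerts, endp_reverse, zero_add, List.reverse_cons]
    rfl

theorem walk_neg_endp (S : List Step) : walk (-endp S) S = rightVerts S := by
  induction S with
  | nil => rfl
  | cons s S ih =>
    rw [walk, rightVerts, ← ih, endp_cons]
    congr 2
    abel

/-! ### Geometry of pairs of partial walks -/

/-- The right walk reaches its top height in one vertex only. -/
def Flat (k r : ℤ) (c : Cfg) : Prop := ∀ a b, (a, b) ∈ rightVerts c.2 → b = k → a = r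

/-- The two partial walks are disjoint and self-avoiding and end at the same height `k`. -/
structure Geo (l k r : ℤ) (c : Cfg) : Prop where
  start : c.1.getLast? = some Step.U
  left_end : endp c.1 = (l, k)
  right_end : -endp c.2 = (r, k)
  lt : l < r
  nodup : (leftVerts c.1 ++ rightVerts c.2).Nodup
  left : ∀ a b, (a, b) ∈ leftVerts c.1 →
    0 ≤ a ∧ 0 ≤ b ∧ b ≤ k + 1 ∧ (b = k + 1 → a < l) ∧ (b = k → a ≤ l)
  right : ∀ a b, (a, b) ∈ rightVerts c.2 → 0 ≤ a ∧ 0 ≤ b ∧ b ≤ k ∧ (b = k → l < a)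

/-- The same with the left walk one unit higher. -/
structure HighGeo (l k r : ℤ) (c : Cfg) : Prop where
  start : c.1.getLast? = some Step.U
  left_end : endp c.1 = (l, k + 1)
  right_end : -endp c.2 = (r, k)
  lt : l < r
  nodup : (leftVerts c.1 ++ rightVerts c.2).Nodup
  left : ∀ a b, (a, b) ∈ leftVerts c.1 →
    0 ≤ a ∧ 0 ≤ b ∧ b ≤ k + 1 ∧ (b = k + 1 → a ≤ l) ∧ (b = k → a < l)
  right : ∀ a b, (a, b) ∈ rightVerts c.2 → 0 ≤ a ∧ 0 ≤ b ∧ b ≤ k ∧ (b = k → l < a)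

/-- The gap defined by counting steps is the actual horizontal distance of the two ends. -/
theorem Bal.gap_eq {d : ℕ} {c : Cfg} (h : Bal d c) {l k r k' : ℤ} (h1 : endp c.1 = (l, k))
    (h2 : -endp c.2 = (r, k')) : r = l + d := by
  have h3 := h.gap
  have h4 := h.left
  rw [endp_eq, Prod.mk.injEq] at h1
  rw [endp_eq, Prod.neg_mk, Prod.mk.injEq] at h2
  omega

theorem getLast?_cons_of_eq {s t : Step} {Q : List Step} (h : Q.getLast? = some t) :
    (s :: Q).getLast? = some t := by
  rw [List.getLast?_cons, h]
  rfl

theorem nodup_left_cons {s : Step} {Q S : List Step}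
    (h : (leftVerts Q ++ rightVerts S).Nodup) (h1 : endp (s :: Q) ∉ leftVerts Q)
    (h2 : endp (s :: Q) ∉ rightVerts S) : (leftVerts (s :: Q) ++ rightVerts S).Nodup := by
  rw [leftVerts, List.cons_append, List.nodup_cons, List.mem_append, not_or]
  exact ⟨⟨h1, h2⟩, h⟩

theorem nodup_right_cons {s : Step} {Q S : List Step}
    (h : (leftVerts Q ++ rightVerts S).Nodup) (h1 : -endp (s :: S) ∉ leftVerts Q)
    (h2 : -endp (s :: S) ∉ rightVerts S) : (leftVerts Q ++ rightVerts (s :: S)).Nodup := by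
  rw [rightVerts, List.nodup_middle, List.nodup_cons, List.mem_append, not_or]
  exact ⟨⟨h1, h2⟩, h⟩

/-- The new vertices lie above the right walk, and by `Geo.left` older vertices of the left walk at
their height are strictly left of `l`. -/
theorem Geo.up {l k r : ℤ} {Q S : List Step} (h : Geo l k r (Q, S)) (hf : Flat k r (Q, S))
    (hlt : l + 1 < r) : HighGeo (l + 1) k r (Step.R :: Step.U :: Q, S) := by
  have e1 : endp (Step.U :: Q) = (l, k + 1) := by
    rw [endp_cons, h.left_end]; simp [Step.vec]; ring
  have e2 : endp (Step.R :: Step.U :: Q) = (l + 1, k + 1) := by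
    rw [endp_cons, e1]; simp [Step.vec]; ring
  refine ⟨getLast?_cons_of_eq (getLast?_cons_of_eq h.start), e2, h.right_end, hlt, ?_, ?_, ?_⟩
  · refine nodup_left_cons (nodup_left_cons h.nodup ?_ ?_) ?_ ?_
    · rw [e1]
      intro hm
      have := h.left _ _ hm
      omega
    · rw [e1]
      intro hm
      have := h.right _ _ hm
      omega
    · rw [e2, leftVerts, e1, List.mem_cons, Prod.mk.injEq, not_or]
      refine ⟨by omega, fun hm => ?_⟩
      have := h.left _ _ hm
      omega
    · rw [e2]
      intro hm
      have := h.right _ _ hm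
      omega
  · intro a b hm
    have h0 := h.left l k (h.left_end ▸ endp_mem_leftVerts Q)
    simp only [leftVerts, e1, e2, List.mem_cons, Prod.mk.injEq] at hm
    rcases hm with hm | hm | hm
    · omega
    · omega
    · have := h.left _ _ hm
      omega
  · intro a b hm
    have h1 := h.right _ _ hm
    have h2 := hf _ _ hm
    omega

theorem HighGeo.step {l k r : ℤ} {Q S : List Step} (h : HighGeo l k r (Q, S))
    (hf : Flat k r (Q, S)) (hlt : l + 1 < r) : HighGeo (l + 1) k r (Step.R :: Q, S) := by
  have e1 : endp (Step.R :: Q) = (l + 1, k + 1) := by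
    rw [endp_cons, h.left_end]; simp [Step.vec]; ring
  refine ⟨getLast?_cons_of_eq h.start, e1, h.right_end, hlt, ?_, ?_, ?_⟩
  · refine nodup_left_cons h.nodup ?_ ?_
    · rw [e1]
      intro hm
      have := h.left _ _ hm
      omega
    · rw [e1]
      intro hm
      have := h.right _ _ hm
      omega
  · intro a b hm
    have h0 := h.left l (k + 1) (h.left_end ▸ endp_mem_leftVerts Q)
    simp only [leftVerts, e1, List.mem_cons, Prod.mk.injEq] at hm
    rcases hm with hm | hm
    · omega
    · have := h.left _ _ hm
      omega
  · intro a b hm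
    have h1 := h.right _ _ hm
    have h2 := hf _ _ hm
    omega

/-- Back at height `k`, the left walk has so far stayed strictly left of `l`, and the right walk has
only the vertex at `r`, beyond `l + 1`. -/
theorem HighGeo.down {l k r : ℤ} {Q S : List Step} (h : HighGeo l k r (Q, S))
    (hk : 0 ≤ k) (hf : Flat k r (Q, S)) (hlt : l + 1 < r) :
    Geo (l + 1) k r (Step.R :: Step.D :: Q, S) := by
  have e1 : endp (Step.D :: Q) = (l, k) := by
    rw [endp_cons, h.left_end]; simp [Step.vec]
  have e2 : endp (Step.R :: Step.D :: Q) = (l + 1, k) := by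
    rw [endp_cons, e1]; simp [Step.vec]; ring
  refine ⟨getLast?_cons_of_eq (getLast?_cons_of_eq h.start), e2, h.right_end, hlt, ?_, ?_, ?_⟩
  · refine nodup_left_cons (nodup_left_cons h.nodup ?_ ?_) ?_ ?_
    · rw [e1]
      intro hm
      have := h.left _ _ hm
      omega
    · rw [e1]
      intro hm
      have := h.right _ _ hm
      omega
    · rw [e2, leftVerts, e1, List.mem_cons, Prod.mk.injEq, not_or]
      refine ⟨by omega, fun hm => ?_⟩
      have := h.left _ _ hm
      omega
    · rw [e2]
      intro hm
      have h1 := h.right _ _ hm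
      have h2 := hf _ _ hm
      omega
  · intro a b hm
    have h0 := h.left l (k + 1) (h.left_end ▸ endp_mem_leftVerts Q)
    simp only [leftVerts, e1, e2, List.mem_cons, Prod.mk.injEq] at hm
    rcases hm with hm | hm | hm
    · omega
    · omega
    · have := h.left _ _ hm
      omega
  · intro a b hm
    have h1 := h.right _ _ hm
    have h2 := hf _ _ hm
    omega

theorem Geo.step {l k r : ℤ} {Q S : List Step} (h : Geo l k r (Q, S))
    (hf : Flat k r (Q, S)) (hlt : l + 1 < r) : Geo (l + 1) k r (Step.R :: Q, S) := by
  have e1 : endp (Step.R :: Q) = (l + 1, k) := by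
    rw [endp_cons, h.left_end]; simp [Step.vec]; ring
  refine ⟨getLast?_cons_of_eq h.start, e1, h.right_end, hlt, ?_, ?_, ?_⟩
  · refine nodup_left_cons h.nodup ?_ ?_
    · rw [e1]
      intro hm
      have := h.left _ _ hm
      omega
    · rw [e1]
      intro hm
      have h1 := h.right _ _ hm
      have h2 := hf _ _ hm
      omega
  · intro a b hm
    have h0 := h.left l k (h.left_end ▸ endp_mem_leftVerts Q)
    simp only [leftVerts, e1, List.mem_cons, Prod.mk.injEq] at hm
    rcases hm with hm | hm
    · omega
    · have := h.left _ _ hm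
      omega
  · intro a b hm
    have h1 := h.right _ _ hm
    have h2 := hf _ _ hm
    omega

theorem Geo.right_left {l k r : ℤ} {Q S : List Step} (h : Geo l k r (Q, S))
    (hf : ∀ a b, (a, b) ∈ rightVerts S → b = k → a ≤ r) : Geo l k (r + 1) (Q, Step.L :: S) ∧
      ∀ a b, (a, b) ∈ rightVerts (Step.L :: S) → b = k → a ≤ r + 1 := by
  have e1 : -endp (Step.L :: S) = (r + 1, k) := by
    rw [endp_cons, neg_add, h.right_end]; simp [Step.vec]; ring
  have h0 := h.left l k (h.left_end ▸ endp_mem_leftVerts Q)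
  have hlt := h.lt
  refine ⟨⟨h.start, h.left_end, e1, by omega, ?_, h.left, ?_⟩, ?_⟩
  · refine nodup_right_cons h.nodup ?_ ?_
    · rw [e1]
      intro hm
      have := h.left _ _ hm
      omega
    · rw [e1]
      intro hm
      have := hf _ _ hm
      omega
  · intro a b hm
    simp only [rightVerts, e1, List.mem_cons, Prod.mk.injEq] at hm
    rcases hm with hm | hm
    · omega
    · exact h.right _ _ hm
  · intro a b hm
    simp only [rightVerts, e1, List.mem_cons, Prod.mk.injEq] at hm
    rcases hm with hm | hm
    · omega
    · have := hf _ _ hm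
      omega

theorem Geo.right_right {l k r : ℤ} {Q S : List Step} (h : Geo l k r (Q, S))
    (hf : ∀ a b, (a, b) ∈ rightVerts S → b = k → r ≤ a) (hlt : l + 1 < r) :
    Geo l k (r - 1) (Q, Step.R :: S) ∧
      ∀ a b, (a, b) ∈ rightVerts (Step.R :: S) → b = k → r - 1 ≤ a := by
  have e1 : -endp (Step.R :: S) = (r - 1, k) := by
    rw [endp_cons, neg_add, h.right_end]; simp [Step.vec]; ring
  have h0 := h.left l k (h.left_end ▸ endp_mem_leftVerts Q)
  refine ⟨⟨h.start, h.left_end, e1, by omega, ?_, h.left, ?_⟩, ?_⟩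
  · refine nodup_right_cons h.nodup ?_ ?_
    · rw [e1]
      intro hm
      have := h.left _ _ hm
      omega
    · rw [e1]
      intro hm
      have := hf _ _ hm
      omega
  · intro a b hm
    simp only [rightVerts, e1, List.mem_cons, Prod.mk.injEq] at hm
    rcases hm with hm | hm
    · omega
    · exact h.right _ _ hm
  · intro a b hm
    simp only [rightVerts, e1, List.mem_cons, Prod.mk.injEq] at hm
    rcases hm with hm | hm
    · omega
    · have := hf _ _ hm
      omega

theorem Geo.row {l k r : ℤ} {Q S : List Step} (h : Geo l k r (Q, S)) :
    Geo l (k + 1) r (Step.U :: Q, Step.D :: S) ∧ Flat (k + 1) r (Step.U :: Q, Step.D :: S) ∧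
      ∀ a b, (a, b) ∈ leftVerts (Step.U :: Q) → b ≤ k + 1 := by
  have e1 : endp (Step.U :: Q) = (l, k + 1) := by
    rw [endp_cons, h.left_end]; simp [Step.vec]; ring
  have e2 : -endp (Step.D :: S) = (r, k + 1) := by
    rw [endp_cons, neg_add, h.right_end]; simp [Step.vec]; ring
  have h0 := h.left l k (h.left_end ▸ endp_mem_leftVerts Q)
  have hlt := h.lt
  refine ⟨⟨getLast?_cons_of_eq h.start, e1, e2, hlt, ?_, ?_, ?_⟩, ?_, ?_⟩
  · refine nodup_right_cons (nodup_left_cons h.nodup ?_ ?_) ?_ ?_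
    · rw [e1]
      intro hm
      have := h.left _ _ hm
      omega
    · rw [e1]
      intro hm
      have := h.right _ _ hm
      omega
    · rw [e2, leftVerts, e1, List.mem_cons, Prod.mk.injEq, not_or]
      refine ⟨by omega, fun hm => ?_⟩
      have := h.left _ _ hm
      omega
    · rw [e2]
      intro hm
      have := h.right _ _ hm
      omega
  · intro a b hm
    simp only [leftVerts, e1, List.mem_cons, Prod.mk.injEq] at hm
    rcases hm with hm | hm
    · omega
    · have := h.left _ _ hm
      omega
  · intro a b hm
    simp only [rightVerts, e2, List.mem_cons, Prod.mk.injEq] at hm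
    rcases hm with hm | hm
    · omega
    · have := h.right _ _ hm
      omega
  · intro a b hm
    simp only [rightVerts, e2, List.mem_cons, Prod.mk.injEq] at hm
    rcases hm with hm | hm
    · omega
    · have := h.right _ _ hm
      omega
  · intro a b hm
    simp only [leftVerts, e1, List.mem_cons, Prod.mk.injEq] at hm
    rcases hm with hm | hm
    · omega
    · have := h.left _ _ hm
      omega

/-- All members of the family are disjoint self-avoiding walks. -/
def GeoFam (X : ℕ → Cfg → Prop) : Prop :=
  ∀ d c, X d c → 1 ≤ d → ∃ l k r, Geo l k r c ∧ Flat k r c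

theorem GeoFam.turn_up {t : Step} {σ : Stage} {X : ℕ → Cfg → Prop}
    (hX : ∀ d c, X d c → Shape t σ d c) (hG : GeoFam X) {d : ℕ} {c : Cfg}
    (h : Turn Step.U X d c) : ∃ l k r, HighGeo l k r c ∧ Flat k r c ∧ 0 ≤ k := by
  induction h with
  | @start d Q S h =>
    obtain ⟨l, k, r, h1, h2⟩ := hG _ _ h (by omega)
    have h3 := (hX _ _ h).bal.gap_eq h1.left_end h1.right_end
    have h0 := h1.left l k (h1.left_end ▸ endp_mem_leftVerts Q)
    exact ⟨_, _, _, h1.up h2 (by omega), h2, h0.2.1⟩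
  | @step d Q S h ih =>
    obtain ⟨l, k, r, h1, h2, h4⟩ := ih
    have h3 := (Turn.shape hX (Or.inl rfl) h).1.bal.gap_eq h1.left_end h1.right_end
    exact ⟨_, _, _, h1.step h2 (by omega), h2, h4⟩

theorem GeoFam.indent {t : Step} {σ : Stage} {X : ℕ → Cfg → Prop}
    (hX : ∀ d c, X d c → Shape t σ d c) (hG : GeoFam X) : GeoFam (Indent X) := by
  intro d c h _
  rw [Indent] at h
  induction h with
  | @start d Q S h =>
    obtain ⟨l, k, r, h1, h2, h4⟩ := GeoFam.turn_up hX hG h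
    have h3 := (Turn.shape hX (Or.inl rfl) h).1.bal.gap_eq h1.left_end h1.right_end
    exact ⟨_, _, _, h1.down h4 h2 (by omega), h2⟩
  | @step d Q S h ih =>
    obtain ⟨l, k, r, h1, h2⟩ := ih (by omega)
    have h3 := (Indent.shape hX h).1.bal.gap_eq h1.left_end h1.right_end
    exact ⟨_, _, _, h1.step h2 (by omega), h2⟩

variable {base : ℕ → Cfg → Prop} {h : Stage → ℕ → Cfg → Prop}

/-- The end of the right walk is the rightmost vertex of that walk in its row while increasing and
the leftmost while decreasing, so its next horizontal step meets no older vertex of it. -/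
theorem Grow.geo (H : GrowData base h) (hb : ∀ d c, base d c → ∃ l k r, Geo l k r c ∧ Flat k r c ∧
      ∀ a b, (a, b) ∈ leftVerts c.1 → b ≤ k) (hh : ∀ σ, GeoFam (h σ)) {σ : Stage} {φ : Phase}
    {d : ℕ} {c : Cfg} (hc : Grow base h σ φ d c) (hd : 1 ≤ d) : ∃ l k r, Geo l k r c ∧
      (φ ≠ .right → Flat k r c ∧ ∀ a b, (a, b) ∈ leftVerts c.1 → b ≤ k) ∧
      (σ = .inc → ∀ a b, (a, b) ∈ rightVerts c.2 → b = k → a ≤ r) ∧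
      (σ = .dec → ∀ a b, (a, b) ∈ rightVerts c.2 → b = k → r ≤ a) := by
  induction hc with
  | base hc =>
    obtain ⟨l, k, r, h1, h2, h3⟩ := hb _ _ hc
    exact ⟨l, k, r, h1, fun _ => ⟨h2, h3⟩, fun _ a b h4 h5 => (h2 a b h4 h5).le,
      fun _ a b h4 h5 => (h2 a b h4 h5).ge⟩
  | row _ ih =>
    obtain ⟨l, k, r, h1, -⟩ := ih hd
    obtain ⟨h2, h3, h4⟩ := h1.row
    exact ⟨l, k + 1, r, h2, fun _ => ⟨h3, h4⟩, fun _ a b h4 h5 => (h3 a b h4 h5).le,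
      fun _ a b h4 h5 => (h3 a b h4 h5).ge⟩
  | left _ ih =>
    obtain ⟨l, k, r, h1, h2, h3⟩ := ih hd
    exact ⟨l, k, r, h1, fun _ => h2 (by simp), h3⟩
  | @left_step _ d Q S hc ih =>
    obtain ⟨l, k, r, h1, h2, h3⟩ := ih (by omega)
    obtain ⟨h4, h5⟩ := h2 (by simp)
    have h6 := (Grow.shape H hc).1.gap_eq h1.left_end h1.right_end
    refine ⟨_, _, _, h1.step h4 (by omega), fun _ => ⟨h4, ?_⟩, h3⟩
    intro a b hm
    rw [leftVerts, endp_cons, h1.left_end, List.mem_cons] at hm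
    rcases hm with hm | hm
    · simp only [Step.vec, Prod.mk_add_mk, Prod.mk.injEq] at hm
      omega
    · exact h5 a b hm
  | right _ ih =>
    obtain ⟨l, k, r, h1, h2, h3⟩ := ih hd
    exact ⟨l, k, r, h1, fun h => (h rfl).elim, h3⟩
  | indent hc =>
    obtain ⟨l, k, r, h1, h2⟩ := hh _ _ _ hc hd
    exact ⟨l, k, r, h1, fun h => (h rfl).elim, fun _ a b h4 h5 => (h2 a b h4 h5).le,
      fun _ a b h4 h5 => (h2 a b h4 h5).ge⟩
  | inc_step hc ih =>
    obtain ⟨l, k, r, h1, h2, h3, -⟩ := ih (Grow.shape H hc).2.2.1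
    obtain ⟨h4, h5⟩ := h1.right_left (h3 rfl)
    exact ⟨l, k, r + 1, h4, fun h => (h rfl).elim, fun _ => h5, nofun⟩
  | dec_step hc ih =>
    obtain ⟨l, k, r, h1, -, -, h3⟩ := ih (by omega)
    have h6 := (Grow.shape H hc).1.gap_eq h1.left_end h1.right_end
    obtain ⟨h4, h5⟩ := h1.right_right (h3 rfl) (by omega)
    exact ⟨l, k, r - 1, h4, fun h => (h rfl).elim, nofun, fun _ => h5⟩
  | switch hc ih =>
    obtain ⟨l, k, r, h1, h2, -⟩ := ih (by omega)
    have h6 := (Grow.shape H hc).1.gap_eq h1.left_end h1.right_end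
    obtain ⟨h4, h5⟩ := h1.right_right
      (fun a b h4 h5 => ((h2 (by simp)).1 a b h4 h5).ge) (by omega)
    exact ⟨l, k, r - 1, h4, fun h => (h rfl).elim, nofun, fun _ => h5⟩
  | switch_indent hc =>
    obtain ⟨l, k, r, h1, h2⟩ := hh _ _ _ hc (by omega)
    have h6 := (H.indent _ _ _ hc).1.bal.gap_eq h1.left_end h1.right_end
    obtain ⟨h4, h5⟩ := h1.right_right (fun a b h4 h5 => (h2 a b h4 h5).ge) (by omega)
    exact ⟨l, k, r - 1, h4, fun h => (h rfl).elim, nofun, fun _ => h5⟩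

end

section

variable {base : ℕ → Cfg → Prop} {h : Stage → ℕ → Cfg → Prop}

/-! ### From closed pairs of walks to polygons -/

theorem mem_rightVerts_replicate {d : ℕ} {a b : ℤ}
    (hm : (a, b) ∈ rightVerts (List.replicate d Step.L)) : b = 0 ∧ 1 ≤ a ∧ a ≤ d := by
  induction d with
  | zero => simp [rightVerts] at hm
  | succ d ih =>
    rw [List.replicate_succ, rightVerts, List.mem_cons, endp_eq] at hm
    rcases hm with hm | hm
    · simp [List.count_replicate] at hm
      omega
    · have := ih hm
      omega

theorem nodup_rightVerts_replicate (d : ℕ) : (rightVerts (List.replicate d Step.L)).Nodup := by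
  induction d with
  | zero => simp [rightVerts]
  | succ d ih =>
    rw [List.replicate_succ, rightVerts, List.nodup_cons]
    refine ⟨?_, ih⟩
    rw [endp_eq, Prod.neg_mk]
    intro hm
    have := mem_rightVerts_replicate hm
    simp [List.count_replicate] at this

theorem bottom_geo (d : ℕ) (c : Cfg) (hc : bottom d c) : ∃ l k r, Geo l k r c ∧ Flat k r c ∧
    ∀ a b, (a, b) ∈ leftVerts c.1 → b ≤ k := by
  obtain ⟨hd, rfl⟩ := hc
  have e1 : endp [Step.U] = (0, 1) := by simp [endp, Step.vec]
  have e2 : -endp (Step.D :: List.replicate d Step.L) = ((d : ℤ), 1) := by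
    rw [endp_eq]
    simp [List.count_replicate]
  have hL : ∀ a b : ℤ, (a, b) ∈ leftVerts [Step.U] → a = 0 ∧ (b = 0 ∨ b = 1) := by
    intro a b hm
    simp only [leftVerts, e1, List.mem_cons, Prod.mk.injEq, List.not_mem_nil, or_false] at hm
    rcases hm with hm | hm
    · omega
    · obtain ⟨rfl, rfl⟩ := Prod.mk.inj hm
      omega
  have hR : ∀ a b : ℤ, (a, b) ∈ rightVerts (Step.D :: List.replicate d Step.L) →
      1 ≤ a ∧ (b = 0 ∨ a = d ∧ b = 1) := by
    intro a b hm
    rw [rightVerts, e2, List.mem_cons, Prod.mk.injEq] at hm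
    rcases hm with hm | hm
    · omega
    · have := mem_rightVerts_replicate hm
      omega
  refine ⟨0, 1, d, ⟨rfl, e1, e2, by omega, ?_, ?_, ?_⟩, ?_, ?_⟩
  · refine List.Nodup.append ?_ ?_ ?_
    · simp [leftVerts, e1]
    · rw [rightVerts, e2, List.nodup_cons]
      refine ⟨fun hm => ?_, nodup_rightVerts_replicate d⟩
      have := mem_rightVerts_replicate hm
      omega
    · rintro ⟨a, b⟩ h1 h2
      have := hL _ _ h1
      have := hR _ _ h2
      omega
  · intro a b hm
    have := hL _ _ hm
    omega
  · intro a b hm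
    have := hR _ _ hm
    omega
  · intro a b hm
    have := hR _ _ hm
    omega
  · intro a b hm
    have := hL _ _ hm
    omega

/-- No right step comes after a left step. -/
def Ordered (S : List Step) : Prop := ∃ S₁ S₂, S = S₁ ++ S₂ ∧ Step.L ∉ S₁ ∧ Step.R ∉ S₂

theorem Ordered.cons {S : List Step} (h : Ordered S) {s : Step} (hs : s ≠ Step.L) :
    Ordered (s :: S) := by
  obtain ⟨S₁, S₂, rfl, h1, h2⟩ := h
  refine ⟨s :: S₁, S₂, rfl, ?_, h2⟩
  simp [h1, hs.symm]

theorem Turn.right_property {s : Step} {X : ℕ → Cfg → Prop} {p : List Step → Prop}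
    (hX : ∀ d c, X d c → p c.2) {d : ℕ} {c : Cfg} (h : Turn s X d c) : p c.2 := by
  induction h with
  | start h =>
    have := hX _ _ h
    exact this
  | step _ ih => exact ih

theorem Indent.right_property {X : ℕ → Cfg → Prop} {p : List Step → Prop}
    (hX : ∀ d c, X d c → p c.2) {d : ℕ} {c : Cfg} (h : Indent X d c) : p c.2 :=
  Turn.right_property (fun _ _ => Turn.right_property hX) h

theorem Grow.ordered (H : GrowData base h) (hh : ∀ σ d c, h σ d c → Ordered c.2) {σ : Stage}
    {φ : Phase} {d : ℕ} {c : Cfg} (hc : Grow base h σ φ d c) : Ordered c.2 := by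
  have hinc : ∀ S : List Step, (Step.R ∈ S ↔ Stage.inc = .dec) → Step.R ∉ S := by
    intro S hS hm
    cases hS.1 hm
  induction hc with
  | base hc => exact ⟨[], _, rfl, by simp, hinc _ (H.base _ _ hc).1.stage⟩
  | row _ ih => exact ih.cons (by simp)
  | left _ ih => exact ih
  | left_step _ ih => exact ih
  | right _ ih => exact ih
  | indent hc => exact hh _ _ _ hc
  | inc_step hc =>
    refine ⟨[], _, rfl, by simp, ?_⟩
    have := hinc _ (Grow.shape H hc).2.1
    simpa using this
  | dec_step _ ih => exact ih.cons (by simp)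
  | switch _ ih => exact ih.cons (by simp)
  | switch_indent hc => exact (hh _ _ _ hc).cons (by simp)

/-! ### Vertical steps of the left walk -/

theorem Turn.verts_eq {s : Step} (hs : s = Step.U ∨ s = Step.D) {X : ℕ → Cfg → Prop} {d : ℕ}
    {c : Cfg} (h : Turn s X d c) : ∃ d' c', X d' c' ∧ verts c.1 = s :: verts c'.1 := by
  induction h with
  | start h => exact ⟨_, _, h, by simp [verts, hs]⟩
  | step _ ih =>
    obtain ⟨d', c', h1, h2⟩ := ih
    refine ⟨d', c', h1, ?_⟩
    rw [← h2]
    simp [verts]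

theorem Indent.verts_eq {X : ℕ → Cfg → Prop} {d : ℕ} {c : Cfg} (h : Indent X d c) :
    ∃ d' c', X d' c' ∧ verts c.1 = Step.D :: Step.U :: verts c'.1 := by
  obtain ⟨d', c', h1, h2⟩ := Turn.verts_eq (Or.inr rfl) h
  obtain ⟨d'', c'', h3, h4⟩ := Turn.verts_eq (Or.inl rfl) h1
  exact ⟨d'', c'', h3, by rw [h2, h4]⟩

/-- Each new row contributes one up step and moves within a row contribute none. Outside the right
phase at least one row has been started since the pattern `v`. -/
theorem Grow.verts_eq {V : List Step → Prop}
    (hb : ∀ d c, base d c → ∃ v, V v ∧ verts c.1 = Step.U :: v)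
    (hh : ∀ σ d c, h σ d c → V (verts c.1)) {σ : Stage} {φ : Phase} {d : ℕ} {c : Cfg}
    (hc : Grow base h σ φ d c) : ∃ n v, V v ∧ verts c.1 = List.replicate n Step.U ++ v ∧
      (φ ≠ .right → 1 ≤ n) := by
  induction hc with
  | base hc =>
    obtain ⟨v, h1, h2⟩ := hb _ _ hc
    exact ⟨1, v, h1, h2, fun _ => le_rfl⟩
  | row _ ih =>
    obtain ⟨n, v, h1, h2, -⟩ := ih
    refine ⟨n + 1, v, h1, ?_, by simp⟩
    rw [List.replicate_succ, List.cons_append, ← h2]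
    simp [verts]
  | left _ ih =>
    obtain ⟨n, v, h1, h2, h3⟩ := ih
    exact ⟨n, v, h1, h2, fun _ => h3 (by simp)⟩
  | left_step _ ih =>
    obtain ⟨n, v, h1, h2, h3⟩ := ih
    refine ⟨n, v, h1, ?_, h3⟩
    rw [← h2]
    simp [verts]
  | right _ ih =>
    obtain ⟨n, v, h1, h2, h3⟩ := ih
    exact ⟨n, v, h1, h2, by simp⟩
  | indent hc => exact ⟨0, _, hh _ _ _ hc, rfl, by simp⟩
  | inc_step _ ih => exact ih
  | dec_step _ ih => exact ih
  | switch _ ih =>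
    obtain ⟨n, v, h1, h2, h3⟩ := ih
    exact ⟨n, v, h1, h2, by simp⟩
  | switch_indent hc => exact ⟨0, _, hh _ _ _ hc, rfl, by simp⟩

theorem verts_plain {σ : Stage} {d : ℕ} {c : Cfg} (hc : Plain σ .left d c) :
    ∃ n, 1 ≤ n ∧ verts c.1 = List.replicate n Step.U := by
  obtain ⟨n, v, rfl, h2, h3⟩ := Grow.verts_eq (V := fun v => v = [])
    (fun d c hc => ⟨[], rfl, by rw [hc.2]; rfl⟩) (fun _ _ _ hc => hc.elim) hc
  exact ⟨n, h3 (by simp), by simpa using h2⟩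

theorem verts_once {σ : Stage} {d : ℕ} {c : Cfg} (hc : Once σ .left d c) :
    ∃ m n, 1 ≤ m ∧ 1 ≤ n ∧ verts c.1 =
      List.replicate m Step.U ++ Step.D :: List.replicate n Step.U := by
  obtain ⟨m, v, ⟨n, hn, rfl⟩, h2, h3⟩ := Grow.verts_eq
    (V := fun v => ∃ n, 1 ≤ n ∧ v = Step.D :: List.replicate n Step.U)
    (fun d c hc => hc.elim) (fun _ _ _ hc => by
      obtain ⟨d', c', h1, h2⟩ := Indent.verts_eq hc
      obtain ⟨n, h3, h4⟩ := verts_plain h1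
      exact ⟨n + 1, by omega, by rw [h2, h4, List.replicate_succ]⟩) hc
  exact ⟨m, n, h3 (by simp), hn, h2⟩

/-- The middle block needs two up steps, one for a new row and one that opens the second indent. In
`verts_double` only the latter is present. -/
theorem verts_twice {σ : Stage} {d : ℕ} {c : Cfg} (hc : Twice σ .left d c) :
    ∃ l m n, 1 ≤ l ∧ 2 ≤ m ∧ 1 ≤ n ∧ verts c.1 = List.replicate l Step.U ++
      Step.D :: (List.replicate m Step.U ++ Step.D :: List.replicate n Step.U) := by
  obtain ⟨l, v, ⟨m, n, hm, hn, rfl⟩, h2, h3⟩ := Grow.verts_eq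
    (V := fun v => ∃ m n, 2 ≤ m ∧ 1 ≤ n ∧
      v = Step.D :: (List.replicate m Step.U ++ Step.D :: List.replicate n Step.U))
    (fun d c hc => hc.elim) (fun _ _ _ hc => by
      obtain ⟨d', c', h1, h2⟩ := Indent.verts_eq hc
      obtain ⟨m, n, hm, hn, h4⟩ := verts_once h1
      exact ⟨m + 1, n, by omega, hn, by rw [h2, h4, List.replicate_succ, List.cons_append]⟩) hc
  exact ⟨l, m, n, h3 (by simp), hm, hn, h2⟩

theorem verts_double {σ : Stage} {d : ℕ} {c : Cfg} (hc : Double σ .left d c) :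
    ∃ l n, 1 ≤ l ∧ 1 ≤ n ∧ verts c.1 = List.replicate l Step.U ++
      Step.D :: (List.replicate 1 Step.U ++ Step.D :: List.replicate n Step.U) := by
  obtain ⟨l, v, ⟨n, hn, rfl⟩, h2, h3⟩ := Grow.verts_eq
    (V := fun v => ∃ n, 1 ≤ n ∧
      v = Step.D :: (List.replicate 1 Step.U ++ Step.D :: List.replicate n Step.U))
    (fun d c hc => hc.elim) (fun _ _ _ hc => by
      obtain ⟨d', c', h1, h2⟩ := Indent.verts_eq hc
      obtain ⟨d'', c'', h3, h4⟩ := Indent.verts_eq h1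
      obtain ⟨n, hn, h5⟩ := verts_plain h3
      exact ⟨n + 1, by omega, by rw [h2, h4, h5]; rfl⟩) hc
  exact ⟨l, n, h3 (by simp), hn, h2⟩

theorem geoFam_left (H : GrowData base h) (hb : ∀ d c, base d c → ∃ l k r, Geo l k r c ∧
      Flat k r c ∧ ∀ a b, (a, b) ∈ leftVerts c.1 → b ≤ k) (hh : ∀ σ, GeoFam (h σ)) (σ : Stage) :
    GeoFam (Grow base h σ .left) := by
  intro d c hc hd
  obtain ⟨l, k, r, h1, h2, -⟩ := Grow.geo H hb hh hc hd
  exact ⟨l, k, r, h1, (h2 (by simp)).1⟩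

/-- The geometric data that make `Grow` produce polygons. -/
structure GeoData (base : ℕ → Cfg → Prop) (h : Stage → ℕ → Cfg → Prop) : Prop where
  toGrowData : GrowData base h
  base_geo : ∀ d c, base d c → ∃ l k r, Geo l k r c ∧ Flat k r c ∧
    ∀ a b, (a, b) ∈ leftVerts c.1 → b ≤ k
  indent_geo : ∀ σ, GeoFam (h σ)
  indent_ordered : ∀ σ d c, h σ d c → Ordered c.2

theorem geoData_plain : GeoData bottom fun _ => nothing :=
  ⟨growData_plain, bottom_geo, fun _ _ _ hc => hc.elim, fun _ _ _ hc => hc.elim⟩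

theorem GeoData.indent {X : Stage → ℕ → Cfg → Prop} {t : Step}
    (hX : ∀ σ d c, X σ d c → Shape t σ d c) (hG : ∀ σ, GeoFam (X σ))
    (hO : ∀ σ d c, X σ d c → Ordered c.2) : GeoData nothing fun σ => Indent (X σ) where
  toGrowData := ⟨fun _ _ hc => hc.elim, fun σ _ _ hc => Indent.shape (hX σ) hc⟩
  base_geo _ _ hc := hc.elim
  indent_geo σ := GeoFam.indent (hX σ) (hG σ)
  indent_ordered σ _ _ hc := Indent.right_property (hO σ) hc

theorem GeoData.grow (H : GeoData base h) :
    GeoData nothing fun σ => Indent (Grow base h σ .left) :=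
  GeoData.indent (fun _ _ _ hc => Grow.shape_left H.toGrowData hc)
    (geoFam_left H.toGrowData H.base_geo H.indent_geo)
    (fun _ _ _ hc => Grow.ordered H.toGrowData H.indent_ordered hc)

theorem geoData_once : GeoData nothing fun σ => Indent (Plain σ .left) := geoData_plain.grow

theorem geoData_twice : GeoData nothing fun σ => Indent (Once σ .left) := geoData_once.grow

theorem geoData_double : GeoData nothing fun σ => Indent (Indent (Plain σ .left)) :=
  GeoData.indent (fun _ _ _ hc => (growData_once.indent _ _ _ hc).1) geoData_once.indent_geo
    geoData_once.indent_ordered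

/-! ### Bounding rectangle and left arc of a closed pair -/

theorem height_eq_of_forall {w : List Step} {k : ℕ} (h1 : ∀ i ≤ w.length, (pos w i).2 ≤ k)
    {n : ℕ} (hn : n ≤ w.length) (h2 : (pos w n).2 = k) : height w = k := by
  apply le_antisymm
  · refine Finset.sup_le fun i hi => ?_
    have := h1 i (by simpa [Nat.lt_succ_iff] using hi)
    omega
  · have := Finset.le_sup (f := fun i => (pos w i).2.toNat)
      (Finset.mem_range.2 (Nat.lt_succ_of_le hn))
    simp only [h2, Int.toNat_natCast] at this
    exact this

theorem width_eq_of_forall {w : List Step} {k : ℕ} (h1 : ∀ i ≤ w.length, (pos w i).1 ≤ k)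
    {n : ℕ} (hn : n ≤ w.length) (h2 : (pos w n).1 = k) : width w = k := by
  apply le_antisymm
  · refine Finset.sup_le fun i hi => ?_
    have := h1 i (by simpa [Nat.lt_succ_iff] using hi)
    omega
  · have := Finset.le_sup (f := fun i => (pos w i).1.toNat)
      (Finset.mem_range.2 (Nat.lt_succ_of_le hn))
    simp only [h2, Int.toNat_natCast] at this
    exact this

theorem leftArc_eq_of_forall {w : List Step} {n : ℕ} (hn : n ≤ w.length)
    (h2 : (pos w n).2 = height w) (h1 : ∀ i ≤ w.length, (pos w i).2 = height w → i ≤ n) :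
    leftArc w = w.take n := by
  rw [leftArc]
  congr 1
  apply le_antisymm
  · refine Finset.sup_le fun i hi => ?_
    rw [Finset.mem_filter, Finset.mem_range] at hi
    exact h1 i (by omega) hi.2
  · exact Finset.le_sup (f := id)
      (Finset.mem_filter.2 ⟨Finset.mem_range.2 (Nat.lt_succ_of_le hn), h2⟩)

/-- A closed pair is the boundary of a polygon. -/
theorem Grow.polygon (H : GeoData base h) {σ : Stage} {c : Cfg}
    (hc : Grow base h σ .left 0 c) : IsRootedPolygon (c.1.reverse ++ c.2) ∧
      width (c.1.reverse ++ c.2) = c.2.count Step.L ∧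
      leftArc (c.1.reverse ++ c.2) = c.1.reverse ∧
      height (c.1.reverse ++ c.2) + c.1.count Step.D = c.1.count Step.U ∧
      c.1.count Step.D + c.2.count Step.D = c.1.count Step.U := by
  have hS := Grow.shape H.toGrowData hc
  have hO := Grow.ordered H.toGrowData H.indent_ordered hc
  cases hc with
  | left hc =>
    have := (Grow.shape H.toGrowData hc).2.2.1
    omega
  -- The last right step crosses gap one and lands on the end of the right walk.
  | @left_step _ _ Q S hc =>
  obtain ⟨l, k, r, hG, hft, -⟩ := Grow.geo H.toGrowData H.base_geo H.indent_geo hc le_rfl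
  obtain ⟨hf, ht⟩ := hft (by simp)
  have hr := (Grow.shape H.toGrowData hc).1.gap_eq hG.left_end hG.right_end
  have e1 : endp (Step.R :: Q) = (l + 1, k) := by
    rw [endp_cons, hG.left_end]; simp [Step.vec]; ring
  have e2 : -endp S = (l + 1, k) := by
    rw [hG.right_end, hr]; simp
  simp only
  set w := (Step.R :: Q).reverse ++ S with hw
  -- The common end of the two walks is listed in `rightVerts S` only.
  have hwalk : walk 0 w = (leftVerts Q).reverse ++ rightVerts S := by
    rw [hw, walk_append, walk_cons_reverse, endp_reverse, zero_add, e1, ← e2, walk_neg_endp]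
  have hlen : w.length = Q.length + 1 + S.length := by
    simp [hw]
    omega
  have hSne : 0 < S.length := by
    have := hS.2.2.2
    cases S with
    | nil => cases this
    | cons => simp
  have hsimple : ∀ i j, i < j → j < w.length → pos w i ≠ pos w j := by
    rw [← nodup_walk_iff, hwalk]
    have := hG.nodup
    rw [List.nodup_append] at this ⊢
    exact ⟨List.nodup_reverse.2 this.1, this.2.1, fun a ha => this.2.2 a (List.mem_reverse.1 ha)⟩
  have hclosed : pos w w.length = 0 := by
    rw [pos_eq_endp, List.take_length, hw, endp_append, endp_reverse, e1, ← e2]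
    simp
  have hk0 : 0 ≤ k := (hG.left l k (hG.left_end ▸ endp_mem_leftVerts Q)).2.1
  have hmem : ∀ i < w.length, 0 ≤ (pos w i).1 ∧ 0 ≤ (pos w i).2 ∧ (pos w i).2 ≤ k := by
    intro i hi
    have h1 := pos_mem_walk 0 hi
    rw [zero_add, hwalk, List.mem_append, List.mem_reverse] at h1
    rcases h1 with h1 | h1
    · have h2 := hG.left (pos w i).1 (pos w i).2 h1
      have h3 := ht (pos w i).1 (pos w i).2 h1
      omega
    · have h2 := hG.right (pos w i).1 (pos w i).2 h1
      omega
  have hmem' : ∀ i ≤ w.length, 0 ≤ (pos w i).1 ∧ 0 ≤ (pos w i).2 ∧ (pos w i).2 ≤ k := by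
    intro i hi
    rcases hi.lt_or_eq with hi | rfl
    · exact hmem i hi
    · rw [hclosed]
      exact ⟨le_rfl, le_rfl, hk0⟩
  have htakeQ : w.take (Q.length + 1) = (Step.R :: Q).reverse := by
    rw [hw, List.take_left' (by simp)]
  have hposQ : pos w (Q.length + 1) = (l + 1, k) := by
    rw [pos_eq_endp, htakeQ, endp_reverse, e1]
  have hcount := e1
  rw [endp_eq, Prod.mk.injEq] at hcount
  have hcountS := e2
  rw [endp_eq, Prod.neg_mk, Prod.mk.injEq] at hcountS
  obtain ⟨⟨b1, b2, b3, b4⟩, -, -, hhead⟩ := hS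
  simp only at b1 b2 b3 b4
  have hheight : height w = k.toNat := by
    refine height_eq_of_forall (n := Q.length + 1) (fun i hi => ?_) (by omega) ?_
    · have := hmem' i hi
      omega
    · rw [hposQ]
      simp only
      omega
  have hwidth : width w = S.count Step.L := by
    obtain ⟨S₁, S₂, rfl, hS₁, hS₂⟩ := hO
    -- The maximal abscissa is reached after `S₁`, when all right steps and no left step have been
    -- made.
    refine width_eq_of_forall (n := Q.length + 1 + S₁.length) (fun i hi => ?_)
      (by rw [hlen, List.length_append]; omega) ?_
    · rw [pos_eq_endp, endp_eq]
      have h1 := (List.take_sublist i w).count_le Step.R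
      have h2 : w.count Step.R = (Step.R :: Q).count Step.R + (S₁ ++ S₂).count Step.R := by
        rw [hw, List.count_append, List.count_reverse]
      simp only
      omega
    · have h1 : w.take (Q.length + 1 + S₁.length) = (Step.R :: Q).reverse ++ S₁ := by
        rw [hw, ← List.append_assoc, List.take_left' (by simp; omega)]
      have h3 := List.count_eq_zero.2 hS₁
      have h4 := List.count_eq_zero.2 hS₂
      rw [pos_eq_endp, h1, endp_eq]
      simp only [List.count_append, List.count_reverse] at b1 ⊢
      omega
  have hk1 : 1 ≤ k := by
    have h1 := hhead
    have h2 : 1 ≤ S.count Step.D := by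
      cases S with
      | nil => cases h1
      | cons s S =>
        cases h1
        simp
    omega
  refine ⟨⟨?_, hclosed, hsimple, fun i hi => ⟨(hmem' i hi).1, (hmem' i hi).2.1⟩, ?_⟩, hwidth, ?_,
    ?_, ?_⟩
  · have h1 : 1 ≤ (Step.R :: Q).count Step.R := by simp
    rw [hw, List.length_append, List.length_reverse, length_eq_counts, length_eq_counts S]
    omega
  · rw [hw, List.head?_append, List.head?_reverse, getLast?_cons_of_eq hG.start]
    rfl
  · rw [← htakeQ]
    have hhk : (height w : ℤ) = k := by omega
    refine leftArc_eq_of_forall (by omega) (by rw [hposQ, hhk]) fun i hi hi2 => ?_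
    by_contra! hlt
    rcases hi.lt_or_eq with hi | rfl
    · obtain ⟨j, rfl⟩ := Nat.exists_eq_add_of_le hlt.le
      have h1 := pos_mem_walk (-endp S) (w := S) (i := j) (by omega)
      have h2 : pos w (Q.length + 1 + j) = -endp S + pos S j := by
        rw [pos_eq_endp, hw, List.take_append, endp_append, List.take_of_length_le (by simp),
          endp_reverse, e1, e2, pos_eq_endp]
        congr 3
        simp
      rw [← h2, walk_neg_endp] at h1
      -- By `Flat`, a later vertex on the top side would coincide with the end of the left arc.
      have h3 := hf (pos w (Q.length + 1 + j)).1 (pos w (Q.length + 1 + j)).2 h1 (by omega)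
      refine hsimple _ _ hlt hi ?_
      rw [hposQ]
      ext
      · simp only
        omega
      · simp only
        omega
    · rw [hclosed] at hi2
      simp only [Prod.snd_zero] at hi2
      omega
  · omega
  · omega

end

section

variable {base : ℕ → Cfg → Prop} {h : Stage → ℕ → Cfg → Prop}

/-! ### Reading a pair of boundary arcs row by row -/

/-- The properties of the left arc `α` and the right arc `ρ` of a polygon that determine the rows. -/
structure Arcs (α ρ : List Step) : Prop where
  left : Step.L ∉ α
  right : Step.U ∉ ρ
  ordered : Ordered ρ
  up_down : ∀ a b, α ≠ a ++ Step.U :: Step.D :: b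
  down_up : ∀ a b, α ≠ a ++ Step.D :: Step.U :: b
  right_left : ∀ a b, ρ ≠ a ++ Step.R :: Step.L :: b
  leftOf : ∀ Q M M' S : List Step, α = Q.reverse ++ M → ρ = M' ++ S → Q ≠ [] → M ≠ [] → S ≠ [] →
    Q.count Step.U = Q.count Step.D + S.count Step.D →
    Q.count Step.R + S.count Step.R < S.count Step.L
  top : ∀ Q M : List Step, α = Q.reverse ++ M → Q.count Step.U ≤ Q.count Step.D + ρ.count Step.D
  head : ρ.head? = some Step.D
  start : α.head? = some Step.U
  vert : α.count Step.U = α.count Step.D + ρ.count Step.D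
  horiz : α.count Step.R + ρ.count Step.R = ρ.count Step.L
  bottom : ∃ M d, 1 ≤ d ∧ ρ = M ++ Step.D :: List.replicate d Step.L

theorem split_of_verts_eq_cons {M v : List Step} {s : Step} (hM : Step.L ∉ M)
    (h : verts M = s :: v) :
    ∃ p M₀, M = List.replicate p Step.R ++ s :: M₀ ∧ verts M₀ = v := by
  induction M with
  | nil => cases h
  | cons t M ih =>
    have hM' : Step.L ∉ M := fun h => hM (List.mem_cons_of_mem _ h)
    cases t with
    | U =>
      rw [verts, List.filter_cons_of_pos (by simp), List.cons.injEq] at h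
      exact ⟨0, M, by rw [← h.1]; rfl, h.2⟩
    | D =>
      rw [verts, List.filter_cons_of_pos (by simp), List.cons.injEq] at h
      exact ⟨0, M, by rw [← h.1]; rfl, h.2⟩
    | L => simp at hM
    | R =>
      obtain ⟨p, M₀, rfl, h2⟩ := ih hM' (by simpa [verts] using h)
      exact ⟨p + 1, M₀, by simp [List.replicate_succ], h2⟩

theorem eq_replicate_of_verts_eq_nil {M : List Step} (hM : Step.L ∉ M) (h : verts M = []) :
    M = List.replicate M.length Step.R := by
  rw [List.eq_replicate_iff]
  refine ⟨rfl, fun s hs => ?_⟩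
  have := List.filter_eq_nil_iff.1 h s hs
  cases s
  · simp at this
  · rfl
  · simp at this
  · exact (hM hs).elim

theorem exists_last_down {M : List Step} (hM : Step.D ∈ M) :
    ∃ M₁ T, M = M₁ ++ Step.D :: T ∧ Step.D ∉ T := by
  induction M with
  | nil => cases hM
  | cons s M ih =>
    by_cases h : Step.D ∈ M
    · obtain ⟨M₁, T, rfl, h2⟩ := ih h
      exact ⟨s :: M₁, T, rfl, h2⟩
    · rcases List.mem_cons.1 hM with rfl | hM
      · exact ⟨[], M, rfl, h⟩
      · exact (h hM).elim

theorem Ordered.notMem {a b : List Step} (h : Ordered (a ++ Step.L :: b)) : Step.R ∉ b := by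
  obtain ⟨S₁, S₂, h1, h2, h3⟩ := h
  rcases List.append_eq_append_iff.1 h1 with ⟨c, rfl, h5⟩ | ⟨c, rfl, h5⟩
  · cases c with
    | nil =>
      rw [List.nil_append] at h5
      rw [← h5] at h3
      exact fun h => h3 (List.mem_cons_of_mem _ h)
    | cons t c =>
      rw [List.cons_append, List.cons.injEq] at h5
      rw [← h5.1] at h2
      simp at h2
  · rw [h5] at h3
    intro h
    exact h3 (by simp [h])

/-- A left step is never followed by a right step, and a right step is never immediately followed by
a left one, so only one direction occurs. -/
theorem eq_replicate_of_horizontal {T : List Step} (hU : Step.U ∉ T) (hD : Step.D ∉ T)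
    (h1 : ∀ a b, T = a ++ Step.L :: b → Step.R ∉ b) (h2 : ∀ a b, T ≠ a ++ Step.R :: Step.L :: b) :
    T = List.replicate T.length Step.L ∨ T = List.replicate T.length Step.R := by
  induction T with
  | nil => simp
  | cons s T ih =>
    have ih := ih (fun h => hU (List.mem_cons_of_mem _ h)) (fun h => hD (List.mem_cons_of_mem _ h))
      (fun a b h => h1 (s :: a) b (by rw [h]; rfl)) (fun a b h => h2 (s :: a) b (by rw [h]; rfl))
    cases s with
    | U => simp at hU
    | D => simp at hD
    | L =>
      left
      rcases ih with ih | ih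
      · rw [List.length_cons, List.replicate_succ, ← ih]
      · have := h1 [] T rfl
        cases T with
        | nil => rfl
        | cons t T =>
          rw [List.length_cons, List.replicate_succ, List.cons.injEq] at ih
          rw [ih.1] at this
          simp at this
    | R =>
      right
      rcases ih with ih | ih
      · cases T with
        | nil => rfl
        | cons t T =>
          rw [List.length_cons, List.replicate_succ, List.cons.injEq] at ih
          rw [ih.1] at h2
          exact (h2 [] T rfl).elim
      · rw [List.length_cons, List.replicate_succ, ← ih]

/-! ### Replaying the arcs of a polygon by the growth rules -/

theorem Turn.run {s : Step} {X : ℕ → Cfg → Prop} {Q S : List Step} (i d : ℕ)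
    (hX : X (d + i + 2) (Q, S)) :
    Turn s X (d + 1) (List.replicate (i + 1) Step.R ++ s :: Q, S) := by
  induction i generalizing d with
  | zero => exact Turn.start hX
  | succ i ih =>
    rw [List.replicate_succ, List.cons_append]
    refine Turn.step (ih (d + 1) ?_)
    rwa [show d + 1 + i + 2 = d + (i + 1) + 2 by ring]

theorem Grow.left_run {σ : Stage} {Q S : List Step} (p d : ℕ)
    (hc : Grow base h σ .left (d + p) (Q, S)) :
    Grow base h σ .left d (List.replicate p Step.R ++ Q, S) := by
  induction p generalizing d with
  | zero => exact hc
  | succ p ih =>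
    rw [List.replicate_succ, List.cons_append]
    refine Grow.left_step (ih (d + 1) ?_)
    rwa [show d + 1 + p = d + (p + 1) by ring]

theorem Grow.inc_run {Q S : List Step} (t d : ℕ) (hc : Grow base h .inc .right d (Q, S)) :
    Grow base h .inc .right (d + t) (Q, List.replicate t Step.L ++ S) := by
  induction t with
  | zero => exact hc
  | succ t ih =>
    rw [List.replicate_succ, List.cons_append]
    exact Grow.inc_step ih

theorem Grow.dec_run {Q S : List Step} (t d : ℕ)
    (hc : Grow base h .dec .right (d + t + 1) (Q, S)) :
    Grow base h .dec .right (d + 1) (Q, List.replicate t Step.R ++ S) := by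
  induction t generalizing d with
  | zero => exact hc
  | succ t ih =>
    rw [List.replicate_succ, List.cons_append]
    refine Grow.dec_step (ih (d + 1) ?_)
    rwa [show d + 1 + t + 1 = d + (t + 1) + 1 by ring]

/-- A pair of partial walks of the family `X` is read off the arcs, with `M` left on the left arc. -/
structure Read (α ρ : List Step) (X : ℕ → Cfg → Prop) (d : ℕ) (Q S M : List Step) : Prop where
  mem : X d (Q, S)
  bal : Bal d (Q, S)
  ne_nil : Q ≠ []
  ne_nil' : S ≠ []
  left_eq : α = Q.reverse ++ M
  right_eq : ∃ M', ρ = M' ++ S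
  height : Q.count Step.U = Q.count Step.D + S.count Step.D

variable {α ρ : List Step}

theorem Read.pos (A : Arcs α ρ) {X : ℕ → Cfg → Prop} {d : ℕ} {Q S M : List Step}
    (hr : Read α ρ X d Q S M) (hM : M ≠ []) : 1 ≤ d := by
  obtain ⟨M', hM'⟩ := hr.right_eq
  have h1 := A.leftOf Q M M' S hr.left_eq hM' hr.ne_nil hM hr.ne_nil' hr.height
  have h2 := hr.bal.gap
  simp only at h2
  omega

theorem Read.notMem (A : Arcs α ρ) {X : ℕ → Cfg → Prop} {d : ℕ} {Q S M : List Step}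
    (hr : Read α ρ X d Q S M) : Step.L ∉ M := by
  have h1 := A.left
  rw [hr.left_eq, List.mem_append, not_or] at h1
  exact h1.2

theorem Read.left_run (A : Arcs α ρ) {σ : Stage} {d : ℕ} {Q S M v : List Step}
    (hr : Read α ρ (Grow base h σ .row) d Q S M) (hv : verts M = Step.U :: v) :
    ∃ d' Q' M₀, Read α ρ (Grow base h σ .left) d' Q' S (Step.U :: M₀) ∧ verts M₀ = v := by
  obtain ⟨p, M₀, rfl, h2⟩ := split_of_verts_eq_cons (hr.notMem A) hv
  obtain ⟨M', hM'⟩ := hr.right_eq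
  have e1 : α = (List.replicate p Step.R ++ Q).reverse ++ Step.U :: M₀ := by
    rw [hr.left_eq]; simp
  have hh := hr.height
  have h1 := A.leftOf _ _ M' S e1 hM' (by simp [hr.ne_nil]) (by simp) hr.ne_nil'
    (by simpa [List.count_replicate] using hh)
  obtain ⟨g1, g2, g3, g4⟩ := hr.bal
  simp at h1 g1 g2 g3 g4
  -- The left arc stays left of the right arc, so the run of right steps is shorter than the gap.
  obtain ⟨d', rfl⟩ : ∃ d', d = d' + p := ⟨d - p, by omega⟩
  refine ⟨d', _, M₀, ⟨Grow.left_run p d' (Grow.left hr.mem), ⟨?_, ?_, ?_, ?_⟩, by simp [hr.ne_nil],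
    hr.ne_nil', e1, hr.right_eq, ?_⟩, h2⟩ <;> simp [List.count_replicate] <;> grind

theorem Read.indent (A : Arcs α ρ) {X : ℕ → Cfg → Prop} {d : ℕ} {Q S M₀ v : List Step}
    (hr : Read α ρ X d Q S (Step.U :: M₀)) (hv : verts M₀ = Step.D :: Step.U :: v) :
    ∃ d' Q' M₁, Read α ρ (Indent X) d' Q' S (Step.U :: M₁) ∧ verts M₁ = v := by
  have hL := hr.notMem A
  obtain ⟨i, M₂, rfl, h2⟩ := split_of_verts_eq_cons (fun h => hL (List.mem_cons_of_mem _ h)) hv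
  obtain ⟨j, M₁, rfl, h3⟩ := split_of_verts_eq_cons (fun h => hL (by simp [h])) h2
  obtain ⟨M', hM'⟩ := hr.right_eq
  have e0 := hr.left_eq
  obtain _ | i := i
  -- An empty run would be a backtrack, so both runs of the indent are nonempty.
  · exact (A.up_down _ _ e0).elim
  obtain _ | j := j
  · exact (A.down_up (Q.reverse ++ Step.U :: List.replicate (i + 1) Step.R) M₁
      (by rw [e0]; simp)).elim
  have e1 : α = (List.replicate (j + 1) Step.R ++ Step.D ::
      (List.replicate (i + 1) Step.R ++ Step.U :: Q)).reverse ++ Step.U :: M₁ := by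
    rw [e0]; simp
  have hh := hr.height
  have h1 := A.leftOf _ _ M' S e1 hM' (by simp) (by simp) hr.ne_nil'
    (by simp [List.count_replicate]; omega)
  obtain ⟨g1, g2, g3, g4⟩ := hr.bal
  simp at h1 g1 g2 g3 g4
  obtain ⟨d', rfl⟩ : ∃ d', d = d' + j + 1 + i + 2 := ⟨d - (j + 1 + i + 2), by omega⟩
  refine ⟨d' + 1, _, M₁, ⟨Turn.run j d' (Turn.run i (d' + j + 1) hr.mem), ⟨?_, ?_, ?_, ?_⟩,
    by simp, hr.ne_nil', e1, hr.right_eq, ?_⟩, h3⟩ <;> simp [List.count_replicate] <;> omega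

/-- Up to the next down step of the right arc there is one horizontal run, and its direction decides
whether the stage changes. -/
theorem Read.right_run (A : Arcs α ρ) (H : GrowData base h) {σ : Stage} {d : ℕ}
    {Q S M₀ : List Step} {X : ℕ → Cfg → Prop} (hr : Read α ρ X d Q S (Step.U :: M₀))
    (hX : ∀ d c, X d c → Grow base h σ .left d c ∨ h σ d c) :
    ∃ σ' d' S', Read α ρ (Grow base h σ' .row) d' (Step.U :: Q) S' M₀ := by
  obtain ⟨M', hM'⟩ := hr.right_eq
  have hh := hr.height
  have hpos := hr.pos A (by simp)
  have e1 : α = (Step.U :: Q).reverse ++ M₀ := by rw [hr.left_eq]; simp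
  have htop := A.top _ _ e1
  -- The left arc still goes up, so the right arc cannot yet be at the top.
  have hD : Step.D ∈ M' := by
    rw [← List.count_pos_iff]
    simp [hM'] at htop
    omega
  obtain ⟨M₁, T, rfl, hT⟩ := exists_last_down hD
  have hUT : Step.U ∉ T := fun hu => A.right (by rw [hM']; simp [hu])
  have hrun := eq_replicate_of_horizontal hUT hT
    (fun a b hab hR => by
      have hO := A.ordered
      rw [hM', hab] at hO
      refine Ordered.notMem (a := M₁ ++ Step.D :: a) (b := b ++ S) ?_ (by simp [hR])
      simpa using hO)
    (fun a b hab => A.right_left (M₁ ++ Step.D :: a) (b ++ S) (by rw [hM', hab]; simp))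
  have hstart : Grow base h σ .right d (Q, S) := by
    rcases hX _ _ hr.mem with hc | hc
    · obtain ⟨d, rfl⟩ : ∃ d', d = d' + 1 := ⟨d - 1, by omega⟩
      exact Grow.right hc
    · exact Grow.indent hc
  have hstage := (Grow.shape H hstart).2.1
  simp only at hstage
  obtain ⟨g1, g2, g3, g4⟩ := hr.bal
  simp only at g1 g2 g3 g4
  have hDT : T.count Step.D = 0 := List.count_eq_zero.2 hT
  have hUT' : T.count Step.U = 0 := List.count_eq_zero.2 hUT
  suffices ∃ σ' d', Grow base h σ' .right d' (Q, T ++ S) by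
    obtain ⟨σ', d', hc⟩ := this
    have hc' := Grow.row hc
    refine ⟨σ', d', Step.D :: (T ++ S), hc', (Grow.shape H hc').1, by simp, by simp, e1,
      ⟨M₁, by rw [hM']; simp⟩, ?_⟩
    simp
    omega
  generalize T.length = t at hrun
  rcases hrun with rfl | rfl
  · obtain _ | t := t
    · exact ⟨σ, d, hstart⟩
    · cases σ with
      | inc => exact ⟨.inc, _, Grow.inc_run _ _ hstart⟩
      | dec =>
        -- In the decreasing stage a right step already follows, which the order of the right arc
        -- forbids after a left step.
        have hR := hstage.2 rfl
        have hO := A.ordered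
        refine (Ordered.notMem (a := M₁ ++ [Step.D])
          (b := List.replicate t Step.L ++ S) ?_ (by simp [hR])).elim
        rw [hM'] at hO
        simpa [List.replicate_succ] using hO
  · obtain _ | t := t
    · exact ⟨σ, d, hstart⟩
    -- Applied at the far end of the run, this shows that the gap stays positive throughout it.
    have h1 := A.leftOf Q (Step.U :: M₀) (M₁ ++ [Step.D]) (List.replicate (t + 1) Step.R ++ S)
      hr.left_eq (by rw [hM']; simp) hr.ne_nil (by simp) (by simp)
      (by simp [List.count_replicate, hh])
    simp [List.count_replicate] at h1
    obtain ⟨d', rfl⟩ : ∃ d', d = d' + t + 2 := ⟨d - (t + 2), by omega⟩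
    refine ⟨.dec, d' + 1, ?_⟩
    cases σ with
    | dec => exact Grow.dec_run (t + 1) d' hstart
    | inc =>
      rw [show List.replicate (t + 1) Step.R ++ S = List.replicate t Step.R ++ Step.R :: S by
        rw [List.replicate_succ']; simp]
      refine Grow.dec_run t d' ?_
      rcases hX _ _ hr.mem with hc | hc
      · exact Grow.switch hc
      · exact Grow.switch_indent hc

/-- Some pair with complete rows is read off the arcs, with the vertical steps `v` left. -/
def ReadRow (α ρ : List Step) (base : ℕ → Cfg → Prop) (h : Stage → ℕ → Cfg → Prop)
    (v : List Step) : Prop :=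
  ∃ σ d Q S M, Read α ρ (Grow base h σ .row) d Q S M ∧ verts M = v

theorem ReadRow.row (A : Arcs α ρ) (H : GrowData base h) {v : List Step}
    (hr : ReadRow α ρ base h (Step.U :: v)) : ReadRow α ρ base h v := by
  obtain ⟨σ, d, Q, S, M, hr, hv⟩ := hr
  obtain ⟨d, Q, M₀, hr, hv⟩ := hr.left_run A hv
  obtain ⟨σ', d', S', hr⟩ := hr.right_run A H fun _ _ hc => Or.inl hc
  exact ⟨σ', d', _, S', M₀, hr, hv⟩

theorem ReadRow.climb (A : Arcs α ρ) (H : GrowData base h) {n : ℕ} {v : List Step}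
    (hr : ReadRow α ρ base h (List.replicate n Step.U ++ v)) : ReadRow α ρ base h v := by
  induction n with
  | zero => exact hr
  | succ n ih => exact ih (ReadRow.row A H hr)

theorem ReadRow.indent (A : Arcs α ρ) {v : List Step}
    (H' : GrowData nothing fun σ => Indent (Grow base h σ .left))
    (hr : ReadRow α ρ base h (Step.U :: Step.D :: Step.U :: v)) :
    ReadRow α ρ nothing (fun σ => Indent (Grow base h σ .left)) v := by
  obtain ⟨σ, d, Q, S, M, hr, hv⟩ := hr
  obtain ⟨d, Q, M₀, hr, hv⟩ := hr.left_run A hv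
  obtain ⟨d, Q, M₁, hr, hv⟩ := hr.indent A hv
  obtain ⟨σ', d', S', hr⟩ := hr.right_run A H' fun _ _ hc => Or.inr hc
  exact ⟨σ', d', _, S', M₁, hr, hv⟩

theorem ReadRow.double (A : Arcs α ρ) {v : List Step}
    (H' : GrowData nothing fun σ => Indent (Indent (Grow base h σ .left)))
    (hr : ReadRow α ρ base h (Step.U :: Step.D :: Step.U :: Step.D :: Step.U :: v)) :
    ReadRow α ρ nothing (fun σ => Indent (Indent (Grow base h σ .left))) v := by
  obtain ⟨σ, d, Q, S, M, hr, hv⟩ := hr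
  obtain ⟨d, Q, M₀, hr, hv⟩ := hr.left_run A hv
  obtain ⟨d, Q, M₁, hr, hv⟩ := hr.indent A hv
  obtain ⟨d, Q, M₂, hr, hv⟩ := hr.indent A hv
  obtain ⟨σ', d', S', hr⟩ := hr.right_run A H' fun _ _ hc => Or.inr hc
  exact ⟨σ', d', _, S', M₂, hr, hv⟩

/-- Equal vertical counts force the right arc to be used up, and equal horizontal counts make the
remaining right steps exactly as many as the gap. -/
theorem ReadRow.close (A : Arcs α ρ) (hr : ReadRow α ρ base h []) :
    ∃ σ, Grow base h σ .left 0 (α.reverse, ρ) := by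
  obtain ⟨σ, d, Q, S, M, hr, hv⟩ := hr
  have hM := eq_replicate_of_verts_eq_nil (hr.notMem A) hv
  generalize M.length = p at hM
  subst hM
  obtain ⟨M', hM'⟩ := hr.right_eq
  have e0 := hr.left_eq
  have h1 := A.vert
  have h2 := A.horiz
  have hh := hr.height
  have hM'' : M' = [] := by
    cases M' with
    | nil => rfl
    | cons s M' =>
      have h3 := A.head
      rw [hM', List.cons_append, List.head?_cons, Option.some.injEq] at h3
      rw [e0, hM', h3] at h1
      simp [List.count_replicate] at h1
      omega
  rw [hM'', List.nil_append] at hM'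
  subst hM'
  have g1 := hr.bal.gap
  rw [e0] at h2
  simp at h2 g1
  obtain rfl : d = p := by omega
  refine ⟨σ, ?_⟩
  have h4 := Grow.left_run d 0 (by rw [zero_add]; exact Grow.left hr.mem)
  rw [e0]
  simpa using h4

theorem readRow_start (A : Arcs α ρ) {v : List Step} (hv : verts α = Step.U :: v) :
    ReadRow α ρ bottom (fun _ => nothing) v := by
  obtain ⟨M', d, hd, hρ⟩ := A.bottom
  have h1 := A.start
  cases α with
  | nil => cases hv
  | cons s M =>
    cases h1
    have hc : Plain .inc .row d ([Step.U], Step.D :: List.replicate d Step.L) :=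
      Grow.base ⟨hd, rfl⟩
    refine ⟨.inc, d, [Step.U], _, M, ⟨hc, (Grow.shape growData_plain hc).1, by simp, by simp, rfl,
      ⟨M', hρ⟩, by simp [List.count_replicate]⟩, ?_⟩
    simpa [verts] using hv

/-- An indent based on the bottom side would place a left arc vertex there at abscissa at least `1`,
but the right arc passes through `(1, 0)`. -/
theorem two_le_of_verts_eq (A : Arcs α ρ) {a b c : ℕ} (ha : 1 ≤ a) (hb : 1 ≤ b)
    (hv : verts α = List.replicate a Step.U ++ Step.D :: (List.replicate b Step.U ++ Step.D ::
      List.replicate c Step.U)) : 2 ≤ a := by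
  by_contra! hlt
  obtain rfl : a = 1 := by omega
  obtain ⟨i, M, hM, hv1⟩ := split_of_verts_eq_cons A.left hv
  obtain rfl : i = 0 := by
    have := A.start
    rw [hM] at this
    cases i with
    | zero => rfl
    | succ i => simp [List.replicate_succ] at this
  have hL : Step.L ∉ M := fun hl => A.left (by rw [hM]; simp [hl])
  obtain ⟨j, M₁, rfl, hv2⟩ := split_of_verts_eq_cons hL hv1
  obtain _ | j := j
  · exact A.up_down [] M₁ hM
  obtain ⟨M', d, hd, hρ⟩ := A.bottom
  obtain ⟨d, rfl⟩ : ∃ d', d = d' + 1 := ⟨d - 1, by omega⟩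
  have h1 := A.leftOf (Step.D :: (List.replicate (j + 1) Step.R ++ [Step.U])) M₁
    (M' ++ Step.D :: List.replicate d Step.L) [Step.L] (by rw [hM]; simp)
    (by rw [hρ, List.replicate_succ']; simp) (by simp) (by
      rintro rfl
      obtain ⟨b, rfl⟩ : ∃ b', b = b' + 1 := ⟨b - 1, by omega⟩
      simp [verts, List.replicate_succ] at hv2) (by simp) (by simp [List.count_replicate])
  simp at h1

theorem count_verts {s : Step} (hs : s = Step.U ∨ s = Step.D) (l : List Step) :
    (verts l).count s = l.count s :=
  List.count_filter (by simpa using hs)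

/-- If nothing went up after the second down step, the vertex before that step would lie above the
top side. -/
theorem one_le_of_verts_eq (A : Arcs α ρ) {a b c : ℕ}
    (hv : verts α = List.replicate a Step.U ++ Step.D :: (List.replicate b Step.U ++ Step.D ::
      List.replicate c Step.U)) : 1 ≤ c := by
  by_contra! hlt
  obtain rfl : c = 0 := by omega
  have hv' : verts α = (List.replicate a Step.U ++ Step.D :: List.replicate b Step.U) ++
      [Step.D] := by rw [hv]; simp
  obtain ⟨α₁, α₂, rfl, h1, h2⟩ := List.filter_eq_append_iff.1 hv'
  have h3 := A.top α₁.reverse α₂ (by simp)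
  have h4 := A.vert
  have h5 := count_verts (Or.inl rfl) α₂
  have h6 := count_verts (Or.inr rfl) α₂
  rw [verts, h2] at h5 h6
  simp at h3 h4 h5 h6
  omega

theorem exists_twice (A : Arcs α ρ) {a b c : ℕ} (ha : 1 ≤ a) (hb : 2 ≤ b)
    (hv : verts α = List.replicate a Step.U ++ Step.D :: (List.replicate b Step.U ++ Step.D ::
      List.replicate c Step.U)) : ∃ σ, Twice σ .left 0 (α.reverse, ρ) := by
  have ha2 := two_le_of_verts_eq A ha (by omega) hv
  have hc := one_le_of_verts_eq A hv
  obtain ⟨a, rfl⟩ : ∃ a', a = a' + 1 + 1 := ⟨a - 2, by omega⟩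
  obtain ⟨b, rfl⟩ : ∃ b', b = b' + 1 + 1 := ⟨b - 2, by omega⟩
  obtain ⟨c, rfl⟩ : ∃ c', c = c' + 1 := ⟨c - 1, by omega⟩
  have h1 := readRow_start A hv
  rw [List.append_eq, List.replicate_succ', List.append_assoc] at h1
  have h2 := ReadRow.indent A growData_once (ReadRow.climb A growData_plain h1)
  rw [List.append_eq, List.replicate_succ', List.append_assoc] at h2
  have h3 := ReadRow.indent A growData_twice (ReadRow.climb A growData_once h2)
  exact ReadRow.close A (ReadRow.climb A growData_twice (by rw [List.append_nil]; exact h3))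

theorem exists_double (A : Arcs α ρ) {a c : ℕ} (ha : 1 ≤ a)
    (hv : verts α = List.replicate a Step.U ++ Step.D :: (List.replicate 1 Step.U ++ Step.D ::
      List.replicate c Step.U)) : ∃ σ, Double σ .left 0 (α.reverse, ρ) := by
  have ha2 := two_le_of_verts_eq A ha le_rfl hv
  have hc := one_le_of_verts_eq A hv
  obtain ⟨a, rfl⟩ : ∃ a', a = a' + 1 + 1 := ⟨a - 2, by omega⟩
  obtain ⟨c, rfl⟩ : ∃ c', c = c' + 1 := ⟨c - 1, by omega⟩
  have h1 := readRow_start A hv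
  rw [List.append_eq, List.replicate_succ', List.append_assoc] at h1
  have h2 := ReadRow.double A growData_double (ReadRow.climb A growData_plain h1)
  exact ReadRow.close A (ReadRow.climb A growData_double (by rw [List.append_nil]; exact h2))

end

section

/-! ### The arcs of a polygon -/

theorem pos_succ {w : List Step} {i : ℕ} (hi : i < w.length) :
    pos w (i + 1) = pos w i + w[i].vec := by
  rw [pos_eq_endp, pos_eq_endp, List.take_succ_eq_append_getElem hi, endp_append]
  simp [endp]

theorem exists_descent {f : ℕ → ℤ} {v : ℤ} {N n : ℕ} (hn : N ≤ n) (hN : v < f N) (hv : f n ≤ v) :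
    ∃ e, N ≤ e ∧ e < n ∧ v < f e ∧ f (e + 1) ≤ v := by
  induction n, hn using Nat.le_induction with
  | base => omega
  | succ n hn ih =>
    by_cases h : f n ≤ v
    · obtain ⟨e, h1, h2, h3⟩ := ih h
      exact ⟨e, h1, by omega, h3⟩
    · exact ⟨n, hn, by omega, by omega, hv⟩

/-- A polygon whose boundary word does not go up after index `N`, where it is at the top. -/
structure Split (w : List Step) (N : ℕ) : Prop where
  poly : IsRootedPolygon w
  le : N ≤ w.length
  one_lt : 1 < N
  down : Step.U ∉ w.drop N
  top : ∀ i ≤ w.length, (pos w i).2 ≤ (pos w N).2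

variable {w : List Step} {N : ℕ}

theorem Split.getElem_ne (H : Split w N) {j : ℕ} (hN : N ≤ j) (hj : j < w.length) :
    w[j] ≠ Step.U := by
  intro h
  refine H.down ?_
  rw [List.mem_iff_getElem]
  refine ⟨j - N, by simp; omega, ?_⟩
  rw [List.getElem_drop]
  convert h using 2
  omega

theorem pos_one (H : IsRootedPolygon w) : pos w 1 = (0, 1) := by
  have h := H.start
  cases w with
  | nil => cases h
  | cons s w =>
    cases h
    simp [pos, Step.vec]

/-- A final down step would start at `(0, 1)`, which is already the vertex of index `1`. -/
theorem Split.not_last (H : Split w N) {e : ℕ} (hN : N ≤ e) (he : e < w.length)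
    (hD : w[e] = Step.D) : e + 1 < w.length := by
  by_contra! hlt
  have h1 := pos_succ he
  rw [show e + 1 = w.length by omega, H.poly.closed, hD] at h1
  have h2 := H.one_lt
  refine H.poly.simple 1 e (by omega) he ?_
  rw [pos_one H.poly, ← sub_eq_iff_eq_add.2 h1]
  simp [Step.vec]

theorem Split.step_right (H : Split w N) {j : ℕ} (hN : N ≤ j) (hj : j < w.length) :
    ((pos w (j + 1)).2 = (pos w j).2 ∧ (pos w (j + 1)).1 ≤ (pos w j).1 + 1 ∧
      (pos w j).1 ≤ (pos w (j + 1)).1 + 1) ∨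
    ((pos w (j + 1)).2 = (pos w j).2 - 1 ∧ (pos w (j + 1)).1 = (pos w j).1 ∧
      j + 1 < w.length) := by
  have h1 := pos_succ hj
  have h2 := H.getElem_ne hN hj
  have h3 := H.not_last hN hj
  rw [h1]
  cases h : w[j] with
  | U => exact (h2 h).elim
  | D =>
    right
    refine ⟨?_, ?_, h3 h⟩ <;> simp [Step.vec] <;> ring
  | L =>
    left
    refine ⟨?_, ?_, ?_⟩ <;> simp [Step.vec]
  | R =>
    left
    refine ⟨?_, ?_, ?_⟩ <;> simp [Step.vec]
    omega

/-- There is a down step of the right arc across every row. -/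
theorem Split.exists_down (H : Split w N) {v : ℤ} (h0 : 0 ≤ v) (h1 : v < (pos w N).2) :
    ∃ e, N ≤ e ∧ e + 1 < w.length ∧ (pos w e).2 = v + 1 ∧ (pos w (e + 1)).2 = v ∧
      (pos w (e + 1)).1 = (pos w e).1 := by
  obtain ⟨e, he, hen, h2, h3⟩ := exists_descent (f := fun i => (pos w i).2) H.le h1
    (by simp only [H.poly.closed]; exact h0)
  rcases H.step_right he hen with h4 | h4
  · omega
  · exact ⟨e, he, h4.2.2, by omega, by omega, h4.2.1⟩

theorem Split.antitone (H : Split w N) {j j' : ℕ} (hN : N ≤ j) (hj : j ≤ j') (hj' : j' < w.length) :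
    (pos w j').2 ≤ (pos w j).2 := by
  induction j', hj using Nat.le_induction with
  | base => exact le_rfl
  | succ k hk ih =>
    have h1 := ih (by omega)
    have h2 := H.step_right (hN.trans hk) (by omega)
    omega

/-- Between two of its vertices of equal height the right arc moves horizontally by unit steps, so
it cannot jump over a vertex of the left arc. -/
theorem Split.lt_iff (H : Split w N) {i : ℕ} (hi : i < N) {j j' : ℕ} (hN : N ≤ j) (hj : j ≤ j')
    (hj' : j' < w.length) (h1 : (pos w i).2 = (pos w j).2) (h2 : (pos w i).2 = (pos w j').2) :
    (pos w i).1 < (pos w j).1 ↔ (pos w i).1 < (pos w j').1 := by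
  induction j', hj using Nat.le_induction with
  | base => rfl
  | succ k hk ih =>
    have h3 := H.antitone hN hk (by omega)
    have h4 : (pos w (k + 1)).2 ≤ _ := H.antitone (hN.trans hk) (Nat.le_succ k) hj'
    rw [ih (by omega) (by omega)]
    have h5 := H.step_right (hN.trans hk) (by omega)
    have h6 := H.poly.simple i k (by omega) (by omega)
    have h7 := H.poly.simple i (k + 1) (by omega) (by omega)
    rw [ne_eq, Prod.ext_iff] at h6 h7
    omega

theorem Split.lt_of_lt (H : Split w N) {i : ℕ} (hi : i < N) {j j' : ℕ} (hN : N ≤ j) (hN' : N ≤ j')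
    (hj : j < w.length) (hj' : j' < w.length) (h1 : (pos w i).2 = (pos w j).2)
    (h2 : (pos w i).2 = (pos w j').2) (h : (pos w i).1 < (pos w j).1) :
    (pos w i).1 < (pos w j').1 := by
  rcases le_total j j' with hjj | hjj
  · exact (H.lt_iff hi hN hjj hj' h1 h2).1 h
  · exact (H.lt_iff hi hN' hjj hj h2 h1).2 h

/-- The left arc is to the left of the right arc. -/
theorem Split.leftOf (H : Split w N) {i : ℕ} (h1 : 1 ≤ i) (hi : i < N) {j : ℕ} (hN : N ≤ j)
    (hj : j < w.length) (hy : (pos w i).2 = (pos w j).2) : (pos w i).1 < (pos w j).1 := by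
  induction i, h1 using Nat.le_induction generalizing j with
  | base =>
    have h2 := H.poly.simple 1 j (by omega) hj
    have h3 := (H.poly.nonneg j hj.le).1
    rw [ne_eq, Prod.ext_iff] at h2
    rw [pos_one H.poly] at h2 hy ⊢
    simp only at h2 hy ⊢
    omega
  | succ i h1 ih =>
    have hle := H.le
    have h2 := pos_succ (w := w) (i := i) (by omega)
    have h3 := H.poly.simple (i + 1) j (by omega) hj
    rw [ne_eq, Prod.ext_iff] at h3
    have hn := H.poly.nonneg i (by omega)
    have hn' := H.poly.nonneg (i + 1) (by omega)
    have ht := H.top i (by omega)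
    have ht' := H.top (i + 1) (by omega)
    cases hs : w[i] with
    | U =>
      rw [hs, Prod.ext_iff] at h2
      simp only [Step.vec, Prod.fst_add, Prod.snd_add] at h2
      -- A down step of the right arc across the same row carries the comparison from one height to
      -- the other.
      obtain ⟨e, he, hen, e1, e2, e3⟩ := H.exists_down (v := (pos w i).2) (by omega) (by omega)
      have h4 := ih (by omega) (j := e + 1) (by omega) hen (by omega)
      exact H.lt_of_lt hi he hN (by omega) hj (by omega) hy (by omega)
    | D =>
      rw [hs, Prod.ext_iff] at h2
      simp only [Step.vec, Prod.fst_add, Prod.snd_add] at h2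
      obtain ⟨e, he, hen, e1, e2, e3⟩ :=
        H.exists_down (v := (pos w (i + 1)).2) (by omega) (by omega)
      have h4 := ih (by omega) (j := e) (by omega) (by omega) (by omega)
      exact H.lt_of_lt hi (j := e + 1) (by omega) hN (by omega) hj (by omega) hy (by omega)
    | L =>
      rw [hs, Prod.ext_iff] at h2
      simp only [Step.vec, Prod.fst_add, Prod.snd_add] at h2
      have h4 := ih (by omega) hN hj (by omega)
      omega
    | R =>
      rw [hs, Prod.ext_iff] at h2
      simp only [Step.vec, Prod.fst_add, Prod.snd_add] at h2
      have h4 := ih (by omega) hN hj (by omega)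
      omega

/-- The right arc meets every height. -/
theorem Split.exists_right (H : Split w N) {i : ℕ} (hi : i ≤ w.length) :
    ∃ j, N ≤ j ∧ j < w.length ∧ (pos w j).2 = (pos w i).2 := by
  have h1 := H.poly.nonneg i hi
  have h2 := H.top i hi
  have hle := H.le
  rcases h1.2.lt_or_eq with h3 | h3
  · obtain ⟨e, he, hen, e1, -⟩ := H.exists_down (v := (pos w i).2 - 1) (by omega) (by omega)
    exact ⟨e, he, by omega, by omega⟩
  · have h4 := H.top 1 (by have := H.one_lt; omega)
    rw [pos_one H.poly] at h4
    simp only at h4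
    obtain ⟨e, he, hen, -, e2, -⟩ := H.exists_down (v := 0) le_rfl (by omega)
    exact ⟨e + 1, by omega, hen, by omega⟩

theorem length_le_of_eq {a T : List Step} (hw : w = a ++ T) : a.length ≤ w.length := by
  rw [hw]
  simp

theorem pos_length_eq_neg_endp (H : IsRootedPolygon w) {a T : List Step} (hw : w = a ++ T) :
    pos w a.length = -endp T := by
  have h := H.closed
  rw [pos_eq_endp, List.take_length, hw, endp_append] at h
  rw [pos_eq_endp, hw, List.take_left' rfl]
  exact eq_neg_of_add_eq_zero_left h

theorem Split.ne_nil_of_eq (H : Split w N) {a T : List Step} (hw : w = a ++ Step.D :: T)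
    (ha : N ≤ a.length) : T ≠ [] := by
  rintro rfl
  have h1 : w.length = a.length + 1 := by rw [hw]; simp
  have h2 := H.not_last ha (by omega) (by simp [hw])
  omega

theorem no_backtrack (H : IsRootedPolygon w) {s t : Step} (hst : s.vec + t.vec = 0)
    (a b : List Step) : w ≠ a ++ s :: t :: b := by
  intro hw
  have h1 : pos w a.length = endp a := by rw [pos_eq_endp, hw, List.take_left' rfl]
  have h2 : pos w (a.length + 2) = endp a := by
    rw [pos_eq_endp, hw, show a ++ s :: t :: b = (a ++ [s, t]) ++ b by simp,
      List.take_left' (by simp), endp_append]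
    simp [endp, hst]
  have hlen : w.length = a.length + 2 + b.length := by rw [hw]; simp; omega
  have h4 := H.four_le
  rcases Nat.eq_zero_or_pos b.length with hb | hb
  · refine H.simple 0 a.length (by omega) (by omega) ?_
    rw [h1, ← h2, show a.length + 2 = w.length by omega, H.closed]
    rfl
  · exact H.simple a.length (a.length + 2) (by omega) (by omega) (by rw [h1, h2])

theorem exists_height_eq (w : List Step) (H : IsRootedPolygon w) :
    (∀ i ≤ w.length, (pos w i).2 ≤ height w) ∧ ∃ i ≤ w.length, (pos w i).2 = height w := by
  constructor
  · intro i hi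
    have h1 := Finset.le_sup (f := fun i => (pos w i).2.toNat)
      (Finset.mem_range.2 (Nat.lt_succ_of_le hi))
    have h2 : (pos w i).2.toNat ≤ height w := h1
    omega
  · obtain ⟨i, hi, h1⟩ := Finset.exists_mem_eq_sup (Finset.range (w.length + 1)) (by simp)
      (fun i => (pos w i).2.toNat)
    have hi' : i ≤ w.length := by simpa [Nat.lt_succ_iff] using hi
    refine ⟨i, hi', ?_⟩
    have h2 := (H.nonneg i hi').2
    have h3 : height w = (pos w i).2.toNat := h1
    omega

theorem exists_width_eq (w : List Step) (H : IsRootedPolygon w) :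
    (∀ i ≤ w.length, (pos w i).1 ≤ width w) ∧ ∃ i ≤ w.length, (pos w i).1 = width w := by
  constructor
  · intro i hi
    have h1 := Finset.le_sup (f := fun i => (pos w i).1.toNat)
      (Finset.mem_range.2 (Nat.lt_succ_of_le hi))
    have h2 : (pos w i).1.toNat ≤ width w := h1
    omega
  · obtain ⟨i, hi, h1⟩ := Finset.exists_mem_eq_sup (Finset.range (w.length + 1)) (by simp)
      (fun i => (pos w i).1.toNat)
    have hi' : i ≤ w.length := by simpa [Nat.lt_succ_iff] using hi
    refine ⟨i, hi', ?_⟩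
    have h2 := (H.nonneg i hi').1
    have h3 : width w = (pos w i).1.toNat := h1
    omega

theorem exists_leftArc_eq (w : List Step) (H : IsRootedPolygon w) :
    ∃ N ≤ w.length, leftArc w = w.take N ∧ (pos w N).2 = height w ∧
      ∀ i ≤ w.length, (pos w i).2 = height w → i ≤ N := by
  obtain ⟨i, hi, h1⟩ := (exists_height_eq w H).2
  have hne : ((Finset.range (w.length + 1)).filter fun i => (pos w i).2 = (height w : ℤ)).Nonempty :=
    ⟨i, by simpa [Nat.lt_succ_iff] using ⟨hi, h1⟩⟩
  obtain ⟨N, hN, h2⟩ := Finset.exists_mem_eq_sup _ hne id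
  rw [Finset.mem_filter, Finset.mem_range] at hN
  refine ⟨N, by omega, by rw [leftArc, h2]; rfl, hN.2, fun i hi h3 => ?_⟩
  have h4 := Finset.le_sup (f := id) ((Finset.mem_filter
    (p := fun i => (pos w i).2 = height w)).2 ⟨Finset.mem_range.2 (Nat.lt_succ_of_le hi), h3⟩)
  rw [h2] at h4
  exact h4

/-- The arcs of a polygon whose excess perimeter is due to two down steps on the left arc. -/
theorem arcs_of_unimodal (hw : IsUnimodal 2 w) (hD : (leftArc w).count Step.D = 2) :
    ∃ ρ, w = leftArc w ++ ρ ∧ Arcs (leftArc w) ρ ∧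
      ((∃ i ≤ w.length, pos w i = ((width w : ℤ), (height w : ℤ))) → Step.R ∉ ρ) := by
  obtain ⟨H, hlen⟩ := hw
  obtain ⟨N, hN, hα, hyN, hlast⟩ := exists_leftArc_eq w H
  obtain ⟨hWle, i₀, hi₀, hxi₀⟩ := exists_width_eq w H
  have hHle := (exists_height_eq w H).1
  have hsplit : w = w.take N ++ w.drop N := (List.take_append_drop N w).symm
  have hcl := H.closed
  rw [pos_eq_endp, List.take_length, endp_eq, Prod.mk_eq_zero] at hcl
  have hlenc := length_eq_counts w
  rw [pos_eq_endp, endp_eq] at hyN hxi₀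
  simp only at hyN hxi₀
  rw [hα] at hD
  have hcount : ∀ s, w.count s = (w.take N).count s + (w.drop N).count s := by
    intro s
    rw [← List.count_append, List.take_append_drop]
  have hcount₀ : ∀ s, w.count s = (w.take i₀).count s + (w.drop i₀).count s := by
    intro s
    rw [← List.count_append, List.take_append_drop]
  have cU := hcount Step.U
  have cD := hcount Step.D
  have cR := hcount Step.R
  have cL := hcount Step.L
  have cR₀ := hcount₀ Step.R
  have cL₀ := hcount₀ Step.L
  -- Reaching the top despite two down steps takes `height + 2` up steps, the width takes as many
  -- right steps, and the walk closes up. This already exhausts the perimeter, so no further step is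
  -- available.
  have hUρ : Step.U ∉ w.drop N := by
    rw [← List.count_eq_zero]
    omega
  have hord : Ordered w := by
    refine ⟨w.take i₀, w.drop i₀, (List.take_append_drop i₀ w).symm, ?_, ?_⟩
    · rw [← List.count_eq_zero]
      omega
    · rw [← List.count_eq_zero]
      omega
  have hone : (1 : ℤ) ≤ height w := by
    have h1 := hHle 1 (by have := H.four_le; omega)
    rwa [pos_one H] at h1
  have hyN' : (pos w N).2 = height w := by rw [pos_eq_endp, endp_eq]; exact hyN
  have h1N : 1 < N := by
    have h1 := List.count_le_length (a := Step.D) (l := w.take N)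
    have h2 : (w.take N).length ≤ N := by simp
    have h3 : (w.take N).length = (w.take N).count Step.U + _ + _ + _ := length_eq_counts _
    omega
  have HS : Split w N := ⟨H, hN, h1N, hUρ, by rw [hyN']; exact hHle⟩
  have hNlt : N < w.length := by
    rcases hN.lt_or_eq with h | h
    · exact h
    · rw [h, H.closed] at hyN'
      simp at hyN'
      omega
  -- A left step on the left arc would mean that the left arc has already touched the right side;
  -- the right arc would then pass beyond that side at the same height.
  have hLα : Step.L ∉ w.take N := by
    intro hL
    obtain ⟨w₁, w₂, hw12, hw1, hw2⟩ := hord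
    have hlt : w₁.length < N := by
      by_contra! hle
      rw [hw12, List.take_append_of_le_length hle] at hL
      exact hw1 (List.mem_of_mem_take hL)
    have hx1 : pos w w₁.length = endp w₁ := by rw [pos_eq_endp, hw12, List.take_left' rfl]
    have hc1 : w.count Step.R = w₁.count Step.R := by
      rw [hw12, List.count_append, List.count_eq_zero.2 hw2, add_zero]
    obtain ⟨i, hi1, hiN, hxi⟩ : ∃ i, 1 ≤ i ∧ i < N ∧ (width w : ℤ) ≤ (pos w i).1 := by
      rcases Nat.eq_zero_or_pos w₁.length with h0 | h0
      -- Here the width is zero. Index `1` serves as witness because `Split.leftOf` excludes the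
      -- origin.
      · refine ⟨1, le_rfl, h1N, ?_⟩
        rw [List.length_eq_zero_iff.1 h0] at hc1
        rw [pos_one H]
        simp at hc1 ⊢
        omega
      · refine ⟨w₁.length, h0, hlt, ?_⟩
        rw [hx1, endp_eq, List.count_eq_zero.2 hw1]
        simp
        omega
    obtain ⟨j, hNj, hj, hy⟩ := HS.exists_right (i := i) (by omega)
    have h1 := HS.leftOf hi1 hiN hNj hj hy.symm
    have h2 := hWle j hj.le
    omega
  have hOρ : Ordered (w.drop N) := by
    obtain ⟨w₁, w₂, hw12, hw1, hw2⟩ := hord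
    rw [hw12, List.drop_append]
    exact ⟨_, _, rfl, fun h => hw1 (List.mem_of_mem_drop h), fun h => hw2 (List.mem_of_mem_drop h)⟩
  refine ⟨w.drop N, by rw [hα, List.take_append_drop], ?_, ?_⟩
  · rw [hα]
    have hrl : ∀ a b, w.drop N ≠ a ++ Step.R :: Step.L :: b := fun a b hab =>
      no_backtrack H (s := Step.R) (t := Step.L) rfl (w.take N ++ a) b
        (by rw [List.append_assoc, ← hab, List.take_append_drop])
    have hhead : (w.drop N).head? = some Step.D := by
      rw [List.head?_drop, List.getElem?_eq_getElem hNlt, Option.some.injEq]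
      have h1 := hlast (N + 1) hNlt
      have h2 := pos_succ hNlt
      have h3 := HS.getElem_ne le_rfl hNlt
      cases hs : w[N] with
      | U => exact (h3 hs).elim
      | D => rfl
      | L =>
        rw [hs, Prod.ext_iff] at h2
        simp only [Step.vec, Prod.fst_add, Prod.snd_add] at h2
        omega
      | R =>
        rw [hs, Prod.ext_iff] at h2
        simp only [Step.vec, Prod.fst_add, Prod.snd_add] at h2
        omega
    refine ⟨hLα, hUρ, hOρ, ?_, ?_, hrl, ?_, ?_, hhead, ?_, by omega, ?_, ?_⟩
    · exact fun a b hab => no_backtrack H (s := Step.U) (t := Step.D) rfl a (b ++ w.drop N)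
        (by conv_lhs => rw [hsplit, hab]
            simp)
    · exact fun a b hab => no_backtrack H (s := Step.D) (t := Step.U) rfl a (b ++ w.drop N)
        (by conv_lhs => rw [hsplit, hab]
            simp)
    · intro Q M M' S hQ hS hQ0 hM0 hS0 hh
      have hQlen : (w.take N).length = Q.length + M.length := by rw [hQ]; simp
      rw [List.length_take, min_eq_left hN] at hQlen
      have hSlen : (w.drop N).length = M'.length + S.length := by rw [hS]; simp
      rw [List.length_drop] at hSlen
      have hQp := List.length_pos_iff.2 hQ0
      have hMp := List.length_pos_iff.2 hM0
      have hSp := List.length_pos_iff.2 hS0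
      have p1 : pos w Q.length = endp Q := by
        rw [pos_eq_endp, ← endp_reverse Q]
        conv_lhs => rw [hsplit, hQ, List.append_assoc, List.take_left' (by simp)]
      have p2 : pos w (N + M'.length) = -endp S := by
        have e1 : w = (w.take N ++ M') ++ S := by
          conv_lhs => rw [hsplit, hS]
          simp
        rw [← pos_length_eq_neg_endp H e1]
        congr 1
        simp
        omega
      have hLQ : Q.count Step.L = 0 := by
        rw [List.count_eq_zero]
        intro h
        exact hLα (by rw [hQ]; simp [h])
      have hUS : S.count Step.U = 0 := by
        rw [List.count_eq_zero]
        intro h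
        exact hUρ (by rw [hS]; simp [h])
      have h1 := HS.leftOf (i := Q.length) (by omega) (by omega) (j := N + M'.length) (by omega)
        (by omega)
      rw [p1, p2, endp_eq, endp_eq, Prod.neg_mk] at h1
      simp only at h1
      omega
    · intro Q M hQ
      have hQlen : (w.take N).length = Q.length + M.length := by rw [hQ]; simp
      rw [List.length_take, min_eq_left hN] at hQlen
      have p1 : pos w Q.length = endp Q := by
        rw [pos_eq_endp, ← endp_reverse Q]
        conv_lhs => rw [hsplit, hQ, List.append_assoc, List.take_left' (by simp)]
      have h1 := hHle Q.length (by omega)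
      rw [p1, endp_eq] at h1
      simp only at h1
      omega
    · rw [List.head?_take, if_neg (by omega), H.start]
    · have := List.count_eq_zero.2 hLα
      omega
    · have hDρ : Step.D ∈ w.drop N := List.mem_of_mem_head? hhead
      obtain ⟨M, T, hT, hDT⟩ := exists_last_down hDρ
      have hUT : Step.U ∉ T := fun h => hUρ (by rw [hT]; simp [h])
      have e1 : w = (w.take N ++ M) ++ Step.D :: T := by
        conv_lhs => rw [hsplit, hT]
        simp
      have hrun := eq_replicate_of_horizontal hUT hDT
        (fun a b hab hR => by
          rw [hT, hab] at hOρ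
          refine Ordered.notMem (a := M ++ Step.D :: a) (b := b) ?_ hR
          simpa using hOρ)
        (fun a b hab => hrl (M ++ Step.D :: a) b (by rw [hT, hab]; simp))
      have hTlen : T ≠ [] := by
        rintro rfl
        exact HS.ne_nil_of_eq e1 (by simp; omega) rfl
      have hTp := List.length_pos_iff.2 hTlen
      refine ⟨M, T.length, hTp, ?_⟩
      rcases hrun with hrun | hrun
      · rw [hT]
        congr 2
      -- A final run of right steps into the origin would start at a negative abscissa.
      · have e2 : w = ((w.take N ++ M) ++ [Step.D]) ++ T := by
          conv_lhs => rw [e1]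
          simp
        have h1 := pos_length_eq_neg_endp H e2
        have h2 := (H.nonneg _ (length_le_of_eq e2)).1
        rw [h1, hrun, endp_eq] at h2
        simp [List.count_replicate] at h2
        exact (hTlen h2).elim
  · rintro ⟨i, hi, hp⟩
    -- The top-right corner comes no later than the end of the left arc, so all right steps lie on
    -- the left arc.
    have h1 : i ≤ N := hlast i hi (by rw [hp])
    rw [pos_eq_endp, endp_eq, Prod.mk.injEq] at hp
    have h2 : (w.take i).count Step.R ≤ (w.take N).count Step.R :=
      (List.take_sublist_take_left h1).count_le _
    rw [← List.count_eq_zero]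
    omega

end

section

/-! ### The generating functions of the polygons -/

/-- The boundary word of a closed pair. -/
def glue (c : Cfg) : List Step := c.1.reverse ++ c.2

/-- Gluing is injective because the place of the cut is recovered as the end of the left arc. -/
theorem genFun_glue {s : Set Cfg} (hs : ∀ c ∈ s, leftArc (glue c) = c.1.reverse ∧
    hsteps (glue c) = 2 * c.2.count Step.L ∧ vsteps (glue c) = 2 * c.1.count Step.U) :
    genFun (glue '' s) = gfs s := by
  ext n
  change (({w ∈ glue '' s | hsteps w = 2 * n 0 ∧ vsteps w = 2 * n 1}.ncard : ℕ) : ℚ) = _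
  rw [coeff_gfs]
  have h1 : {w ∈ glue '' s | hsteps w = 2 * n 0 ∧ vsteps w = 2 * n 1} =
      glue '' {c ∈ s | wt c = n} := by
    ext w
    simp only [Set.mem_ofPred_eq, Set.mem_image, wt_eq_iff]
    constructor
    · rintro ⟨⟨c, hc, rfl⟩, h2, h3⟩
      have h4 := hs c hc
      exact ⟨c, ⟨hc, by omega, by omega⟩, rfl⟩
    · rintro ⟨c, ⟨hc, h2, h3⟩, rfl⟩
      have h4 := hs c hc
      exact ⟨⟨c, hc, rfl⟩, by omega, by omega⟩
  rw [h1, Set.InjOn.ncard_image]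
  rintro c hc c' hc' heq
  have h2 : c.1 = c'.1 := by
    rw [← List.reverse_inj, ← (hs c hc.1).1, ← (hs c' hc'.1).1, heq]
  have h3 : c.2 = c'.2 := by
    simpa [glue, h2] using heq
  exact Prod.ext h2 h3

variable {base : ℕ → Cfg → Prop} {h : Stage → ℕ → Cfg → Prop}

theorem Grow.glue_steps (H : GeoData base h) {σ : Stage} {c : Cfg}
    (hc : Grow base h σ .left 0 c) : leftArc (glue c) = c.1.reverse ∧
    hsteps (glue c) = 2 * c.2.count Step.L ∧ vsteps (glue c) = 2 * c.1.count Step.U := by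
  obtain ⟨-, -, h3, -, h5⟩ := Grow.polygon H hc
  obtain ⟨g1, g2, g3, -⟩ := (Grow.shape H.toGrowData hc).1
  refine ⟨h3, ?_, ?_⟩
  · simp only [hsteps, glue, List.count_append, List.count_reverse]
    omega
  · simp only [vsteps, glue, List.count_append, List.count_reverse]
    omega

theorem Grow.unimodal (H : GeoData base h) {σ : Stage} {c : Cfg}
    (hc : Grow base h σ .left 0 c) (hD : c.1.count Step.D = 2) : IsUnimodal 2 (glue c) := by
  obtain ⟨h1, h2, h3, h4, h5⟩ := Grow.polygon H hc
  obtain ⟨g1, g2, g3, -⟩ := (Grow.shape H.toGrowData hc).1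
  refine ⟨h1, ?_⟩
  rw [length_eq_counts]
  simp only [glue, List.count_append, List.count_reverse] at h2 h4 ⊢
  rw [h2]
  omega

theorem Grow.staircase (H : GeoData base h) {c : Cfg}
    (hc : Grow base h .inc .left 0 c) (hD : c.1.count Step.D = 2) : IsStaircase 2 (glue c) := by
  refine ⟨hc.unimodal H hD, c.1.length, by simp [glue], ?_⟩
  obtain ⟨h1, h2, h3, h4, h5⟩ := Grow.polygon H hc
  obtain ⟨⟨g1, g2, g3, -⟩, g4, -⟩ := Grow.shape H.toGrowData hc
  have hR : c.2.count Step.R = 0 := by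
    rw [List.count_eq_zero]
    intro hm
    cases g4.1 hm
  have hw : width (glue c) = c.2.count Step.L := h2
  have hh : height (glue c) + c.1.count Step.D = c.1.count Step.U := h4
  rw [pos_eq_endp, glue, List.take_left' (by simp), endp_reverse, endp_eq, ← glue, Prod.mk.injEq]
  omega

/-- The vertical steps of the left arc. -/
def Pattern (w : List Step) (a b c : ℕ) : Prop :=
  verts (leftArc w) = List.replicate a Step.U ++ Step.D :: (List.replicate b Step.U ++ Step.D ::
    List.replicate c Step.U)

theorem twoVerticalIndents_iff (w : List Step) (k₁ k₂ : ℕ) : TwoVerticalIndents w k₁ k₂ ↔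
    ∃ a b c, 1 ≤ b ∧ Pattern w a b c ∧ k₁ + 1 = a ∧ k₂ + 2 = a + b := by
  simp only [TwoVerticalIndents, Pattern, verts, List.append_assoc, List.nil_append,
    List.cons_append]

/-- The heights `a - 1` and `a + b - 2` agree exactly when `b = 1`. -/
theorem exists_ne_iff (w : List Step) :
    (∃ k₁ k₂, TwoVerticalIndents w k₁ k₂ ∧ k₁ ≠ k₂) ↔
      ∃ a b c, 1 ≤ a ∧ 2 ≤ b ∧ Pattern w a b c := by
  simp only [twoVerticalIndents_iff]
  constructor
  · rintro ⟨k₁, k₂, ⟨a, b, c, hb, hp, h1, h2⟩, hne⟩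
    exact ⟨a, b, c, by omega, by omega, hp⟩
  · rintro ⟨a, b, c, ha, hb, hp⟩
    exact ⟨a - 1, a + b - 2, ⟨a, b, c, by omega, hp, by omega, by omega⟩, by omega⟩

theorem exists_iff (w : List Step) :
    (∃ k₁ k₂, TwoVerticalIndents w k₁ k₂) ↔
      (∃ a b c, 1 ≤ a ∧ 2 ≤ b ∧ Pattern w a b c) ∨ ∃ a c, 1 ≤ a ∧ Pattern w a 1 c := by
  simp only [twoVerticalIndents_iff]
  constructor
  · rintro ⟨k₁, k₂, a, b, c, hb, hp, h1, h2⟩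
    rcases hb.lt_or_eq with hb | rfl
    · exact Or.inl ⟨a, b, c, by omega, by omega, hp⟩
    · exact Or.inr ⟨a, c, by omega, hp⟩
  · rintro (⟨a, b, c, ha, hb, hp⟩ | ⟨a, c, ha, hp⟩)
    · exact ⟨a - 1, a + b - 2, a, b, c, by omega, hp, by omega, by omega⟩
    · exact ⟨a - 1, a - 1, a, 1, c, by omega, hp, by omega, by omega⟩

theorem verts_reverse (l : List Step) : verts l.reverse = (verts l).reverse :=
  List.filter_reverse

theorem pattern_of_verts {w Q : List Step} {l m n : ℕ} (hQ : leftArc w = Q.reverse)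
    (hv : verts Q = List.replicate l Step.U ++
      Step.D :: (List.replicate m Step.U ++ Step.D :: List.replicate n Step.U)) :
    Pattern w n m l := by
  rw [Pattern, hQ, verts_reverse, hv]
  simp

theorem Pattern.count {w : List Step} {a b c : ℕ} (hp : Pattern w a b c) :
    (leftArc w).count Step.D = 2 := by
  rw [← count_verts (Or.inr rfl), hp]
  simp [List.count_replicate]

theorem Pattern.middle_unique {w : List Step} {a b c a' b' c' : ℕ} (hp : Pattern w a b c)
    (hp' : Pattern w a' b' c') : b = b' := by
  have key : ∀ (n n' : ℕ) (v v' : List Step), List.replicate n Step.U ++ Step.D :: v =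
      List.replicate n' Step.U ++ Step.D :: v' → n = n' ∧ v = v' := by
    intro n
    induction n with
    | zero =>
      intro n' v v' heq
      cases n' with
      | zero => simpa using heq
      | succ n' => simp [List.replicate_succ] at heq
    | succ n ih =>
      intro n' v v' heq
      cases n' with
      | zero => simp [List.replicate_succ] at heq
      | succ n' =>
        simp only [List.replicate_succ, List.cons_append, List.cons.injEq, true_and] at heq
        obtain ⟨h1, h2⟩ := ih n' v v' heq
        exact ⟨by omega, h2⟩
  exact (key _ _ _ _ (key _ _ _ _ (hp.symm.trans hp')).2).1

theorem pattern_twice {σ : Stage} {c : Cfg} (hc : Twice σ .left 0 c) :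
    ∃ l m n, 1 ≤ l ∧ 2 ≤ m ∧ Pattern (glue c) l m n := by
  obtain ⟨l, m, n, -, hm, hn, hv⟩ := verts_twice hc
  exact ⟨n, m, l, hn, hm, pattern_of_verts (Grow.glue_steps geoData_twice hc).1 hv⟩

theorem pattern_double {σ : Stage} {c : Cfg} (hc : Double σ .left 0 c) :
    ∃ l n, 1 ≤ l ∧ Pattern (glue c) l 1 n := by
  obtain ⟨l, n, -, hn, hv⟩ := verts_double hc
  exact ⟨n, l, hn, pattern_of_verts (Grow.glue_steps geoData_double hc).1 hv⟩

theorem count_of_pattern {c : Cfg} {a b d : ℕ} (hc : leftArc (glue c) = c.1.reverse)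
    (hp : Pattern (glue c) a b d) : c.1.count Step.D = 2 := by
  rw [← hp.count, hc, List.count_reverse]

theorem unimodal_twice_iff (w : List Step) :
    (IsUnimodal 2 w ∧ ∃ a b c, 1 ≤ a ∧ 2 ≤ b ∧ Pattern w a b c) ↔
      ∃ c, (Twice .inc .left 0 c ∨ Twice .dec .left 0 c) ∧ glue c = w := by
  constructor
  · rintro ⟨hw, a, b, c, ha, hb, hp⟩
    obtain ⟨ρ, hρ, A, -⟩ := arcs_of_unimodal hw hp.count
    obtain ⟨σ, hσ⟩ := exists_twice A ha hb hp
    refine ⟨((leftArc w).reverse, ρ), ?_, by rw [glue, List.reverse_reverse, ← hρ]⟩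
    cases σ
    · exact Or.inl hσ
    · exact Or.inr hσ
  · rintro ⟨c, hc, rfl⟩
    obtain ⟨σ, hσ⟩ : ∃ σ, Twice σ .left 0 c := by
      rcases hc with hc | hc
      exacts [⟨_, hc⟩, ⟨_, hc⟩]
    have hp := pattern_twice hσ
    obtain ⟨l, m, n, -, -, hp'⟩ := hp
    exact ⟨Grow.unimodal geoData_twice hσ
      (count_of_pattern (Grow.glue_steps geoData_twice hσ).1 hp'), pattern_twice hσ⟩

theorem unimodal_double_iff (w : List Step) :
    (IsUnimodal 2 w ∧ ∃ a c, 1 ≤ a ∧ Pattern w a 1 c) ↔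
      ∃ c, (Double .inc .left 0 c ∨ Double .dec .left 0 c) ∧ glue c = w := by
  constructor
  · rintro ⟨hw, a, c, ha, hp⟩
    obtain ⟨ρ, hρ, A, -⟩ := arcs_of_unimodal hw hp.count
    obtain ⟨σ, hσ⟩ := exists_double A ha hp
    refine ⟨((leftArc w).reverse, ρ), ?_, by rw [glue, List.reverse_reverse, ← hρ]⟩
    cases σ
    · exact Or.inl hσ
    · exact Or.inr hσ
  · rintro ⟨c, hc, rfl⟩
    obtain ⟨σ, hσ⟩ : ∃ σ, Double σ .left 0 c := by
      rcases hc with hc | hc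
      exacts [⟨_, hc⟩, ⟨_, hc⟩]
    obtain ⟨l, n, -, hp'⟩ := pattern_double hσ
    exact ⟨Grow.unimodal geoData_double hσ
      (count_of_pattern (Grow.glue_steps geoData_double hσ).1 hp'), pattern_double hσ⟩

/-- The decreasing stage drops out, since it puts a right step on the right arc. -/
theorem staircase_twice_iff (w : List Step) :
    (IsStaircase 2 w ∧ ∃ a b c, 1 ≤ a ∧ 2 ≤ b ∧ Pattern w a b c) ↔
      ∃ c, Twice .inc .left 0 c ∧ glue c = w := by
  constructor
  · rintro ⟨⟨hw, hcorner⟩, a, b, c, ha, hb, hp⟩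
    obtain ⟨ρ, hρ, A, hR⟩ := arcs_of_unimodal hw hp.count
    obtain ⟨σ, hσ⟩ := exists_twice A ha hb hp
    refine ⟨((leftArc w).reverse, ρ), ?_, by rw [glue, List.reverse_reverse, ← hρ]⟩
    cases σ
    · exact hσ
    · exact (hR hcorner ((Grow.shape growData_twice hσ).2.1.2 rfl)).elim
  · rintro ⟨c, hσ, rfl⟩
    obtain ⟨l, m, n, -, -, hp'⟩ := pattern_twice hσ
    exact ⟨Grow.staircase geoData_twice hσ
      (count_of_pattern (Grow.glue_steps geoData_twice hσ).1 hp'), pattern_twice hσ⟩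

theorem staircase_double_iff (w : List Step) :
    (IsStaircase 2 w ∧ ∃ a c, 1 ≤ a ∧ Pattern w a 1 c) ↔
      ∃ c, Double .inc .left 0 c ∧ glue c = w := by
  constructor
  · rintro ⟨⟨hw, hcorner⟩, a, c, ha, hp⟩
    obtain ⟨ρ, hρ, A, hR⟩ := arcs_of_unimodal hw hp.count
    obtain ⟨σ, hσ⟩ := exists_double A ha hp
    refine ⟨((leftArc w).reverse, ρ), ?_, by rw [glue, List.reverse_reverse, ← hρ]⟩
    cases σ
    · exact hσ
    · exact (hR hcorner ((Grow.shape growData_double hσ).2.1.2 rfl)).elim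
  · rintro ⟨c, hσ, rfl⟩
    obtain ⟨l, n, -, hp'⟩ := pattern_double hσ
    exact ⟨Grow.staircase geoData_double hσ
      (count_of_pattern (Grow.glue_steps geoData_double hσ).1 hp'), pattern_double hσ⟩

theorem gfs_inc_union_dec (H : GrowData base h) :
    gfs ({c | Grow base h .inc .left 0 c} ∪ {c | Grow base h .dec .left 0 c}) =
      gf (Grow base h .inc .left) 0 + gf (Grow base h .dec .left) 0 := by
  refine gfs_union_of_bal (d := 0) rfl ?_ ?_
  · rintro c (hc | hc)
    · exact (Grow.shape H hc).1
    · exact (Grow.shape H hc).1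
  · rw [Set.disjoint_left]
    intro c hc hc'
    cases (Grow.shape H hc).2.1.1 ((Grow.shape H hc').2.1.2 rfl)

theorem gfs_twice_union_double {s t : Set Cfg} (hs : ∀ c ∈ s, ∃ σ, Twice σ .left 0 c)
    (ht : ∀ c ∈ t, ∃ σ, Double σ .left 0 c) : gfs (s ∪ t) = gfs s + gfs t := by
  refine gfs_union_of_bal (d := 0) rfl ?_ ?_
  · rintro c (hc | hc)
    · obtain ⟨σ, hσ⟩ := hs c hc
      exact (Grow.shape growData_twice hσ).1
    · obtain ⟨σ, hσ⟩ := ht c hc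
      exact (Grow.shape growData_double hσ).1
  · rw [Set.disjoint_left]
    intro c hc hc'
    obtain ⟨σ, hσ⟩ := hs c hc
    obtain ⟨σ', hσ'⟩ := ht c hc'
    obtain ⟨l, m, n, -, hm, hp⟩ := pattern_twice hσ
    obtain ⟨l', n', -, hp'⟩ := pattern_double hσ'
    have := hp.middle_unique hp'
    omega

theorem gf_twice_zero (σ : Stage) :
    gf (Twice σ .left) 0 = y ^ 5 * twice (expo (ratio σ) 1 1) := by
  rw [← gf_twice]
  exact gf_left_zero growData_twice σ

theorem gf_double_zero (σ : Stage) :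
    gf (Double σ .left) 0 = y ^ 4 * (I ^ 2 * dy (expo (ratio σ) 1 1)) := by
  rw [← gf_double]
  exact gf_left_zero growData_double σ

theorem gf_twice_inc : gf (Twice .inc .left) 0 = y ^ 5 * twice (divY SP) := by
  rw [gf_twice_zero, ← expo_one_one_one]
  rfl

theorem gf_twice_add : gf (Twice .inc .left) 0 + gf (Twice .dec .left) 0 =
    y ^ 5 * twice (x * Z) := by
  rw [gf_twice_zero, gf_twice_zero, ← expo_add_expo_dec, twice_add, mul_add]
  rfl

theorem gf_double_inc : gf (Double .inc .left) 0 = y ^ 4 * (I ^ 2 * dy (divY SP)) := by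
  rw [gf_double_zero, ← expo_one_one_one]
  rfl

theorem gf_double_add : gf (Double .inc .left) 0 + gf (Double .dec .left) 0 =
    y ^ 4 * (I ^ 2 * dy (x * Z)) := by
  rw [gf_double_zero, gf_double_zero, ← expo_add_expo_dec, dy_add, mul_add, mul_add]
  rfl

theorem half_smul_y_pow_five (f : Ser) :
    (1 / 2 : ℚ) • (y ^ 5 * dy (I ^ 2 * dy f)) = y ^ 5 * twice f := by
  rw [twice, mul_smul_comm]

/-- Differentiating the additional factor `y ^ 2` yields exactly the term for two indents in the
same row. -/
theorem half_smul_y_pow_three (f : Ser) : (1 / 2 : ℚ) • (y ^ 3 * dy ((y * I) ^ 2 * dy f)) =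
    y ^ 5 * twice f + y ^ 4 * (I ^ 2 * dy f) := by
  rw [twice, half_smul, half_smul, show (y * I) ^ 2 * dy f = y * (y * (I ^ 2 * dy f)) by ring,
    dy_y_mul, dy_y_mul]
  linear_combination y ^ 4 * I ^ 2 * dy f * two_mul_half

end

end AlmostConvex

end


open AlmostConvex in
theorem proposition2 :
    (genFun {w | IsStaircase 2 w ∧ ∃ k₁ k₂, TwoVerticalIndents w k₁ k₂ ∧ k₁ ≠ k₂} =
      (1 / 2 : ℚ) • (y ^ 5 * dy (I ^ 2 * dy (divY SP)))) ∧
    (genFun {w | IsUnimodal 2 w ∧ ∃ k₁ k₂, TwoVerticalIndents w k₁ k₂ ∧ k₁ ≠ k₂} =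
      (1 / 2 : ℚ) • (y ^ 5 * dy (I ^ 2 * dy (x * Z)))) ∧
    (genFun {w | IsStaircase 2 w ∧ ∃ k₁ k₂, TwoVerticalIndents w k₁ k₂} =
      (1 / 2 : ℚ) • (y ^ 3 * dy ((y * I) ^ 2 * dy (divY SP)))) ∧
    (genFun {w | IsUnimodal 2 w ∧ ∃ k₁ k₂, TwoVerticalIndents w k₁ k₂} =
      (1 / 2 : ℚ) • (y ^ 3 * dy ((y * I) ^ 2 * dy (x * Z)))) := by
  have hT : ∀ {σ c}, Twice σ .left 0 c → _ := fun hc => Grow.glue_steps geoData_twice hc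
  have hD : ∀ {σ c}, Double σ .left 0 c → _ := fun hc => Grow.glue_steps geoData_double hc
  refine ⟨?_, ?_, ?_, ?_⟩
  · rw [half_smul_y_pow_five, ← gf_twice_inc, gf,
      ← genFun_glue (s := {c | Twice .inc .left 0 c}) fun c hc => hT hc]
    congr 1
    ext w
    simp only [Set.mem_ofPred_eq, Set.mem_image, exists_ne_iff, staircase_twice_iff]
  · rw [half_smul_y_pow_five, ← gf_twice_add, Twice, ← gfs_inc_union_dec growData_twice,
      ← genFun_glue (by rintro c (hc | hc); exacts [hT hc, hT hc])]
    congr 1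
    ext w
    simp only [Set.mem_ofPred_eq, Set.mem_image, exists_ne_iff, unimodal_twice_iff, Set.mem_union,
      Twice]
  · rw [half_smul_y_pow_three, ← gf_twice_inc, ← gf_double_inc, gf, gf,
      ← gfs_twice_union_double (s := {c | Twice .inc .left 0 c}) (t := {c | Double .inc .left 0 c})
        (fun c hc => ⟨_, hc⟩) (fun c hc => ⟨_, hc⟩),
      ← genFun_glue (s := {c | Twice .inc .left 0 c} ∪ {c | Double .inc .left 0 c}) (by rintro c (hc | hc); exacts [hT hc, hD hc])]
    congr 1
    ext w
    simp only [Set.mem_ofPred_eq, Set.mem_image, exists_iff, and_or_left, staircase_twice_iff,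
      staircase_double_iff, Set.mem_union, or_and_right, exists_or]
  · rw [half_smul_y_pow_three, ← gf_twice_add, ← gf_double_add, Twice, Double,
      ← gfs_inc_union_dec growData_twice, ← gfs_inc_union_dec growData_double,
      ← gfs_twice_union_double (by rintro c (hc | hc); exacts [⟨_, hc⟩, ⟨_, hc⟩])
        (by rintro c (hc | hc); exacts [⟨_, hc⟩, ⟨_, hc⟩]),
      ← genFun_glue (by rintro c ((hc | hc) | (hc | hc)); exacts [hT hc, hT hc, hD hc, hD hc])]
    congr 1
    ext w
    simp only [Set.mem_ofPred_eq, Set.mem_image, exists_iff, and_or_left, unimodal_twice_iff,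
      unimodal_double_iff, Set.mem_union, or_and_right, exists_or, Twice, Double]
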